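/- Let $\ell\ge 1$ be an integer, $J\subseteq \mathbb Z/\ell\mathbb Z$, and $\theta\in\mathbb C^{\mathbb Z/\ell\mathbb Z}$ with $\sum_i\theta_i\neq 0$. **Standard parameters.** The affine Weyl group $W^{\mathrm{aff}}_\ell$ of type $\tilde A_{\ell-1}$ (trivial for $\ell=1$), with simple reflections $s_j$ ($j\in\mathbb Z/\ell\mathbb Z$), acts on $\mathbb C^{\mathbb Z/\ell\mathbb Z}$ by $s_j(\theta)_i=\theta_i-(2\delta_{i,j}-\delta_{i,j+1}-\delta_{i,j-1})\theta_j$. Assume $\theta$ is $J$-standard: the stabilizer of $\theta$ is the parabolic subgroup $W_J=\langle s_j : j\in J\rangle$, and $J=\{i:\theta_i=0\}$ (the latter is automatic if $\ell\ge2$). **Partitions.** Partitions are identified with Young diagrams; the box in row $r$ and column $s$ has $\ell$-residue $s-r \bmod \ell$. A box is removable if there is no box to its right and none below it. $\mu$ is a $J$-core if it has no removable box with residue in $J$; $\mathrm{Core}_J(\mu)$ is the $J$-core obtained from $\mu$ by successively deleting removable boxes with residue in $J$. The $\ell$-core of $\mu$ is obtained by repeatedly passing to a smaller diagram by deleting $\ell$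 boxes with $\ell$ different residues, as long as possible. For an $\ell$-core $\nu$, $\mathcal P_\nu[m]$ is the set of partitions of $m$ with $\ell$-core $\nu$. **Representations.** Let $\widehat Q_\ell$ be the quiver with vertices $\mathbb Z/\ell\mathbb Z\sqcup\{\infty\}$ and arrows $Y_i:i\to i+1$, $X_i:i+1\to i$ ($i\in\mathbb Z/\ell\mathbb Z$), $x:\infty\to0$, $y:0\to\infty$. Representations are finite-dimensional over $\mathbb C$. For $i\in J$, $L(\alpha_i)$ denotes the representation of dimension $1$ at $i$ and $0$ at the other vertices, with all arrows zero. For a partition $\mu$ with $k$ diagonal boxes, let $a_r$ (resp. $b_r$) be the number of boxes to the right of (resp. below) the box $(r,r)$, $1\le r\le k$; write $\theta_i=\theta_{i \bmod \ell}$ for $i\in\mathbb Z$ and $\beta_r=\sum_{i=-b_r}^{a_r}\theta_i$. The representation $A_\mu$ is $\mathbb C$ at $\infty$, and at $i\in\mathbb Z/\ell\mathbb Z$ it has basis the $v_{r,j}$ with $1\le r\le k$, $-b_r\le j\le a_r$, $j\equiv i \bmod \ell$. With the convention $v_{r,j}=0$ if $j\notin[-b_r,a_r]$, its maps are $$X v_{r,j}=v_{r,j-1},\qquad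 Y v_{r,j}=\begin{cases}\bigl(\sum_{i=-b_r}^{j}\theta_i\bigr)v_{r,j+1}+\sum_{t>r}\beta_t v_{t,j+1}, & j<0,\\ -\bigl(\sum_{i=j+1}^{a_r}\theta_i\bigr)v_{r,j+1}-\sum_{t<r}\beta_t v_{t,j+1}, & j\ge 0,\end{cases}$$ $$x(1)=\sum_{r=1}^k\beta_r v_{r,0},\qquad y(v_{r,0})=1,\qquad y(v_{r,j})=0\ \ (j\ne0).$$ Let $A'_\mu$ be the semisimplification of $A_\mu$, the direct sum of its Jordan–Hölder subquotients. **Theorem.** 1. If $\mu$ is a $J$-core, then $A_\mu$ is simple. 2. If $b$ is a removable box of $\mu$ with residue $i\in J$, there is a short exact sequence $0\to L(\alpha_i)\to A_\mu\to A_{\mu\setminus b}\to0$ or a short exact sequence $0\to A_{\mu\setminus b}\to A_\mu\to L(\alpha_i)\to0$. 3. For every partition $\mu$, with $\lambda=\mathrm{Core}_J(\mu)$, there is a decomposition into a direct sum of simple representations $A'_\mu\cong A_\lambda\oplus\bigoplus_{b\in\mu\setminus\lambda}L(\alpha_{\mathrm{res}(b)})$, where $\mathrm{res}(b)$ is the $\ell$-residue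 of $b$. 4. Let $\nu$ be an $\ell$-core, $n\ge0$, and $\mu_1,\mu_2\in\mathcal P_\nu[n\ell+|\nu|]$. Then $A'_{\mu_1}\cong A'_{\mu_2}$ if and only if $\mathrm{Core}_J(\mu_1)=\mathrm{Core}_J(\mu_2)$. -/

import Mathlib

noncomputable section

namespace CMQuiver

/-! ### Partitions, residues, cores

Partitions are Young diagrams; the box in line `r` and column `s` (counted from `0`) is `(r, s)`. -/

/-- The `ℓ`-residue `s - r mod ℓ` of the box `(r, s)`. -/
def residue (ℓ : ℕ) (b : ℕ × ℕ) : ZMod ℓ := (((b.2 : ℤ) - (b.1 : ℤ) : ℤ) : ZMod ℓ)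

/-- A box of `μ` is removable if it has no box on the right and no box below. -/
def IsRemovable (μ : YoungDiagram) (b : ℕ × ℕ) : Prop :=
  b ∈ μ ∧ (b.1 + 1, b.2) ∉ μ ∧ (b.1, b.2 + 1) ∉ μ

/-- The diagram `μ ∖ b` for a removable box `b`. -/
def eraseBox (μ : YoungDiagram) (b : ℕ × ℕ) (hb : IsRemovable μ b) : YoungDiagram where
  cells := μ.cells.erase b
  isLowerSet := by
    intro c d hdc hc
    have hc' := Finset.mem_erase.1 (Finset.mem_coe.1 hc)
    refine Finset.mem_coe.2 (Finset.mem_erase.2 ⟨?_, μ.isLowerSet hdc hc'.2⟩)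
    rintro rfl
    obtain ⟨c1, c2⟩ := c
    obtain ⟨d1, d2⟩ := d
    obtain ⟨-, h1, h2⟩ := hb
    obtain ⟨hle1, hle2⟩ := Prod.mk_le_mk.1 hdc
    have hcm : (c1, c2) ∈ μ := hc'.2
    rcases Nat.lt_or_ge d1 c1 with h | h
    · exact h1 (μ.up_left_mem (by simpa using h) hle2 hcm)
    · rcases Nat.lt_or_ge d2 c2 with h' | h'
      · exact h2 (μ.up_left_mem hle1 (by simpa using h') hcm)
      · exact hc'.1 (Prod.ext (le_antisymm h hle1) (le_antisymm h' hle2))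

/-- `μ` is a `J`-core if it has no removable box with residue in `J`. -/
def IsJCore {ℓ : ℕ} (J : Set (ZMod ℓ)) (μ : YoungDiagram) : Prop :=
  ∀ b, IsRemovable μ b → residue ℓ b ∉ J

/-- `μ'` is obtained from `μ` by removing one `J`-removable box. -/
def JStep {ℓ : ℕ} (J : Set (ZMod ℓ)) (μ μ' : YoungDiagram) : Prop :=
  ∃ (b : ℕ × ℕ) (hb : IsRemovable μ b), residue ℓ b ∈ J ∧ μ' = eraseBox μ b hb

theorem exists_coreJ {ℓ : ℕ} (J : Set (ZMod ℓ)) (μ : YoungDiagram) :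
    ∃ κ, Relation.ReflTransGen (JStep J) μ κ ∧ IsJCore J κ := by
  induction h : μ.card using Nat.strong_induction_on generalizing μ with
  | _ n ih =>
    by_cases hμ : IsJCore J μ
    · exact ⟨μ, .refl, hμ⟩
    · simp only [IsJCore, not_forall, not_not] at hμ
      obtain ⟨b, hb, hJ⟩ := hμ
      have hlt : (eraseBox μ b hb).card < n := by
        rw [← h]
        exact Finset.card_erase_lt_of_mem hb.1
      obtain ⟨κ, h1, h2⟩ := ih _ hlt (eraseBox μ b hb) rfl
      exact ⟨κ, .head ⟨b, hb, hJ, rfl⟩ h1, h2⟩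

/-- `Core_J(μ)`: the `J`-core obtained from `μ` by successively removing `J`-removable boxes.
It does not depend on the order of the removals, see `coreJ_unique`. -/
def coreJ {ℓ : ℕ} (J : Set (ZMod ℓ)) (μ : YoungDiagram) : YoungDiagram :=
  Classical.choose (exists_coreJ J μ)

theorem coreJ_le_of_reach {ℓ : ℕ} {J : Set (ZMod ℓ)} {μ κ lam : YoungDiagram}
    (hκ : Relation.ReflTransGen (JStep J) μ κ) (hlam : IsJCore J lam) (hle : lam ≤ μ) :
    lam ≤ κ := by
  induction hκ with
  | refl => exact hle
  | tail _ hstep ih =>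
    obtain ⟨b, hb, hJ, rfl⟩ := hstep
    intro c hc
    refine Finset.mem_erase.2 ⟨?_, ih hc⟩
    rintro rfl
    exact hlam c ⟨hc, fun h => hb.2.1 (ih h), fun h => hb.2.2 (ih h)⟩ hJ

theorem le_of_reach {ℓ : ℕ} {J : Set (ZMod ℓ)} {μ κ : YoungDiagram}
    (hκ : Relation.ReflTransGen (JStep J) μ κ) : κ ≤ μ := by
  induction hκ with
  | refl => exact le_rfl
  | tail _ hstep ih =>
    obtain ⟨b, hb, hJ, rfl⟩ := hstep
    exact fun c hc => ih (Finset.mem_of_mem_erase hc)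

theorem coreJ_unique {ℓ : ℕ} {J : Set (ZMod ℓ)} {μ κ : YoungDiagram}
    (hκ : Relation.ReflTransGen (JStep J) μ κ) (hcore : IsJCore J κ) : κ = coreJ J μ := by
  obtain ⟨h1, h2⟩ := Classical.choose_spec (exists_coreJ J μ)
  exact le_antisymm (coreJ_le_of_reach h1 hcore (le_of_reach hκ))
    (coreJ_le_of_reach hκ h2 (le_of_reach h1))

/-- `μ` is contained in `lam` and differs from it by `ℓ` boxes with `ℓ` different residues. -/
def EllStep (ℓ : ℕ) (lam μ : YoungDiagram) : Prop :=
  μ ≤ lam ∧ (lam.cells \ μ.cells).card = ℓ ∧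
    Set.InjOn (residue ℓ) ((lam.cells \ μ.cells : Finset (ℕ × ℕ)) : Set (ℕ × ℕ))

/-- `ℓ`-cores. -/
def IsEllCore (ℓ : ℕ) (lam : YoungDiagram) : Prop := ¬ ∃ μ, EllStep ℓ lam μ

/-- `ν` is the `ℓ`-core of `lam`: an `ℓ`-core obtained from `lam` by repeatedly removing `ℓ` boxes
with `ℓ` different residues. -/
def IsEllCoreOf (ℓ : ℕ) (ν lam : YoungDiagram) : Prop :=
  Relation.ReflTransGen (EllStep ℓ) lam ν ∧ IsEllCore ℓ ν

/-- `𝒫_ν[m]`: the partitions of `m` whose `ℓ`-core is `ν`. -/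
def partitionsWithCore (ℓ : ℕ) (ν : YoungDiagram) (m : ℕ) : Set YoungDiagram :=
  {lam | IsEllCoreOf ℓ ν lam ∧ lam.card = m}

/-! ### The affine Weyl group and standard parameters -/

/-- Labels of the simple reflections of `W_ℓ^aff`: all of `ℤ/ℓℤ` if `ℓ ≥ 2`, and none if `ℓ = 1`
(where `W_1^aff` is the trivial group). -/
abbrev SimpleIndex (ℓ : ℕ) : Type := {_i : ZMod ℓ // ℓ ≠ 1}

open Classical in
/-- The Coxeter matrix of the affine type `Ã_{ℓ-1}`: a cycle of length `ℓ`; for `ℓ = 2` the product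
of the two simple reflections has infinite order (encoded by `0`). -/
def affineMatrix (ℓ : ℕ) : CoxeterMatrix (SimpleIndex ℓ) where
  M := Matrix.of fun i j =>
    if i = j then 1 else if ℓ = 2 then 0
    else if j.1 = i.1 + 1 ∨ i.1 = j.1 + 1 then 3 else 2
  isSymm := by
    ext i j
    simp only [Matrix.transpose_apply, Matrix.of_apply, eq_comm (a := j) (b := i),
      or_comm (a := i.1 = j.1 + 1)]
  diagonal := by simp
  off_diagonal := by
    intro i j hij
    simp only [Matrix.of_apply, if_neg hij]
    split_ifs <;> decide

/-- The affine Weyl group `W_ℓ^aff`. -/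
abbrev AffineWeyl (ℓ : ℕ) : Type := (affineMatrix ℓ).Group

/-- Entries of the Cartan matrix of type `Ã_{ℓ-1}` (for `ℓ = 2` the off-diagonal ones are `-2`). -/
def cartan {ℓ : ℕ} (j i : ZMod ℓ) : ℂ :=
  (if i = j then 2 else 0) - (if i = j + 1 then 1 else 0) - (if i = j - 1 then 1 else 0)

/-- The operator `s_j` on `ℂ^{ℤ/ℓℤ}`: `s_j(θ)_i = θ_i - C_{ji} θ_j`. For `ℓ ≥ 3` it replaces `θ_j` by
`-θ_j`, adds `θ_j` to `θ_{j-1}` and `θ_{j+1}`, and fixes the other coordinates. -/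
def refl {ℓ : ℕ} (j : ZMod ℓ) : Module.End ℂ (ZMod ℓ → ℂ) where
  toFun θ := fun i => θ i - cartan j i * θ j
  map_add' θ η := by ext i; simp only [Pi.add_apply]; ring
  map_smul' c θ := by ext i; simp only [Pi.smul_apply, smul_eq_mul, RingHom.id_apply]; ring

theorem refl_apply {ℓ : ℕ} (j : ZMod ℓ) (θ : ZMod ℓ → ℂ) (i : ZMod ℓ) :
    refl j θ i = θ i - cartan j i * θ j := rfl

theorem cartan_self {ℓ : ℕ} (hℓ : ℓ ≠ 1) (i : ZMod ℓ) : cartan i i = 2 := by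
  have h1 : (1 : ZMod ℓ) ≠ 0 := by
    intro h
    have := (ZMod.natCast_eq_zero_iff 1 ℓ).1 (by simpa using h)
    exact hℓ (Nat.dvd_one.1 this)
  have h2 : ¬ (i = i + 1) := fun h => h1 (by simpa using h)
  have h3 : ¬ (i = i - 1) := fun h => h1 (by
    have := sub_eq_self.1 h.symm
    exact this)
  simp [cartan, h2, h3]

theorem cartan_succ {ℓ : ℕ} (hℓ : ℓ ≠ 1) (hℓ2 : ℓ ≠ 2) (i : ZMod ℓ) :
    cartan i (i + 1) = -1 ∧ cartan (i + 1) i = -1 := by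
  have h1 : (1 : ZMod ℓ) ≠ 0 := by
    intro h
    have := (ZMod.natCast_eq_zero_iff 1 ℓ).1 (by simpa using h)
    exact hℓ (Nat.dvd_one.1 this)
  have h2 : (1 : ZMod ℓ) + 1 ≠ 0 := by
    intro h
    have := (ZMod.natCast_eq_zero_iff 2 ℓ).1 (by
      push_cast; rw [← one_add_one_eq_two]; exact h)
    rcases (Nat.dvd_prime Nat.prime_two).1 this with h' | h'
    · exact hℓ h'
    · exact hℓ2 h'
  have h3 : ¬ (i + 1 = i - 1) := fun h => h2 (by
    have : i + (1 + 1) = i := by rw [← add_assoc, h]; ring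
    simpa using this)
  have h4 : ¬ (i = i + 1 + 1) := fun h => h2 (by
    have : i + (1 + 1) = i := by rw [← add_assoc]; exact h.symm
    simpa using this)
  constructor <;> simp [cartan, h1, h3, h4]

theorem cartan_far {ℓ : ℕ} {i j : ZMod ℓ} (hij : i ≠ j) (h1 : j ≠ i + 1) (h2 : i ≠ j + 1) :
    cartan i j = 0 := by
  have h3 : ¬ (j = i - 1) := fun h => h2 (by rw [h]; ring)
  simp [cartan, hij.symm, h1, h3]

theorem refl_liftable (ℓ : ℕ) :
    (affineMatrix ℓ).IsLiftable (fun i : SimpleIndex ℓ => refl i.1) := by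
  intro i j
  have hℓ : ℓ ≠ 1 := i.2
  have hii := cartan_self hℓ i.1
  have hjj := cartan_self hℓ j.1
  change (refl i.1 * refl j.1) ^ (if i = j then 1 else if ℓ = 2 then 0
    else if j.1 = i.1 + 1 ∨ i.1 = j.1 + 1 then 3 else 2) = 1
  split_ifs with h1 h2 h3
  · subst h1
    refine LinearMap.ext fun η => funext fun k => ?_
    simp only [pow_one, Module.End.mul_apply, refl_apply, hii,
      Module.End.one_apply]
    ring
  · simp
  · have hc : cartan i.1 j.1 = -1 ∧ cartan j.1 i.1 = -1 := by
      rcases h3 with h | h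
      · rw [h]; exact cartan_succ hℓ h2 _
      · rw [h]; exact (cartan_succ hℓ h2 _).symm
    refine LinearMap.ext fun η => funext fun k => ?_
    simp only [pow_succ, pow_zero, one_mul, Module.End.mul_apply, refl_apply,
      hii, hjj, hc.1, hc.2, Module.End.one_apply]
    ring
  · push Not at h3
    have hne : i.1 ≠ j.1 := fun h => h1 (Subtype.ext h)
    have hc1 := cartan_far hne h3.1 h3.2
    have hc2 := cartan_far hne.symm h3.2 h3.1
    refine LinearMap.ext fun η => funext fun k => ?_
    simp only [pow_succ, pow_zero, one_mul, Module.End.mul_apply, refl_apply,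
      hii, hjj, hc1, hc2, Module.End.one_apply]
    ring

/-- The linear action of `W_ℓ^aff` on `ℂ^{ℤ/ℓℤ}` in which the simple reflections act by `refl`. -/
def weylAction (ℓ : ℕ) : AffineWeyl ℓ →* Module.End ℂ (ZMod ℓ → ℂ) :=
  (affineMatrix ℓ).toCoxeterSystem.lift ⟨fun i => refl i.1, refl_liftable ℓ⟩

/-- The parabolic subgroup `W_J`, generated by the `s_i` with `i ∈ J`. -/
def parabolic {ℓ : ℕ} (J : Set (ZMod ℓ)) : Subgroup (AffineWeyl ℓ) :=
  Subgroup.closure ((affineMatrix ℓ).simple '' {i | i.1 ∈ J})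

/-- `θ` is `J`-standard: its stabilizer in `W_ℓ^aff` is `W_J`, and `J = {i | θ_i = 0}`. The second
condition follows from the first if `ℓ ≥ 2`; for `ℓ = 1`, where `W_J` is trivial for both subsets
`J`, it is what determines `J`. -/
def IsJStandard {ℓ : ℕ} (θ : ZMod ℓ → ℂ) (J : Set (ZMod ℓ)) : Prop :=
  (∀ w : AffineWeyl ℓ, weylAction ℓ w θ = θ ↔ w ∈ parabolic J) ∧ ∀ i, i ∈ J ↔ θ i = 0

/-! ### Representations of quivers -/

/-- Finite-dimensional complex representations of a quiver `Q`. -/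
structure QuiverRep (Q : Type) [Quiver.{0} Q] where
  V : Q → Type
  [grp : ∀ a, AddCommGroup (V a)]
  [mod : ∀ a, Module ℂ (V a)]
  [fin : ∀ a, FiniteDimensional ℂ (V a)]
  map : ∀ {a b : Q}, (a ⟶ b) → (V a →ₗ[ℂ] V b)

attribute [instance] QuiverRep.grp QuiverRep.mod QuiverRep.fin

namespace QuiverRep

variable {Q : Type} [Quiver.{0} Q]

/-- Morphisms of representations. -/
structure Hom (M N : QuiverRep Q) where
  app : ∀ a, M.V a →ₗ[ℂ] N.V a
  comm : ∀ {a b : Q} (f : a ⟶ b) (v : M.V a), app b (M.map f v) = N.map f (app a v)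

/-- Two representations are isomorphic. -/
def Isomorphic (M N : QuiverRep Q) : Prop :=
  ∃ e : Hom M N, ∀ a, Function.Bijective (e.app a)

/-- There is a short exact sequence `0 → L → M → N → 0`. -/
def HasShortExact (L M N : QuiverRep Q) : Prop :=
  ∃ (f : Hom L M) (g : Hom M N), ∀ a,
    Function.Injective (f.app a) ∧ Function.Exact (f.app a) (g.app a) ∧
      Function.Surjective (g.app a)

/-- Subrepresentations. -/
@[ext]
structure Subrep (M : QuiverRep Q) where
  carrier : ∀ a, Submodule ℂ (M.V a)
  map_mem : ∀ {a b : Q} (f : a ⟶ b) (v : M.V a), v ∈ carrier a → M.map f v ∈ carrier b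

instance (M : QuiverRep Q) : PartialOrder (Subrep M) :=
  PartialOrder.lift Subrep.carrier (fun _ _ h => Subrep.ext h)

instance (M : QuiverRep Q) : BoundedOrder (Subrep M) where
  top := ⟨fun _ => ⊤, fun _ _ _ => Submodule.mem_top⟩
  le_top _ := fun _ => le_top
  bot := ⟨fun _ => ⊥, fun f v hv => by
    rw [Submodule.mem_bot] at hv ⊢
    rw [hv, map_zero]⟩
  bot_le _ := fun _ => bot_le

/-- A representation is simple if it is nonzero and has no proper nonzero subrepresentation. -/
def IsSimple (M : QuiverRep Q) : Prop := IsSimpleOrder (Subrep M)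

/-- The subquotient `P / N` of `M`, for subrepresentations `N ≤ P`. -/
def subquotient {M : QuiverRep Q} (N P : Subrep M) : QuiverRep Q where
  V a := P.carrier a ⧸ (N.carrier a).submoduleOf (P.carrier a)
  map {a b} f := Submodule.mapQ _ _
    ((M.map f).restrict (p := P.carrier a) (q := P.carrier b) (P.map_mem f))
    (fun v hv => N.map_mem f v.1 hv)

/-- The direct sum of two representations. -/
def prod (M N : QuiverRep Q) : QuiverRep Q where
  V a := M.V a × N.V a
  map f := (M.map f).prodMap (N.map f)

/-- The direct sum of a finite family of representations. -/
def directSum {ι : Type} [Finite ι] (M : ι → QuiverRep Q) : QuiverRep Q where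
  V a := ∀ i, (M i).V a
  map f := LinearMap.pi fun i => (M i).map f ∘ₗ LinearMap.proj i

/-- A composition series `0 = F_0 ⋖ F_1 ⋖ ⋯ ⋖ F_n = M`. -/
structure CompSeries (M : QuiverRep Q) where
  length : ℕ
  F : Fin (length + 1) → Subrep M
  head : F 0 = ⊥
  last : F (Fin.last length) = ⊤
  step : ∀ i : Fin length, F i.castSucc ⋖ F i.succ

theorem nonempty_compSeries [Finite Q] (M : QuiverRep Q) : Nonempty (CompSeries M) := by
  have hmono : StrictMono (Subrep.carrier : Subrep M → ∀ a, Submodule ℂ (M.V a)) :=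
    fun _ _ h => h
  have : WellFoundedLT (Subrep M) := hmono.wellFoundedLT
  have : WellFoundedLT (∀ a, (Submodule ℂ (M.V a))ᵒᵈ) := inferInstance
  have : WellFoundedGT (∀ a, Submodule ℂ (M.V a)) := ⟨this.wf⟩
  have : WellFoundedGT (Subrep M) := hmono.wellFoundedGT
  obtain ⟨s, h0, n, hn, hs⟩ := exists_covBy_seq_of_wellFoundedLT_wellFoundedGT (Subrep M)
  exact ⟨⟨n, fun i => s i, h0.eq_bot, hn.eq_top, fun i => hs i i.2⟩⟩

/-- The semisimplification of `M`: the direct sum of the Jordan-Hölder subquotients of `M` (for some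
composition series; up to isomorphism the choice does not matter, by the Jordan-Hölder theorem). -/
def semisimplification [Finite Q] (M : QuiverRep Q) : QuiverRep Q :=
  let s : CompSeries M := Classical.choice (nonempty_compSeries M)
  directSum fun i : Fin s.length => subquotient (s.F i.castSucc) (s.F i.succ)

end QuiverRep

/-! ### The framed cyclic double quiver and the representations `L(α_i)`, `A_μ` -/

/-- Vertices of the framed quiver: `ℤ/ℓℤ` and `∞`. -/
inductive Vertex (ℓ : ℕ) : Type
  | node (i : ZMod ℓ) : Vertex ℓ
  | inf : Vertex ℓ

/-- Arrows of the framed double cyclic quiver: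
`y_i : i → i + 1`, `x_i : i + 1 → i`, `x : ∞ → 0` and `y : 0 → ∞`. -/
inductive Arrow (ℓ : ℕ) : Vertex ℓ → Vertex ℓ → Type
  | Y (i : ZMod ℓ) : Arrow ℓ (.node i) (.node (i + 1))
  | X (i : ZMod ℓ) : Arrow ℓ (.node (i + 1)) (.node i)
  | x : Arrow ℓ .inf (.node 0)
  | y : Arrow ℓ (.node 0) .inf

instance (ℓ : ℕ) : Quiver.{0} (Vertex ℓ) := ⟨Arrow ℓ⟩

instance (ℓ : ℕ) [NeZero ℓ] : Finite (Vertex ℓ) := by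
  refine Finite.of_injective
    (fun v : Vertex ℓ => (match v with | .node i => some i | .inf => none : Option (ZMod ℓ))) ?_
  rintro (i | _) (j | _) h <;> simp_all

/-- `L(α_i)`: the representation of dimension `1` at the vertex `i` and `0` at the other vertices, with
all arrows acting by zero. -/
def simpleAt {ℓ : ℕ} (i : ZMod ℓ) : QuiverRep (Vertex ℓ) where
  V a := {_u : Unit // a = .node i} → ℂ
  map _ := 0

/-- The number `k` of diagonal boxes (hence of hooks) of `μ`. -/
def numHooks (μ : YoungDiagram) : ℕ := (μ.cells.filter fun b => b.1 = b.2).card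

/-- `a_r`: the number of boxes to the right of `(r, r)`. Hooks are numbered `0, …, k - 1`. -/
def arm (μ : YoungDiagram) (r : ℕ) : ℤ := ((μ.row r).filter fun b => r < b.2).card

/-- `b_r`: the number of boxes below `(r, r)`. -/
def leg (μ : YoungDiagram) (r : ℕ) : ℤ := ((μ.col r).filter fun b => r < b.1).card

/-- The index set of the basis vectors `v_{r,j}`: pairs `(r, j)` with `r < k` and
`-b_r ≤ j ≤ a_r`. -/
def hookIndex (μ : YoungDiagram) : Finset (ℕ × ℤ) :=
  (Finset.range (numHooks μ)).biUnion fun r =>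
    (Finset.Icc (-leg μ r) (arm μ r)).image fun j => (r, j)

section Amu

variable {ℓ : ℕ} (θ : ZMod ℓ → ℂ) (μ : YoungDiagram)

/-- `∑_{i = p}^{q} θ_i`, with `θ_i = θ_{i mod ℓ}`. -/
def thetaSum (p q : ℤ) : ℂ := ∑ i ∈ Finset.Icc p q, θ (i : ZMod ℓ)

/-- `β_r = ∑_{i = -b_r}^{a_r} θ_i`. -/
def beta (r : ℕ) : ℂ := thetaSum θ (-leg μ r) (arm μ r)

/-- The space of `A_μ` at the vertex `i`: it has the basis `v_{r,j}`, `j ≡ i mod ℓ`. -/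
abbrev NodeSpace (i : ZMod ℓ) : Type := {p : hookIndex μ // ((p.1.2 : ℤ) : ZMod ℓ) = i} →₀ ℂ

/-- The vector `v_{r,j}` as an element of the space at the vertex `i ≡ j`; it is `0` by convention
if `(r, j)` is not in the index set. -/
def basisVec (i : ZMod ℓ) (r : ℕ) (j : ℤ) : NodeSpace μ i :=
  open Classical in
  if h : (r, j) ∈ hookIndex μ ∧ (j : ZMod ℓ) = i then
    Finsupp.single ⟨⟨(r, j), h.1⟩, h.2⟩ 1 else 0

/-- `X v_{r,j} = v_{r,j-1}` (which is `0` if `j = -b_r`). -/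
def mapX (i : ZMod ℓ) : NodeSpace μ (i + 1) →ₗ[ℂ] NodeSpace μ i :=
  Finsupp.linearCombination ℂ fun p => basisVec μ i p.1.1.1 (p.1.1.2 - 1)

/-- For `j < 0`,
`Y v_{r,j} = (∑_{i=-b_r}^{j} θ_i) v_{r,j+1} + ∑_{t>r} β_t v_{t,j+1}`; for `j ≥ 0`,
`Y v_{r,j} = -(∑_{i=j+1}^{a_r} θ_i) v_{r,j+1} - ∑_{t<r} β_t v_{t,j+1}`
(the first term is `0` if `j = a_r`). -/
def mapY (i : ZMod ℓ) : NodeSpace μ i →ₗ[ℂ] NodeSpace μ (i + 1) :=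
  Finsupp.linearCombination ℂ fun p =>
    let r := p.1.1.1
    let j := p.1.1.2
    if j < 0 then
      thetaSum θ (-leg μ r) j • basisVec μ (i + 1) r (j + 1)
        + ∑ t ∈ Finset.Ioo r (numHooks μ), beta θ μ t • basisVec μ (i + 1) t (j + 1)
    else
      -(thetaSum θ (j + 1) (arm μ r) • basisVec μ (i + 1) r (j + 1))
        - ∑ t ∈ Finset.range r, beta θ μ t • basisVec μ (i + 1) t (j + 1)

/-- `x(1) = ∑_r β_r v_{r,0}`. -/
def mapx : ℂ →ₗ[ℂ] NodeSpace (ℓ := ℓ) μ 0 :=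
  LinearMap.toSpanSingleton ℂ _
    (∑ r ∈ Finset.range (numHooks μ), beta θ μ r • basisVec μ 0 r 0)

/-- `y(v_{r,0}) = 1`, and `y(v_{r,j}) = 0` for `j ≠ 0`. -/
def mapy : NodeSpace (ℓ := ℓ) μ 0 →ₗ[ℂ] ℂ :=
  Finsupp.linearCombination ℂ fun p => if p.1.1.2 = 0 then 1 else 0

/-- The representation `A_μ` of the framed double cyclic quiver attached to `θ` and `μ`. -/
def repA : QuiverRep (Vertex ℓ) where
  V
    | .node i => NodeSpace μ i
    | .inf => ℂ
  grp
    | .node i => inferInstanceAs (AddCommGroup (NodeSpace μ i))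
    | .inf => inferInstanceAs (AddCommGroup ℂ)
  mod
    | .node i => inferInstanceAs (Module ℂ (NodeSpace μ i))
    | .inf => inferInstanceAs (Module ℂ ℂ)
  fin
    | .node i => inferInstanceAs (FiniteDimensional ℂ (NodeSpace μ i))
    | .inf => inferInstanceAs (FiniteDimensional ℂ ℂ)
  map f := match f with
    | .Y i => mapY θ μ i
    | .X i => mapX μ i
    | .x => mapx θ μ
    | .y => mapy μ

end Amu

end CMQuiver

end

open CMQuiver

/-!
Everything rests on one consequence of `θ` being `J`-standard
(`theta_eq_zero_of_thetaSum_eq_zero`): if `θ_p + ⋯ + θ_q = 0` for integers `p ≤ q`, then each of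
`θ_p`, …, `θ_q` is zero. Indeed `∑ θ_i ≠ 0` prevents `α_p + ⋯ + α_q` from being imaginary, so
it is a real root, and its reflection lies in the affine Weyl group (`exists_reflection`). The
reflection stabilizes `θ`, hence belongs to `W_J`, hence fixes the indicator function of the complement
of `J`; so this function has sum `0` over `[p, q]`, which means that `[p, q]` maps to `J`.

*Removing a box.* A box is written as the point of content `j` on the `r`-th hook (`boxOf`), so
that boxes correspond to basis vectors `v_{r,j}` (`mem_hookIndex_iff`). If `θ` vanishes on the
residue of a removable box, the sums `β_t` and the coefficients of `Y` do not change when the box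
is removed. The remaining basis vectors span a subrepresentation if the box lies on or above the
diagonal, and `v_{r,j}` itself spans one if it lies below (`hasShortExact_eraseBox`).

*Simplicity for a `J`-core.* On the sum of the spaces of `A_μ` at the vertices of `ℤ/ℓℤ` the
deformed preprojective relation `[X, Y] = θ - x y` holds (`commutator_totalVec`). In a
subrepresentation that is zero at `∞`, `y` vanishes, so `[X, Y] = θ`; as in the representation
theory of `𝔰𝔩₂`, applying powers of `Y` to a vector killed by `X` gives, by the statement on
roots, a nonzero homogeneous vector killed by both operators, in a degree `i` with `θ_i = 0`
(`exists_killed_of_commutator`). The formulas for `X` and `Y` show that some box occurring in such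
a vector is removable, or else that some `β_r` is `0`; in the latter case `θ` vanishes on all
contents of the `r`-th hook, among which is the content of a removable box
(`exists_removable_of_killed`). For a `J`-core neither is possible, so the subrepresentation is
zero. Subrepresentations containing the space at `∞` are treated in the same way, using the linear
forms that vanish on them (`carrier_eq_top_of_inf`, `exists_removable_of_killing`).

*Semisimplification.* By the Jordan–Hölder theorem in the modular lattice of subrepresentations,
the semisimplification is the direct sum of any multiset of composition factors
(`HasFactors.semisimplification_isomorphic`), and the factors add up in short exact sequences
(`HasFactors.of_hasShortExact`). Removing boxes one by one from `μ` down to its `J`-core gives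
those of `A_μ` (`hasFactors_repA`).

*Comparison.* Two partitions of the same size with the same `ℓ`-core have the same number of boxes
of each residue (`map_residue_eq`), so if their `J`-cores agree, so do the factors. Conversely, an
isomorphism of semisimplifications restricts to an injection between the summands that are nonzero
at `∞`, that is, between the representations of the `J`-cores. It respects the operator
`v_{r,j} ↦ j v_{r,j}`, because a simple `A_μ` is generated by `x(1)`, of content `0`, under
arrows that shift the content by one (`app_contentOp`). So the numbers of boxes of each content can
be compared, and they determine a partition (`le_of_injective`, `le_of_isomorphic_prod`).
-/

namespace CMQuiver

/-! ### Real roots and the parabolic subgroup -/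

theorem weylAction_simple {ℓ : ℕ} (i : SimpleIndex ℓ) :
    weylAction ℓ ((affineMatrix ℓ).simple i) = refl i.1 :=
  (affineMatrix ℓ).toCoxeterSystem.lift_apply_simple (refl_liftable ℓ) i

theorem refl_refl {ℓ : ℕ} (hℓ : ℓ ≠ 1) (j : ZMod ℓ) (η : ZMod ℓ → ℂ) :
    refl j (refl j η) = η := by
  ext i
  simp only [refl_apply, cartan_self hℓ]
  ring

theorem one_ne_zero_zmod {ℓ : ℕ} (hℓ : ℓ ≠ 1) : (1 : ZMod ℓ) ≠ 0 := by
  intro h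
  have := (ZMod.natCast_eq_zero_iff 1 ℓ).1 (by simpa using h)
  exact hℓ (Nat.dvd_one.1 this)

/-- The pairing of the root `∑_{a ≤ i < b} α_i` with the coroot of `α_j` telescopes. -/
theorem sum_Ico_cartan {ℓ : ℕ} (j : ZMod ℓ) {a b : ℤ} (hab : a ≤ b) :
    ∑ i ∈ Finset.Ico a b, cartan j (i : ZMod ℓ) =
      ((if (a : ZMod ℓ) = j then 1 else 0) - (if (a : ZMod ℓ) = j + 1 then 1 else 0)) -
      ((if (b : ZMod ℓ) = j then 1 else 0) - (if (b : ZMod ℓ) = j + 1 then 1 else 0)) := by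
  induction b, hab using Int.leInduction with
  | base => simp
  | succ b hab ih =>
    rw [← Finset.insert_Ico_right_eq_Ico_add_one hab, Finset.sum_insert (by simp), ih]
    have h1 : ((b : ZMod ℓ) = j - 1) = (((b + 1 : ℤ) : ZMod ℓ) = j) := by
      push_cast; rw [eq_sub_iff_add_eq]
    have h2 : (((b + 1 : ℤ) : ZMod ℓ) = j + 1) = ((b : ZMod ℓ) = j) := by
      push_cast; rw [add_left_inj]
    simp only [cartan, h1, h2]
    split_ifs <;> ring

theorem sum_Ico_refl {ℓ : ℕ} (j : ZMod ℓ) (η : ZMod ℓ → ℂ) {a b : ℤ} (hab : a ≤ b) :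
    ∑ i ∈ Finset.Ico a b, refl j η (i : ZMod ℓ) = ∑ i ∈ Finset.Ico a b, η (i : ZMod ℓ) -
      (((if (a : ZMod ℓ) = j then 1 else 0) - (if (a : ZMod ℓ) = j + 1 then 1 else 0)) -
      ((if (b : ZMod ℓ) = j then 1 else 0) - (if (b : ZMod ℓ) = j + 1 then 1 else 0))) * η j := by
  rw [← sum_Ico_cartan j hab, Finset.sum_mul, ← Finset.sum_sub_distrib]
  rfl

/-- The reflection in the real root `∑_{a ≤ i < b} α_i`, where `a ≢ b mod ℓ`, belongs to the affine
Weyl group. -/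
theorem exists_reflection {ℓ : ℕ} (hℓ : ℓ ≠ 1) (n : ℕ) :
    ∀ a b : ℤ, a < b → b - a = n → (a : ZMod ℓ) ≠ b →
      ∃ (w : AffineWeyl ℓ) (c : ZMod ℓ → ℂ), c ≠ 0 ∧ ∀ η : ZMod ℓ → ℂ,
        weylAction ℓ w η = η - (∑ i ∈ Finset.Ico a b, η (i : ZMod ℓ)) • c := by
  induction n using Nat.strong_induction_on with
  | _ n ih =>
    intro a b hab hn hne
    have h10 := one_ne_zero_zmod hℓ
    -- conjugation by the simple reflection in `α_a`
    have conj : ∀ a' b' : ℤ, a' < b' → b' - a' < n → (a' : ZMod ℓ) ≠ b' →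
        (∀ η : ZMod ℓ → ℂ, ∑ i ∈ Finset.Ico a' b', refl (a : ZMod ℓ) η (i : ZMod ℓ) =
          ∑ i ∈ Finset.Ico a b, η (i : ZMod ℓ)) →
        ∃ (w : AffineWeyl ℓ) (c : ZMod ℓ → ℂ), c ≠ 0 ∧ ∀ η : ZMod ℓ → ℂ,
          weylAction ℓ w η = η - (∑ i ∈ Finset.Ico a b, η (i : ZMod ℓ)) • c := by
      intro a' b' h1 h2 h3 h4
      obtain ⟨w, c, hc, hw⟩ := ih (b' - a').toNat (by omega) a' b' h1 (by omega) h3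
      refine ⟨(affineMatrix ℓ).simple ⟨a, hℓ⟩ * w * (affineMatrix ℓ).simple ⟨a, hℓ⟩,
        refl (a : ZMod ℓ) c, ?_, fun η => ?_⟩
      · intro h
        apply hc
        rw [← refl_refl hℓ (a : ZMod ℓ) c, h, map_zero]
      · rw [map_mul, map_mul, weylAction_simple, Module.End.mul_apply, Module.End.mul_apply, hw, h4,
          map_sub, map_smul, refl_refl hℓ]
    rcases eq_or_ne b (a + 1) with rfl | hb1
    · refine ⟨(affineMatrix ℓ).simple ⟨a, hℓ⟩, fun i => cartan (a : ZMod ℓ) i, ?_, fun η => ?_⟩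
      · intro h
        have := congrFun h (a : ZMod ℓ)
        simp [cartan_self hℓ] at this
      · rw [weylAction_simple]
        have hI : Finset.Ico a (a + 1) = {a} := by ext; simp; omega
        rw [hI]
        ext i
        simp [refl_apply, mul_comm]
    have hIa : ∀ (η : ZMod ℓ → ℂ) (b' : ℤ), a < b' → ∑ i ∈ Finset.Ico a b', η (i : ZMod ℓ) =
        η a + ∑ i ∈ Finset.Ico (a + 1) b', η (i : ZMod ℓ) := by
      intro η b' h
      rw [← Finset.insert_Ico_add_one_left_eq_Ico h, Finset.sum_insert (by simp)]
    by_cases hba : (b : ZMod ℓ) = a + 1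
    · have hlt : a + 1 < b - 1 := by
        by_contra hcon
        have hb2 : b = a + 2 := by omega
        apply h10
        have hb3 : (b : ZMod ℓ) = a + 2 := by rw [hb2]; push_cast; rfl
        linear_combination hba - hb3
      have hb' : ((b - 1 : ℤ) : ZMod ℓ) = a := by push_cast; rw [hba]; ring
      refine conj (a + 1) (b - 1) hlt (by omega) ?_ fun η => ?_
      · rw [hb']; push_cast; simpa using h10
      · rw [sum_Ico_refl _ _ hlt.le, hb', hIa η b hab]
        have hbb : Finset.Ico (a + 1) b = insert (b - 1) (Finset.Ico (a + 1) (b - 1)) := by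
          ext; simp; omega
        rw [hbb, Finset.sum_insert (by simp), hb']
        simp [h10]
        ring
    · have hlt : a + 1 < b := by omega
      refine conj (a + 1) b hlt (by omega) ?_ fun η => ?_
      · push_cast; exact fun h => hba h.symm
      · rw [sum_Ico_refl _ _ hlt.le, hIa η b hab]
        simp [h10, hba, Ne.symm hne]
        ring

/-- The parabolic subgroup `W_J` fixes the parameters that vanish on `J`. -/
theorem weylAction_of_mem_parabolic {ℓ : ℕ} {J : Set (ZMod ℓ)} {w : AffineWeyl ℓ}
    (hw : w ∈ parabolic J) {η : ZMod ℓ → ℂ} (hη : ∀ i ∈ J, η i = 0) :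
    weylAction ℓ w η = η := by
  induction hw using Subgroup.closure_induction with
  | mem x hx =>
    obtain ⟨i, hi, rfl⟩ := hx
    rw [weylAction_simple]
    ext k
    simp [refl_apply, hη _ hi]
  | one => simp
  | mul x y _ _ hx hy => rw [map_mul, Module.End.mul_apply, hy, hx]
  | inv x _ hx =>
    conv_lhs => rw [← hx]
    rw [← Module.End.mul_apply, ← map_mul]
    simp

theorem sum_Ico_add_mul {ℓ : ℕ} [NeZero ℓ] (θ : ZMod ℓ → ℂ) (a : ℤ) (m : ℕ) :
    ∑ i ∈ Finset.Ico a (a + m * ℓ), θ (i : ZMod ℓ) = m * ∑ i, θ i := by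
  induction m with
  | zero => simp
  | succ m ih =>
    have h1 : a ≤ a + m * ℓ := by have : (0 : ℤ) ≤ m * ℓ := by positivity
                                  omega
    have h2 : a + m * ℓ ≤ a + ((m + 1 : ℕ) : ℤ) * ℓ := by push_cast; nlinarith
    have key : ∑ i ∈ Finset.Ico (a + m * ℓ) (a + ((m + 1 : ℕ) : ℤ) * ℓ), θ (i : ZMod ℓ)
        = ∑ i, θ i := by
      refine Finset.sum_bij (fun i _ => (i : ZMod ℓ)) (by simp) ?_ ?_ (fun _ _ => rfl)
      · intro x hx y hy hxy
        rw [ZMod.intCast_eq_intCast_iff] at hxy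
        simp only [Finset.mem_Ico] at hx hy
        push_cast at hx hy
        obtain ⟨k, hk⟩ := hxy.dvd
        have hk1 : k < 1 := by
          by_contra h
          nlinarith
        have hk2 : -1 < k := by
          by_contra h
          nlinarith
        have : k = 0 := by omega
        subst this
        omega
      · intro z _
        have hl : (0 : ℤ) < ℓ := by exact_mod_cast Nat.pos_of_ne_zero (NeZero.ne ℓ)
        refine ⟨a + m * ℓ + ((z.val : ℤ) - a - m * ℓ) % ℓ, ?_, ?_⟩
        · have h3 := Int.emod_nonneg ((z.val : ℤ) - a - m * ℓ) hl.ne'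
          have h4 := Int.emod_lt_of_pos ((z.val : ℤ) - a - m * ℓ) hl
          simp only [Finset.mem_Ico]
          push_cast
          constructor <;> nlinarith
        · push_cast
          simp
    rw [← Finset.Ico_union_Ico_eq_Ico h1 h2,
      Finset.sum_union (Finset.Ico_disjoint_Ico_consecutive _ _ _), ih, key]
    push_cast
    ring

/-- If `θ` is `J`-standard and `∑ θ_i ≠ 0`, then a positive root `∑_{p ≤ i ≤ q} α_i` on which `θ`
vanishes is a sum of simple roots on each of which `θ` vanishes: its reflection stabilizes `θ`, so
it lies in `W_J`, and it fixes the indicator function of the complement of `J`. -/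
theorem theta_eq_zero_of_thetaSum_eq_zero {ℓ : ℕ} [NeZero ℓ] {J : Set (ZMod ℓ)} {θ : ZMod ℓ → ℂ}
    (hsum : ∑ i, θ i ≠ 0) (hθ : IsJStandard θ J) {p q : ℤ} (hpq : p ≤ q)
    (h0 : thetaSum θ p q = 0) {i : ℤ} (hi : i ∈ Finset.Icc p q) : θ (i : ZMod ℓ) = 0 := by
  classical
  have hIcc : Finset.Icc p q = Finset.Ico p (q + 1) := by ext; simp
  rw [thetaSum, hIcc] at h0
  rw [hIcc] at hi
  have hℓ0 : ℓ ≠ 0 := NeZero.ne ℓ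
  have hne : (p : ZMod ℓ) ≠ ((q + 1 : ℤ) : ZMod ℓ) := by
    intro h
    rw [ZMod.intCast_eq_intCast_iff] at h
    obtain ⟨k, hk⟩ := h.dvd
    have hl : (0 : ℤ) < ℓ := by exact_mod_cast Nat.pos_of_ne_zero hℓ0
    have hk0 : 0 < k := by
      by_contra hcon
      nlinarith
    lift k to ℕ using hk0.le
    have hq : q + 1 = p + k * ℓ := by linarith
    rw [hq, sum_Ico_add_mul] at h0
    rcases mul_eq_zero.1 h0 with h | h
    · exact hk0.ne' (by exact_mod_cast h)
    · exact hsum h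
  have hℓ : ℓ ≠ 1 := by
    rintro rfl
    exact hne (Subsingleton.elim _ _)
  obtain ⟨w, c, hc, hw⟩ := exists_reflection hℓ (q + 1 - p).toNat p (q + 1) (by omega)
    (by omega) hne
  have hwJ : w ∈ parabolic J := (hθ.1 w).1 (by rw [hw, h0]; simp)
  rw [← hθ.2]
  have h1 := weylAction_of_mem_parabolic hwJ (η := fun i => if i ∈ J then 0 else 1)
    (fun i hi => if_pos hi)
  rw [hw] at h1
  have h2 := (smul_eq_zero.1 (sub_eq_self.1 h1)).resolve_right hc
  have h3 : ∑ i ∈ Finset.Ico p (q + 1), (if (i : ZMod ℓ) ∈ J then (0 : ℕ) else 1) = 0 := by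
    have : ((∑ i ∈ Finset.Ico p (q + 1),
        (if (i : ZMod ℓ) ∈ J then (0 : ℕ) else 1) : ℕ) : ℂ) = 0 := by
      push_cast
      exact h2
    exact_mod_cast this
  have h4 := Finset.sum_eq_zero_iff.1 h3 i hi
  by_contra hcon
  simp [hcon] at h4

/-! ### Boxes and hooks -/

/-- The box of a Young diagram with index `j` in the `r`-th hook: it lies on the diagonal of
content `j`, and `r` is the smaller one of its coordinates. -/
def boxOf (r : ℕ) (j : ℤ) : ℕ × ℕ := (r + (-j).toNat, r + j.toNat)

theorem boxOf_injective {r r' : ℕ} {j j' : ℤ} (h : boxOf r j = boxOf r' j') : r = r' ∧ j = j' := by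
  simp only [boxOf, Prod.mk.injEq] at h
  omega

theorem exists_boxOf (b : ℕ × ℕ) : ∃ r j, boxOf r j = b :=
  ⟨min b.1 b.2, (b.2 : ℤ) - b.1, by ext <;> simp only [boxOf] <;> omega⟩

theorem residue_boxOf (ℓ : ℕ) (r : ℕ) (j : ℤ) : residue ℓ (boxOf r j) = (j : ZMod ℓ) := by
  unfold residue boxOf
  congr 1
  push_cast
  omega

theorem arm_eq (μ : YoungDiagram) (r : ℕ) : arm μ r = ((μ.rowLen r - (r + 1) : ℕ) : ℤ) := by
  unfold arm
  have : (μ.row r).filter (fun b => r < b.2) =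
      (Finset.Ico (r + 1) (μ.rowLen r)).image fun s => (r, s) := by
    ext ⟨x, y⟩
    simp only [Finset.mem_filter, YoungDiagram.mem_row_iff, Finset.mem_image, Finset.mem_Ico,
      Prod.mk.injEq, YoungDiagram.mem_iff_lt_rowLen]
    constructor
    · rintro ⟨⟨h1, rfl⟩, h2⟩
      exact ⟨y, by omega, rfl, rfl⟩
    · rintro ⟨s, h, rfl, rfl⟩
      exact ⟨⟨by omega, rfl⟩, by omega⟩
  rw [this, Finset.card_image_of_injective _ (Prod.mk_right_injective r), Nat.card_Ico]

theorem leg_eq (μ : YoungDiagram) (r : ℕ) : leg μ r = ((μ.colLen r - (r + 1) : ℕ) : ℤ) := by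
  unfold leg
  have : (μ.col r).filter (fun b => r < b.1) =
      (Finset.Ico (r + 1) (μ.colLen r)).image fun s => (s, r) := by
    ext ⟨x, y⟩
    simp only [Finset.mem_filter, YoungDiagram.mem_col_iff, Finset.mem_image, Finset.mem_Ico,
      Prod.mk.injEq, YoungDiagram.mem_iff_lt_colLen]
    constructor
    · rintro ⟨⟨h1, rfl⟩, h2⟩
      exact ⟨x, by omega, rfl, rfl⟩
    · rintro ⟨s, h, rfl, rfl⟩
      exact ⟨⟨by omega, rfl⟩, by omega⟩
  rw [this, Finset.card_image_of_injective _ (Prod.mk_left_injective r), Nat.card_Ico]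

theorem lt_numHooks_iff (μ : YoungDiagram) (r : ℕ) : r < numHooks μ ↔ (r, r) ∈ μ := by
  -- the diagonal boxes form an initial segment of the diagonal
  have hex : ∃ n, (n, n) ∉ μ := by
    obtain ⟨j, hj⟩ := μ.exists_notMem_row 0
    exact ⟨j, fun h => hj (μ.up_left_mem (Nat.zero_le _) le_rfl h)⟩
  classical
  have hmem : ∀ r, (r, r) ∈ μ ↔ r < Nat.find hex := fun r => by
    rw [Nat.lt_find_iff]
    exact ⟨fun h m hm => not_not.2 (μ.up_left_mem hm hm h), fun h => not_not.1 (h r le_rfl)⟩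
  have hset : (μ.cells.filter fun b => b.1 = b.2) =
      (Finset.range (Nat.find hex)).image fun n => (n, n) := by
    ext ⟨x, y⟩
    simp only [Finset.mem_filter, YoungDiagram.mem_cells, Finset.mem_image, Finset.mem_range,
      Prod.mk.injEq]
    constructor
    · rintro ⟨h, rfl⟩
      exact ⟨x, (hmem x).1 h, rfl, rfl⟩
    · rintro ⟨s, h, rfl, rfl⟩
      exact ⟨(hmem s).2 h, rfl⟩
  rw [numHooks, hset, Finset.card_image_of_injective _ (fun a b h => (Prod.mk.inj h).1),
    Finset.card_range, hmem]

theorem mem_hookIndex_iff_bounds (μ : YoungDiagram) (r : ℕ) (j : ℤ) :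
    (r, j) ∈ hookIndex μ ↔ (r, r) ∈ μ ∧ -leg μ r ≤ j ∧ j ≤ arm μ r := by
  simp only [hookIndex, Finset.mem_biUnion, Finset.mem_range, Finset.mem_image, Finset.mem_Icc,
    Prod.mk.injEq, lt_numHooks_iff]
  constructor
  · rintro ⟨r', h, j', hj, rfl, rfl⟩
    exact ⟨h, hj⟩
  · rintro ⟨h, hj⟩
    exact ⟨r, h, j, hj, rfl, rfl⟩

theorem mem_hookIndex_iff (μ : YoungDiagram) (r : ℕ) (j : ℤ) :
    (r, j) ∈ hookIndex μ ↔ boxOf r j ∈ μ := by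
  rw [mem_hookIndex_iff_bounds, arm_eq, leg_eq]
  unfold boxOf
  constructor
  · rintro ⟨h, h1, h2⟩
    have hr := YoungDiagram.mem_iff_lt_rowLen.1 h
    have hc := YoungDiagram.mem_iff_lt_colLen.1 h
    rcases le_total 0 j with hj | hj
    · have : (-j).toNat = 0 := by omega
      rw [this, YoungDiagram.mem_iff_lt_rowLen]
      simp only [add_zero]
      omega
    · have : j.toNat = 0 := by omega
      rw [this, YoungDiagram.mem_iff_lt_colLen]
      simp only [add_zero]
      omega
  · intro h
    refine ⟨μ.up_left_mem (by omega) (by omega) h, ?_, ?_⟩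
    · have := YoungDiagram.mem_iff_lt_colLen.1 (μ.up_left_mem le_rfl (Nat.le_add_right r _) h)
      omega
    · have := YoungDiagram.mem_iff_lt_rowLen.1 (μ.up_left_mem (Nat.le_add_right r _) le_rfl h)
      omega

theorem arm_nonneg (μ : YoungDiagram) (r : ℕ) : 0 ≤ arm μ r := by
  rw [arm_eq]; exact Int.natCast_nonneg _

theorem leg_nonneg (μ : YoungDiagram) (r : ℕ) : 0 ≤ leg μ r := by
  rw [leg_eq]; exact Int.natCast_nonneg _

theorem lt_numHooks_of_mem {μ : YoungDiagram} {r : ℕ} {j : ℤ} (h : (r, j) ∈ hookIndex μ) :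
    r < numHooks μ :=
  (lt_numHooks_iff μ r).2 ((mem_hookIndex_iff_bounds μ r j).1 h).1

/-- Monotonicity of membership: a box of `μ` bounds from below and from the right the boxes weakly
to its upper left. -/
theorem mem_hookIndex_of_le {μ : YoungDiagram} {r r' : ℕ} {j j' : ℤ} (h : (r, j) ∈ hookIndex μ)
    (h1 : r' + (-j').toNat ≤ r + (-j).toNat) (h2 : r' + j'.toNat ≤ r + j.toNat) :
    (r', j') ∈ hookIndex μ := by
  rw [mem_hookIndex_iff] at h ⊢
  exact μ.up_left_mem h1 h2 h

theorem eq_arm {μ : YoungDiagram} {r : ℕ} {j : ℤ} (h : (r, j) ∈ hookIndex μ)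
    (h' : (r, j + 1) ∉ hookIndex μ) : j = arm μ r := by
  rw [mem_hookIndex_iff_bounds] at h h'
  by_contra hne
  exact h' ⟨h.1, by omega, by omega⟩

theorem eq_neg_leg {μ : YoungDiagram} {r : ℕ} {j : ℤ} (h : (r, j) ∈ hookIndex μ)
    (h' : (r, j - 1) ∉ hookIndex μ) : j = -leg μ r := by
  rw [mem_hookIndex_iff_bounds] at h h'
  by_contra hne
  exact h' ⟨h.1, by omega, by omega⟩

/-- If `μ` has an `r`-th hook, it has a removable box weakly below and to the right of `(r, r)`; the
content of that box lies between `-b_r` and `a_r`. -/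
theorem exists_removable_of_hook {μ : YoungDiagram} {r : ℕ} (h : (r, r) ∈ μ) :
    ∃ b, IsRemovable μ b ∧
      ∃ j ∈ Finset.Icc (-leg μ r) (arm μ r), ∀ ℓ, residue ℓ b = (j : ZMod ℓ) := by
  -- a box that is maximal for the sum of the coordinates, among those weakly below and to the right
  -- of `(r, r)`
  obtain ⟨b, hb, hmax⟩ := Finset.exists_max_image (μ.cells.filter fun b => r ≤ b.1 ∧ r ≤ b.2)
    (fun b => b.1 + b.2) ⟨(r, r), by simp [h]⟩
  simp only [Finset.mem_filter, YoungDiagram.mem_cells] at hb hmax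
  obtain ⟨hbμ, hb1, hb2⟩ := hb
  refine ⟨b, ⟨hbμ, fun hc => ?_, fun hc => ?_⟩, (b.2 : ℤ) - b.1, ?_, fun ℓ => rfl⟩
  · have := hmax _ ⟨hc, by simp; omega, by simpa using hb2⟩
    simp at this
  · have := hmax _ ⟨hc, by simpa using hb1, by simp; omega⟩
    simp at this
  · have h1 := YoungDiagram.mem_iff_lt_colLen.1 (μ.up_left_mem le_rfl hb2 hbμ)
    have h2 := YoungDiagram.mem_iff_lt_rowLen.1 (μ.up_left_mem hb1 le_rfl hbμ)
    rw [Finset.mem_Icc, arm_eq, leg_eq]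
    omega

section Erase

variable {μ : YoungDiagram}

theorem mem_eraseBox {b c : ℕ × ℕ} (hb : IsRemovable μ b) : c ∈ eraseBox μ b hb ↔ c ≠ b ∧ c ∈ μ :=
  Finset.mem_erase

theorem mem_hookIndex_eraseBox {r₀ : ℕ} {j₀ : ℤ} (hb : IsRemovable μ (boxOf r₀ j₀)) (r : ℕ)
    (j : ℤ) :
    (r, j) ∈ hookIndex (eraseBox μ _ hb) ↔ (r, j) ∈ hookIndex μ ∧ (r, j) ≠ (r₀, j₀) := by
  rw [mem_hookIndex_iff, mem_hookIndex_iff, mem_eraseBox, and_comm]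
  refine and_congr_right fun _ => not_congr ⟨fun h => ?_, fun h => ?_⟩
  · obtain ⟨h1, h2⟩ := boxOf_injective h
    rw [h1, h2]
  · rw [(Prod.mk.inj h).1, (Prod.mk.inj h).2]

theorem rowLen_eraseBox {b : ℕ × ℕ} (hb : IsRemovable μ b) (r : ℕ) :
    (eraseBox μ b hb).rowLen r = if r = b.1 then b.2 else μ.rowLen r := by
  have key : ∀ s, s < (eraseBox μ b hb).rowLen r ↔ s < if r = b.1 then b.2 else μ.rowLen r := by
    intro s
    rw [← YoungDiagram.mem_iff_lt_rowLen, mem_eraseBox]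
    split_ifs with h
    · subst h
      constructor
      · rintro ⟨h1, h2⟩
        by_contra hcon
        have hs : s ≠ b.2 := fun h => h1 (by rw [h])
        exact hb.2.2 (μ.up_left_mem le_rfl (by omega) h2)
      · intro h
        exact ⟨fun h' => by rw [← h'] at h; exact lt_irrefl _ h, μ.up_left_mem le_rfl h.le hb.1⟩
    · rw [← YoungDiagram.mem_iff_lt_rowLen]
      exact ⟨fun h => h.2, fun h' => ⟨fun hc => h (by rw [← hc]), h'⟩⟩
  exact le_antisymm (le_of_not_gt fun h => lt_irrefl _ ((key _).1 h))
    (le_of_not_gt fun h => lt_irrefl _ ((key _).2 h))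

theorem colLen_eraseBox {b : ℕ × ℕ} (hb : IsRemovable μ b) (r : ℕ) :
    (eraseBox μ b hb).colLen r = if r = b.2 then b.1 else μ.colLen r := by
  have key : ∀ s, s < (eraseBox μ b hb).colLen r ↔ s < if r = b.2 then b.1 else μ.colLen r := by
    intro s
    rw [← YoungDiagram.mem_iff_lt_colLen, mem_eraseBox]
    split_ifs with h
    · subst h
      constructor
      · rintro ⟨h1, h2⟩
        by_contra hcon
        have hs : s ≠ b.1 := fun h => h1 (by rw [h])
        exact hb.2.1 (μ.up_left_mem (by omega) le_rfl h2)
      · intro h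
        exact ⟨fun h' => by rw [← h'] at h; exact lt_irrefl _ h, μ.up_left_mem h.le le_rfl hb.1⟩
    · rw [← YoungDiagram.mem_iff_lt_colLen]
      exact ⟨fun h => h.2, fun h' => ⟨fun hc => h (by rw [← hc]), h'⟩⟩
  exact le_antisymm (le_of_not_gt fun h => lt_irrefl _ ((key _).1 h))
    (le_of_not_gt fun h => lt_irrefl _ ((key _).2 h))

theorem rowLen_of_removable {b : ℕ × ℕ} (hb : IsRemovable μ b) : μ.rowLen b.1 = b.2 + 1 := by
  have h1 := YoungDiagram.mem_iff_lt_rowLen.1 hb.1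
  have h2 := mt YoungDiagram.mem_iff_lt_rowLen.2 hb.2.2
  omega

theorem colLen_of_removable {b : ℕ × ℕ} (hb : IsRemovable μ b) : μ.colLen b.2 = b.1 + 1 := by
  have h1 := YoungDiagram.mem_iff_lt_colLen.1 hb.1
  have h2 := mt YoungDiagram.mem_iff_lt_colLen.2 hb.2.1
  omega

theorem arm_eraseBox {r₀ : ℕ} {j₀ : ℤ} (hb : IsRemovable μ (boxOf r₀ j₀)) (r : ℕ) :
    arm (eraseBox μ _ hb) r = if r = r₀ ∧ 0 < j₀ then j₀ - 1 else arm μ r := by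
  have h1 := rowLen_of_removable hb
  rw [arm_eq, arm_eq, rowLen_eraseBox]
  by_cases hr : r = (boxOf r₀ j₀).1
  · subst hr
    rw [if_pos rfl, h1]
    simp only [boxOf]
    split_ifs <;> omega
  · rw [if_neg hr, if_neg]
    simp only [boxOf] at hr
    omega

theorem leg_eraseBox {r₀ : ℕ} {j₀ : ℤ} (hb : IsRemovable μ (boxOf r₀ j₀)) (r : ℕ) :
    leg (eraseBox μ _ hb) r = if r = r₀ ∧ j₀ < 0 then -j₀ - 1 else leg μ r := by
  have h1 := colLen_of_removable hb
  rw [leg_eq, leg_eq, colLen_eraseBox]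
  by_cases hr : r = (boxOf r₀ j₀).2
  · subst hr
    rw [if_pos rfl, h1]
    simp only [boxOf]
    split_ifs <;> omega
  · rw [if_neg hr, if_neg]
    simp only [boxOf] at hr
    omega

theorem arm_of_removable {r₀ : ℕ} {j₀ : ℤ} (hb : IsRemovable μ (boxOf r₀ j₀)) (hj : 0 ≤ j₀) :
    arm μ r₀ = j₀ := by
  have h1 := rowLen_of_removable hb
  rw [arm_eq]
  simp only [boxOf] at h1
  have : (-j₀).toNat = 0 := by omega
  rw [this, add_zero] at h1
  omega

theorem leg_of_removable {r₀ : ℕ} {j₀ : ℤ} (hb : IsRemovable μ (boxOf r₀ j₀)) (hj : j₀ ≤ 0) :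
    leg μ r₀ = -j₀ := by
  have h1 := colLen_of_removable hb
  rw [leg_eq]
  simp only [boxOf] at h1
  have : j₀.toNat = 0 := by omega
  rw [this, add_zero] at h1
  omega

theorem numHooks_eraseBox_le {b : ℕ × ℕ} (hb : IsRemovable μ b) :
    numHooks (eraseBox μ b hb) ≤ numHooks μ :=
  le_of_not_gt fun h => lt_irrefl _ ((lt_numHooks_iff _ _).2
    ((mem_eraseBox hb).1 ((lt_numHooks_iff _ _).1 h)).2)

variable {ℓ : ℕ} (θ : ZMod ℓ → ℂ)

theorem thetaSum_sub_one_right {p q : ℤ} (h : θ (q : ZMod ℓ) = 0) :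
    thetaSum θ p (q - 1) = thetaSum θ p q := by
  unfold thetaSum
  refine Finset.sum_subset (Finset.Icc_subset_Icc_right (by omega)) fun i hi hi' => ?_
  simp only [Finset.mem_Icc] at hi hi'
  have : i = q := by omega
  rw [this, h]

theorem thetaSum_add_one_left {p q : ℤ} (h : θ (p : ZMod ℓ) = 0) :
    thetaSum θ (p + 1) q = thetaSum θ p q := by
  unfold thetaSum
  refine Finset.sum_subset (Finset.Icc_subset_Icc_left (by omega)) fun i hi hi' => ?_
  simp only [Finset.mem_Icc] at hi hi'
  have : i = p := by omega
  rw [this, h]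

/-- Sums of parameters ending at the end of a row do not change when a box on which the parameter
vanishes is removed. -/
theorem thetaSum_arm_eraseBox {r₀ : ℕ} {j₀ : ℤ} (hb : IsRemovable μ (boxOf r₀ j₀))
    (h0 : θ (j₀ : ZMod ℓ) = 0) (p : ℤ) (r : ℕ) :
    thetaSum θ p (arm (eraseBox μ _ hb) r) = thetaSum θ p (arm μ r) := by
  rw [arm_eraseBox]
  split_ifs with h
  · rw [h.1, arm_of_removable hb h.2.le, thetaSum_sub_one_right θ h0]
  · rfl

theorem thetaSum_leg_eraseBox {r₀ : ℕ} {j₀ : ℤ} (hb : IsRemovable μ (boxOf r₀ j₀))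
    (h0 : θ (j₀ : ZMod ℓ) = 0) (q : ℤ) (r : ℕ) :
    thetaSum θ (-leg (eraseBox μ _ hb) r) q = thetaSum θ (-leg μ r) q := by
  rw [leg_eraseBox]
  split_ifs with h
  · rw [h.1, leg_of_removable hb h.2.le, ← thetaSum_add_one_left θ (p := - -j₀) (by simpa using h0)]
    congr 1
    ring
  · rfl

theorem beta_eraseBox {r₀ : ℕ} {j₀ : ℤ} (hb : IsRemovable μ (boxOf r₀ j₀))
    (h0 : θ (j₀ : ZMod ℓ) = 0) (r : ℕ) : beta θ (eraseBox μ _ hb) r = beta θ μ r := by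
  unfold beta
  rw [thetaSum_arm_eraseBox θ hb h0, thetaSum_leg_eraseBox θ hb h0]

end Erase

/-! ### The representations `A_μ` on basis vectors -/

section Basis

variable {ℓ : ℕ} (θ : ZMod ℓ → ℂ) (μ : YoungDiagram)

theorem basisVec_of_mem {i : ZMod ℓ} {r : ℕ} {j : ℤ} (h : (r, j) ∈ hookIndex μ)
    (hi : (j : ZMod ℓ) = i) : basisVec μ i r j = Finsupp.single ⟨⟨(r, j), h⟩, hi⟩ 1 :=
  dif_pos ⟨h, hi⟩

theorem basisVec_of_notMem {i : ZMod ℓ} {r : ℕ} {j : ℤ} (h : (r, j) ∉ hookIndex μ) :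
    basisVec μ i r j = 0 :=
  dif_neg fun h' => h h'.1

variable {μ} in
theorem nodeSpace_hom_ext {i : ZMod ℓ} {M : Type*} [AddCommMonoid M] [Module ℂ M]
    {f g : NodeSpace μ i →ₗ[ℂ] M}
    (h : ∀ r j, (r, j) ∈ hookIndex μ → (j : ZMod ℓ) = i →
      f (basisVec μ i r j) = g (basisVec μ i r j)) : f = g := by
  refine Finsupp.lhom_ext' fun p => LinearMap.ext_ring ?_
  have := h p.1.1.1 p.1.1.2 p.1.2 p.2
  rw [basisVec_of_mem μ p.1.2 p.2] at this
  exact this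

theorem mapX_basisVec {i : ZMod ℓ} {r : ℕ} {j : ℤ} (h : (r, j) ∈ hookIndex μ)
    (hi : (j : ZMod ℓ) = i + 1) : mapX μ i (basisVec μ (i + 1) r j) = basisVec μ i r (j - 1) := by
  rw [basisVec_of_mem μ h hi, mapX, Finsupp.linearCombination_single, one_smul]

theorem mapy_basisVec {r : ℕ} {j : ℤ} (h : (r, j) ∈ hookIndex μ)
    (hi : (j : ZMod ℓ) = 0) : mapy μ (basisVec μ (0 : ZMod ℓ) r j) = if j = 0 then 1 else 0 := by
  rw [basisVec_of_mem μ h hi, mapy, Finsupp.linearCombination_single, one_smul]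

/-- Sums over hooks may be extended beyond the number of hooks of `μ`. -/
theorem sum_Ioo_basisVec {N : ℕ} (hN : numHooks μ ≤ N) (c : ℕ → ℂ) (i : ZMod ℓ) (r : ℕ) (j : ℤ) :
    ∑ t ∈ Finset.Ioo r (numHooks μ), c t • basisVec μ i t j =
      ∑ t ∈ Finset.Ioo r N, c t • basisVec μ i t j := by
  refine Finset.sum_subset (Finset.Ioo_subset_Ioo_right hN) fun t ht ht' => ?_
  rw [basisVec_of_notMem, smul_zero]
  intro h
  exact ht' (Finset.mem_Ioo.2 ⟨(Finset.mem_Ioo.1 ht).1, lt_numHooks_of_mem h⟩)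

theorem sum_range_basisVec {N : ℕ} (hN : numHooks μ ≤ N) (c : ℕ → ℂ) (i : ZMod ℓ) (j : ℤ) :
    ∑ t ∈ Finset.range (numHooks μ), c t • basisVec μ i t j =
      ∑ t ∈ Finset.range N, c t • basisVec μ i t j := by
  refine Finset.sum_subset (Finset.range_subset_range.2 hN) fun t ht ht' => ?_
  rw [basisVec_of_notMem, smul_zero]
  intro h
  exact ht' (Finset.mem_range.2 (lt_numHooks_of_mem h))

theorem mapY_basisVec_of_neg {N : ℕ} (hN : numHooks μ ≤ N) {i : ZMod ℓ} {r : ℕ} {j : ℤ}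
    (h : (r, j) ∈ hookIndex μ) (hi : (j : ZMod ℓ) = i) (hj : j < 0) :
    mapY θ μ i (basisVec μ i r j) = thetaSum θ (-leg μ r) j • basisVec μ (i + 1) r (j + 1) +
      ∑ t ∈ Finset.Ioo r N, beta θ μ t • basisVec μ (i + 1) t (j + 1) := by
  rw [basisVec_of_mem μ h hi, mapY, Finsupp.linearCombination_single, one_smul, if_pos hj,
    sum_Ioo_basisVec μ hN]

theorem mapY_basisVec_of_nonneg {i : ZMod ℓ} {r : ℕ} {j : ℤ}
    (h : (r, j) ∈ hookIndex μ) (hi : (j : ZMod ℓ) = i) (hj : 0 ≤ j) :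
    mapY θ μ i (basisVec μ i r j) =
      -(thetaSum θ (j + 1) (arm μ r) • basisVec μ (i + 1) r (j + 1)) -
        ∑ t ∈ Finset.range r, beta θ μ t • basisVec μ (i + 1) t (j + 1) := by
  rw [basisVec_of_mem μ h hi, mapY, Finsupp.linearCombination_single, one_smul, if_neg hj.not_gt]

/-- The linear map `v_{r,j} ↦ v_{r,j}` between the spaces attached to two diagrams; it kills the
`v_{r,j}` that do not exist in the target. -/
noncomputable def transfer (μ κ : YoungDiagram) (i : ZMod ℓ) : NodeSpace μ i →ₗ[ℂ] NodeSpace κ i :=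
  Finsupp.linearCombination ℂ fun p => basisVec κ i p.1.1.1 p.1.1.2

theorem transfer_basisVec (κ : YoungDiagram) {i : ZMod ℓ} {r : ℕ} {j : ℤ}
    (h : (r, j) ∈ hookIndex κ → (r, j) ∈ hookIndex μ) :
    transfer μ κ i (basisVec μ i r j) = basisVec κ i r j := by
  by_cases hi : (r, j) ∈ hookIndex μ ∧ (j : ZMod ℓ) = i
  · rw [basisVec_of_mem μ hi.1 hi.2, transfer, Finsupp.linearCombination_single, one_smul]
  · have h1 : basisVec μ i r j = 0 := dif_neg hi
    have h2 : basisVec κ i r j = 0 := dif_neg fun h' => hi ⟨h h'.1, h'.2⟩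
    rw [h1, h2, map_zero]

/-- The coefficient of `v_{r,j}`. -/
noncomputable def coeffAt (i : ZMod ℓ) (r : ℕ) (j : ℤ) : NodeSpace μ i →ₗ[ℂ] ℂ :=
  Finsupp.linearCombination ℂ fun p => if p.1.1 = (r, j) then 1 else 0

theorem coeffAt_basisVec {i : ZMod ℓ} {r r' : ℕ} {j j' : ℤ} (h : (r', j') ∈ hookIndex μ)
    (hi : (j' : ZMod ℓ) = i) :
    coeffAt μ i r j (basisVec μ i r' j') = if (r', j') = (r, j) then 1 else 0 := by
  rw [basisVec_of_mem μ h hi, coeffAt, Finsupp.linearCombination_single, one_smul]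

theorem coeffAt_basisVec_of_ne {i : ZMod ℓ} {r r' : ℕ} {j j' : ℤ} (h : (r', j') ≠ (r, j)) :
    coeffAt μ i r j (basisVec μ i r' j') = 0 := by
  by_cases hi : (r', j') ∈ hookIndex μ ∧ (j' : ZMod ℓ) = i
  · rw [coeffAt_basisVec μ hi.1 hi.2, if_neg h]
  · have h1 : basisVec μ i r' j' = 0 := dif_neg hi
    rw [h1, map_zero]

end Basis

/-! ### Removing a box on which the parameter vanishes -/

section Erase

variable {ℓ : ℕ} (θ : ZMod ℓ → ℂ) {μ : YoungDiagram} {r₀ : ℕ} {j₀ : ℤ}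

theorem mem_hookIndex_of_removable (hb : IsRemovable μ (boxOf r₀ j₀)) : (r₀, j₀) ∈ hookIndex μ :=
  (mem_hookIndex_iff μ r₀ j₀).2 hb.1

theorem transfer_to_eraseBox (hb : IsRemovable μ (boxOf r₀ j₀)) {i : ZMod ℓ} (r : ℕ) (j : ℤ) :
    transfer μ (eraseBox μ _ hb) i (basisVec μ i r j) = basisVec (eraseBox μ _ hb) i r j :=
  transfer_basisVec μ _ fun h => ((mem_hookIndex_eraseBox hb r j).1 h).1

theorem transfer_from_eraseBox (hb : IsRemovable μ (boxOf r₀ j₀)) {i : ZMod ℓ} {r : ℕ} {j : ℤ}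
    (hne : (r, j) ≠ (r₀, j₀)) :
    transfer (eraseBox μ _ hb) μ i (basisVec (eraseBox μ _ hb) i r j) = basisVec μ i r j :=
  transfer_basisVec _ _ fun h => (mem_hookIndex_eraseBox hb r j).2 ⟨h, hne⟩

theorem transfer_transfer_eraseBox (hb : IsRemovable μ (boxOf r₀ j₀)) {i : ZMod ℓ}
    (v : NodeSpace (eraseBox μ _ hb) i) :
    transfer μ (eraseBox μ _ hb) i (transfer (eraseBox μ _ hb) μ i v) = v := by
  refine LinearMap.congr_fun (f := transfer μ (eraseBox μ _ hb) i ∘ₗ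
    transfer (eraseBox μ _ hb) μ i) (g := LinearMap.id) (nodeSpace_hom_ext fun r j h hi => ?_) v
  rw [LinearMap.comp_apply, transfer_from_eraseBox hb ((mem_hookIndex_eraseBox hb r j).1 h).2,
    transfer_to_eraseBox, LinearMap.id_apply]

/-- A vector is the sum of its component at the removed box and of its other components. -/
theorem transfer_add_coeffAt (hb : IsRemovable μ (boxOf r₀ j₀)) {i : ZMod ℓ} (v : NodeSpace μ i) :
    transfer (eraseBox μ _ hb) μ i (transfer μ (eraseBox μ _ hb) i v) +
      coeffAt μ i r₀ j₀ v • basisVec μ i r₀ j₀ = v := by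
  refine LinearMap.congr_fun (f := transfer (eraseBox μ _ hb) μ i ∘ₗ
    transfer μ (eraseBox μ _ hb) i + (coeffAt μ i r₀ j₀).smulRight (basisVec μ i r₀ j₀))
    (g := LinearMap.id) (nodeSpace_hom_ext fun r j h hi => ?_) v
  rw [LinearMap.add_apply, LinearMap.comp_apply, LinearMap.smulRight_apply, LinearMap.id_apply,
    transfer_to_eraseBox]
  by_cases hne : (r, j) = (r₀, j₀)
  · obtain ⟨rfl, rfl⟩ := Prod.mk.inj hne
    rw [basisVec_of_notMem (eraseBox μ _ hb) (fun h => ((mem_hookIndex_eraseBox hb r j).1 h).2 rfl),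
      coeffAt_basisVec μ h hi, if_pos rfl, map_zero, one_smul, zero_add]
  · rw [transfer_from_eraseBox hb hne, coeffAt_basisVec_of_ne μ hne, zero_smul, add_zero]

theorem coeffAt_transfer (hb : IsRemovable μ (boxOf r₀ j₀)) {i : ZMod ℓ}
    (v : NodeSpace (eraseBox μ _ hb) i) :
    coeffAt μ i r₀ j₀ (transfer (eraseBox μ _ hb) μ i v) = 0 := by
  refine LinearMap.congr_fun (f := coeffAt μ i r₀ j₀ ∘ₗ transfer (eraseBox μ _ hb) μ i)
    (g := 0) (nodeSpace_hom_ext fun r j h hi => ?_) v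
  have hne := ((mem_hookIndex_eraseBox hb r j).1 h).2
  rw [LinearMap.comp_apply, transfer_from_eraseBox hb hne, coeffAt_basisVec_of_ne μ hne,
    LinearMap.zero_apply]

/-- The row below a removable box on or above the diagonal is too short for a box of the next
hooks to be mapped to the removable box. -/
theorem not_mem_of_removable_nonneg (hb : IsRemovable μ (boxOf r₀ j₀)) (hj : 0 ≤ j₀) {r : ℕ}
    (hr : r₀ < r) : (r, j₀ - 1) ∉ hookIndex μ := fun h =>
  hb.2.1 (μ.up_left_mem (by simp only [boxOf]; omega) (by simp only [boxOf]; omega)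
    ((mem_hookIndex_iff μ _ _).1 h))

theorem not_mem_of_removable_zero (hb : IsRemovable μ (boxOf r₀ 0)) :
    (r₀, -1) ∉ hookIndex μ := fun h =>
  hb.2.1 (μ.up_left_mem (by simp [boxOf]) (by simp [boxOf]) ((mem_hookIndex_iff μ _ _).1 h))

theorem not_mem_of_removable_neg (hb : IsRemovable μ (boxOf r₀ j₀)) (hj : j₀ < 0) {r : ℕ}
    (hr : r₀ < r) : (r, j₀ + 1) ∉ hookIndex μ := fun h =>
  hb.2.2 (μ.up_left_mem (by simp only [boxOf]; omega) (by simp only [boxOf]; omega)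
    ((mem_hookIndex_iff μ _ _).1 h))

theorem beta_of_removable_zero {r₀ : ℕ} (hb : IsRemovable μ (boxOf r₀ 0))
    (h0 : θ ((0 : ℤ) : ZMod ℓ) = 0) : beta θ μ r₀ = 0 := by
  simp only [beta, arm_of_removable hb le_rfl, leg_of_removable hb le_rfl, thetaSum]
  simpa using h0

theorem transfer_mapX_from_eraseBox (hb : IsRemovable μ (boxOf r₀ j₀)) (hj : 0 ≤ j₀) (i : ZMod ℓ)
    (v : NodeSpace (eraseBox μ _ hb) (i + 1)) :
    transfer (eraseBox μ _ hb) μ i (mapX _ i v) =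
      mapX μ i (transfer (eraseBox μ _ hb) μ (i + 1) v) := by
  refine LinearMap.congr_fun (f := transfer _ _ _ ∘ₗ mapX _ i) (g := mapX _ i ∘ₗ transfer _ _ _)
    (nodeSpace_hom_ext fun r j h hi => ?_) v
  obtain ⟨hμ, hne⟩ := (mem_hookIndex_eraseBox hb r j).1 h
  rw [LinearMap.comp_apply, LinearMap.comp_apply, mapX_basisVec _ h hi,
    transfer_from_eraseBox hb hne, mapX_basisVec _ hμ hi, transfer_from_eraseBox hb]
  intro heq
  obtain ⟨rfl, h1⟩ := Prod.mk.inj heq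
  rw [← h1] at hb hj
  exact hb.2.2 (μ.up_left_mem (by simp only [boxOf]; omega) (by simp only [boxOf]; omega)
    ((mem_hookIndex_iff μ r j).1 hμ))

theorem transfer_mapY_from_eraseBox (hb : IsRemovable μ (boxOf r₀ j₀)) (hj : 0 ≤ j₀)
    (h0 : θ (j₀ : ZMod ℓ) = 0) (i : ZMod ℓ) (v : NodeSpace (eraseBox μ _ hb) i) :
    transfer (eraseBox μ _ hb) μ (i + 1) (mapY θ _ i v) =
      mapY θ μ i (transfer (eraseBox μ _ hb) μ i v) := by
  refine LinearMap.congr_fun (f := transfer _ _ _ ∘ₗ mapY θ _ i)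
    (g := mapY θ _ i ∘ₗ transfer _ _ _) (nodeSpace_hom_ext fun r j h hi => ?_) v
  obtain ⟨hμ, hne⟩ := (mem_hookIndex_eraseBox hb r j).1 h
  rw [LinearMap.comp_apply, LinearMap.comp_apply, transfer_from_eraseBox hb hne]
  -- a vector that is mapped to the removed box appears with the coefficient `0`
  have key : ∀ (c : ℂ) (t : ℕ) (m : ℤ), ((t, m) = (r₀, j₀) → c = 0) →
      c • transfer (eraseBox μ _ hb) μ (i + 1) (basisVec (eraseBox μ _ hb) (i + 1) t m) =
        c • basisVec μ (i + 1) t m := by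
    intro c t m hc
    by_cases h' : (t, m) = (r₀, j₀)
    · rw [hc h', zero_smul, zero_smul]
    · rw [transfer_from_eraseBox hb h']
  rcases lt_or_ge j 0 with hj' | hj'
  · rw [mapY_basisVec_of_neg θ _ (numHooks_eraseBox_le hb) h hi hj',
      mapY_basisVec_of_neg θ _ le_rfl hμ hi hj', map_add, map_smul, map_sum,
      thetaSum_leg_eraseBox θ hb h0]
    have hz : j + 1 = j₀ → j₀ = 0 := fun h => by omega
    congr 1
    · refine key _ _ _ fun heq => ?_
      obtain ⟨rfl, h1⟩ := Prod.mk.inj heq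
      obtain rfl := hz h1
      obtain rfl : j = -1 := by omega
      exact absurd hμ (not_mem_of_removable_zero hb)
    · refine Finset.sum_congr rfl fun t _ => ?_
      rw [map_smul, beta_eraseBox θ hb h0]
      refine key _ _ _ fun heq => ?_
      obtain ⟨rfl, h1⟩ := Prod.mk.inj heq
      obtain rfl := hz h1
      exact beta_of_removable_zero θ hb h0
  · rw [mapY_basisVec_of_nonneg θ _ h hi hj', mapY_basisVec_of_nonneg θ _ hμ hi hj', map_sub,
      map_neg, map_smul, map_sum, thetaSum_arm_eraseBox θ hb h0]
    rw [key, Finset.sum_congr rfl fun t ht => ?_]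
    · rw [map_smul, beta_eraseBox θ hb h0]
      refine key _ _ _ fun heq => ?_
      obtain ⟨rfl, rfl⟩ := Prod.mk.inj heq
      exact absurd (by simpa using hμ)
        (not_mem_of_removable_nonneg hb hj (Finset.mem_range.1 ht))
    · intro heq
      obtain ⟨rfl, rfl⟩ := Prod.mk.inj heq
      rw [arm_of_removable hb hj]
      simpa [thetaSum] using h0

theorem mapx_apply (μ : YoungDiagram) {N : ℕ} (hN : numHooks μ ≤ N) (c : ℂ) :
    mapx θ μ c = c • ∑ r ∈ Finset.range N, beta θ μ r • basisVec μ 0 r 0 := by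
  rw [← sum_range_basisVec μ hN]
  rfl

theorem transfer_mapx_from_eraseBox (hb : IsRemovable μ (boxOf r₀ j₀))
    (h0 : θ (j₀ : ZMod ℓ) = 0) (c : ℂ) :
    transfer (eraseBox μ _ hb) μ 0 (mapx θ _ c) = mapx θ μ c := by
  rw [mapx_apply θ _ (numHooks_eraseBox_le hb), mapx_apply θ _ le_rfl, map_smul, map_sum]
  congr 1
  refine Finset.sum_congr rfl fun t _ => ?_
  rw [map_smul, beta_eraseBox θ hb h0]
  by_cases heq : (t, (0 : ℤ)) = (r₀, j₀)
  · obtain ⟨rfl, rfl⟩ := Prod.mk.inj heq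
    rw [beta_of_removable_zero θ hb h0, zero_smul, zero_smul]
  · rw [transfer_from_eraseBox hb heq]

theorem mapy_transfer_from_eraseBox (hb : IsRemovable μ (boxOf r₀ j₀))
    (v : NodeSpace (ℓ := ℓ) (eraseBox μ _ hb) 0) :
    mapy (eraseBox μ _ hb) v = mapy μ (transfer (eraseBox μ _ hb) μ 0 v) := by
  refine LinearMap.congr_fun (f := mapy _)
    (g := mapy _ ∘ₗ transfer _ _ _) (nodeSpace_hom_ext fun r j h hi => ?_) v
  obtain ⟨hμ, hne⟩ := (mem_hookIndex_eraseBox hb r j).1 h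
  rw [LinearMap.comp_apply, transfer_from_eraseBox hb hne, mapy_basisVec _ h hi,
    mapy_basisVec _ hμ hi]

theorem transfer_mapX_to_eraseBox (hb : IsRemovable μ (boxOf r₀ j₀)) (hj : j₀ < 0) (i : ZMod ℓ)
    (v : NodeSpace μ (i + 1)) :
    transfer μ (eraseBox μ _ hb) i (mapX _ i v) =
      mapX _ i (transfer μ (eraseBox μ _ hb) (i + 1) v) := by
  refine LinearMap.congr_fun (f := transfer _ _ _ ∘ₗ mapX _ i) (g := mapX _ i ∘ₗ transfer _ _ _)
    (nodeSpace_hom_ext fun r j h hi => ?_) v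
  rw [LinearMap.comp_apply, LinearMap.comp_apply, mapX_basisVec _ h hi, transfer_to_eraseBox,
    transfer_to_eraseBox]
  by_cases hne : (r, j) = (r₀, j₀)
  · obtain ⟨rfl, rfl⟩ := Prod.mk.inj hne
    have h1 : (r, j) ∉ hookIndex (eraseBox μ _ hb) := fun h =>
      ((mem_hookIndex_eraseBox hb r j).1 h).2 rfl
    have h2 : (r, j - 1) ∉ hookIndex (eraseBox μ _ hb) := fun h => h1 (mem_hookIndex_of_le h
      (by omega) (by omega))
    rw [basisVec_of_notMem _ h1, basisVec_of_notMem _ h2, map_zero]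
  · rw [mapX_basisVec _ ((mem_hookIndex_eraseBox hb r j).2 ⟨h, hne⟩) hi]

/-- `Y` kills the basis vector of a removable box below the diagonal. -/
theorem mapY_basisVec_removable (hb : IsRemovable μ (boxOf r₀ j₀)) (hj : j₀ < 0)
    (h0 : θ (j₀ : ZMod ℓ) = 0) {i : ZMod ℓ} (hi : (j₀ : ZMod ℓ) = i) :
    mapY θ μ i (basisVec μ i r₀ j₀) = 0 := by
  rw [mapY_basisVec_of_neg θ _ le_rfl (mem_hookIndex_of_removable hb) hi hj,
    leg_of_removable hb hj.le]
  have h1 : thetaSum θ (- -j₀) j₀ = 0 := by simpa [thetaSum] using h0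
  rw [h1, zero_smul, zero_add]
  refine Finset.sum_eq_zero fun t ht => ?_
  rw [basisVec_of_notMem _ (not_mem_of_removable_neg hb hj (Finset.mem_Ioo.1 ht).1), smul_zero]

theorem mapX_basisVec_removable (hb : IsRemovable μ (boxOf r₀ j₀)) (hj : j₀ < 0)
    {i : ZMod ℓ} (hi : (j₀ : ZMod ℓ) = i + 1) :
    mapX μ i (basisVec μ (i + 1) r₀ j₀) = 0 := by
  rw [mapX_basisVec _ (mem_hookIndex_of_removable hb) hi, basisVec_of_notMem]
  intro h
  have := ((mem_hookIndex_iff_bounds _ _ _).1 h).2.1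
  rw [leg_of_removable hb hj.le] at this
  omega

theorem transfer_mapY_to_eraseBox (hb : IsRemovable μ (boxOf r₀ j₀)) (hj : j₀ < 0)
    (h0 : θ (j₀ : ZMod ℓ) = 0) (i : ZMod ℓ) (v : NodeSpace μ i) :
    transfer μ (eraseBox μ _ hb) (i + 1) (mapY θ _ i v) =
      mapY θ _ i (transfer μ (eraseBox μ _ hb) i v) := by
  refine LinearMap.congr_fun (f := transfer _ _ _ ∘ₗ mapY θ _ i)
    (g := mapY θ _ i ∘ₗ transfer _ _ _) (nodeSpace_hom_ext fun r j h hi => ?_) v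
  rw [LinearMap.comp_apply, LinearMap.comp_apply, transfer_to_eraseBox]
  by_cases hne : (r, j) = (r₀, j₀)
  · obtain ⟨rfl, rfl⟩ := Prod.mk.inj hne
    rw [mapY_basisVec_removable θ hb hj h0 hi, basisVec_of_notMem (eraseBox μ _ hb) (fun h =>
      ((mem_hookIndex_eraseBox hb r j).1 h).2 rfl), map_zero, map_zero]
  have h' := (mem_hookIndex_eraseBox hb r j).2 ⟨h, hne⟩
  rcases lt_or_ge j 0 with hj' | hj'
  · rw [mapY_basisVec_of_neg θ _ (numHooks_eraseBox_le hb) h' hi hj',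
      mapY_basisVec_of_neg θ _ le_rfl h hi hj', map_add, map_smul, map_sum,
      thetaSum_leg_eraseBox θ hb h0, transfer_to_eraseBox]
    congr 1
    refine Finset.sum_congr rfl fun t _ => ?_
    rw [map_smul, beta_eraseBox θ hb h0, transfer_to_eraseBox]
  · rw [mapY_basisVec_of_nonneg θ _ h hi hj', mapY_basisVec_of_nonneg θ _ h' hi hj', map_sub,
      map_neg, map_smul, map_sum, thetaSum_arm_eraseBox θ hb h0, transfer_to_eraseBox,
      Finset.sum_congr rfl fun t _ => ?_]
    rw [map_smul, beta_eraseBox θ hb h0, transfer_to_eraseBox]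

theorem transfer_mapx_to_eraseBox (hb : IsRemovable μ (boxOf r₀ j₀))
    (h0 : θ (j₀ : ZMod ℓ) = 0) (c : ℂ) :
    transfer μ (eraseBox μ _ hb) 0 (mapx θ _ c) = mapx θ _ c := by
  rw [mapx_apply θ (eraseBox μ _ hb) (numHooks_eraseBox_le hb), mapx_apply θ μ le_rfl, map_smul,
    map_sum]
  congr 1
  refine Finset.sum_congr rfl fun t _ => ?_
  rw [map_smul, beta_eraseBox θ hb h0, transfer_to_eraseBox]

theorem mapy_transfer_to_eraseBox (hb : IsRemovable μ (boxOf r₀ j₀)) (hj : j₀ < 0)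
    (v : NodeSpace (ℓ := ℓ) μ 0) :
    mapy μ v = mapy (eraseBox μ _ hb) (transfer μ (eraseBox μ _ hb) 0 v) := by
  refine LinearMap.congr_fun (f := mapy _)
    (g := mapy _ ∘ₗ transfer _ _ _) (nodeSpace_hom_ext fun r j h hi => ?_) v
  rw [LinearMap.comp_apply, transfer_to_eraseBox, mapy_basisVec _ h hi]
  by_cases hne : (r, j) = (r₀, j₀)
  · obtain ⟨rfl, rfl⟩ := Prod.mk.inj hne
    rw [basisVec_of_notMem (eraseBox μ _ hb) (fun h =>
      ((mem_hookIndex_eraseBox hb r j).1 h).2 rfl), map_zero, if_neg hj.ne]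
  · rw [mapy_basisVec _ ((mem_hookIndex_eraseBox hb r j).2 ⟨h, hne⟩) hi]

/-- If the removed box lies on or above the diagonal, the representation attached to the smaller
diagram is a subrepresentation. -/
noncomputable def eraseInclusion (hb : IsRemovable μ (boxOf r₀ j₀)) (hj : 0 ≤ j₀)
    (h0 : θ (j₀ : ZMod ℓ) = 0) : QuiverRep.Hom (repA θ (eraseBox μ _ hb)) (repA θ μ) where
  app
    | .node i => transfer (eraseBox μ _ hb) μ i
    | .inf => (LinearMap.id : ℂ →ₗ[ℂ] ℂ)
  comm {a b} f v := by
    change Arrow ℓ a b at f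
    cases f with
    | X i => exact transfer_mapX_from_eraseBox hb hj i v
    | Y i => exact transfer_mapY_from_eraseBox θ hb hj h0 i v
    | x => exact transfer_mapx_from_eraseBox θ hb h0 v
    | y => exact mapy_transfer_from_eraseBox hb v

/-- If the removed box lies below the diagonal, the representation attached to the smaller diagram
is a quotient. -/
noncomputable def eraseProjection (hb : IsRemovable μ (boxOf r₀ j₀)) (hj : j₀ < 0)
    (h0 : θ (j₀ : ZMod ℓ) = 0) : QuiverRep.Hom (repA θ μ) (repA θ (eraseBox μ _ hb)) where
  app
    | .node i => transfer μ (eraseBox μ _ hb) i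
    | .inf => (LinearMap.id : ℂ →ₗ[ℂ] ℂ)
  comm {a b} f v := by
    change Arrow ℓ a b at f
    cases f with
    | X i => exact transfer_mapX_to_eraseBox hb hj i v
    | Y i => exact transfer_mapY_to_eraseBox θ hb hj h0 i v
    | x => exact transfer_mapx_to_eraseBox θ hb h0 v
    | y => exact mapy_transfer_to_eraseBox hb hj v

end Erase

/-! ### The short exact sequence of a removable box -/

section Exact

variable {ℓ : ℕ} (θ : ZMod ℓ → ℂ) {μ : YoungDiagram} {r₀ : ℕ} {j₀ : ℤ}

theorem coeffAt_mapX_from (hb : IsRemovable μ (boxOf r₀ j₀)) (hj : 0 ≤ j₀) (i : ZMod ℓ)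
    (v : NodeSpace μ (i + 1)) : coeffAt μ i r₀ j₀ (mapX μ i v) = 0 := by
  refine LinearMap.congr_fun (f := coeffAt μ i r₀ j₀ ∘ₗ mapX μ i) (g := 0)
    (nodeSpace_hom_ext fun r j h hi => ?_) v
  rw [LinearMap.comp_apply, mapX_basisVec _ h hi, coeffAt_basisVec_of_ne, LinearMap.zero_apply]
  intro heq
  obtain ⟨rfl, rfl⟩ := Prod.mk.inj heq
  have := ((mem_hookIndex_iff_bounds _ _ _).1 h).2.2
  rw [arm_of_removable hb hj] at this
  omega

/-- `Y` raises the content by one. -/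
theorem coeffAt_mapY_basisVec {r r' : ℕ} {j j' : ℤ} (hne : j ≠ j' + 1) {i : ZMod ℓ}
    (h : (r', j') ∈ hookIndex μ) (hi : (j' : ZMod ℓ) = i) :
    coeffAt μ (i + 1) r j (mapY θ μ i (basisVec μ i r' j')) = 0 := by
  have hz : ∀ t, coeffAt μ (i + 1) r j (basisVec μ (i + 1) t (j' + 1)) = 0 := fun t =>
    coeffAt_basisVec_of_ne μ fun heq => hne (Prod.mk.inj heq).2.symm
  rcases lt_or_ge j' 0 with hj' | hj'
  · rw [mapY_basisVec_of_neg θ _ le_rfl h hi hj', map_add, map_smul, map_sum, hz, smul_zero,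
      zero_add]
    exact Finset.sum_eq_zero fun t _ => by rw [map_smul, hz, smul_zero]
  · rw [mapY_basisVec_of_nonneg θ _ h hi hj', map_sub, map_neg, map_smul, map_sum, hz, smul_zero,
      neg_zero, zero_sub, neg_eq_zero]
    exact Finset.sum_eq_zero fun t _ => by rw [map_smul, hz, smul_zero]

theorem coeffAt_mapY_from (hb : IsRemovable μ (boxOf r₀ j₀)) (hj : 0 ≤ j₀)
    (h0 : θ (j₀ : ZMod ℓ) = 0) (i : ZMod ℓ)
    (v : NodeSpace μ i) : coeffAt μ (i + 1) r₀ j₀ (mapY θ μ i v) = 0 := by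
  rw [← transfer_add_coeffAt hb v, map_add, map_add, ← transfer_mapY_from_eraseBox θ hb hj h0,
    coeffAt_transfer hb, zero_add, map_smul, map_smul]
  by_cases hi : (j₀ : ZMod ℓ) = i
  · rw [coeffAt_mapY_basisVec θ (by omega) (mem_hookIndex_of_removable hb) hi, smul_zero]
  · have h1 : basisVec μ i r₀ j₀ = 0 := dif_neg fun h => hi h.2
    rw [h1, map_zero, map_zero, smul_zero]

theorem coeffAt_mapx_from (hb : IsRemovable μ (boxOf r₀ j₀))
    (h0 : θ (j₀ : ZMod ℓ) = 0) (c : ℂ) : coeffAt μ 0 r₀ j₀ (mapx θ μ c) = 0 := by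
  rw [← transfer_mapx_from_eraseBox θ hb h0 c, coeffAt_transfer hb]

/-- The coefficient of the basis vector of a removable box on or above the diagonal, as a quotient
map to `L(α_i)`. -/
noncomputable def boxQuotient (hb : IsRemovable μ (boxOf r₀ j₀)) (hj : 0 ≤ j₀)
    (h0 : θ (j₀ : ZMod ℓ) = 0) : QuiverRep.Hom (repA θ μ) (simpleAt (j₀ : ZMod ℓ)) where
  app
    | .node i => LinearMap.pi fun _ => coeffAt μ i r₀ j₀
    | .inf => 0
  comm {a b} f v := by
    change Arrow ℓ a b at f
    cases f with
    | X i => exact funext fun _ => coeffAt_mapX_from hb hj i v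
    | Y i => exact funext fun _ => coeffAt_mapY_from θ hb hj h0 i v
    | x => exact funext fun _ => coeffAt_mapx_from θ hb h0 v
    | y => exact funext fun u => nomatch u

/-- The maps `L(α_i) → A_μ` onto the line spanned by the basis vector `v_{r,j}`. -/
noncomputable def lineMap (μ : YoungDiagram) (r : ℕ) (j : ℤ) (i i' : ZMod ℓ) :
    ({_u : Unit // Vertex.node i = .node i'} → ℂ) →ₗ[ℂ] NodeSpace μ i :=
  open Classical in Fintype.linearCombination ℂ fun _ => basisVec μ i r j

theorem lineMap_self {i i' : ZMod ℓ} (u : {_u : Unit // Vertex.node i = .node i'})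
    (r : ℕ) (j : ℤ) (c : {_u : Unit // Vertex.node i = .node i'} → ℂ) :
    lineMap μ r j i i' c = c u • basisVec μ i r j := by
  classical
  rw [lineMap, Fintype.linearCombination_apply, Fintype.sum_eq_single u fun u' hu =>
    absurd (Subsingleton.elim u' u) hu]

theorem lineMap_of_ne {i i' : ZMod ℓ} (h : i ≠ i')
    (r : ℕ) (j : ℤ) (c : {_u : Unit // Vertex.node i = .node i'} → ℂ) :
    lineMap μ r j i i' c = 0 := by
  have : c = 0 := funext fun u => absurd (Vertex.node.inj u.2) h
  rw [this, map_zero]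

theorem mapX_lineMap (hb : IsRemovable μ (boxOf r₀ j₀)) (hj : j₀ < 0) (i : ZMod ℓ)
    (c : {_u : Unit // Vertex.node (i + 1) = .node (j₀ : ZMod ℓ)} → ℂ) :
    mapX μ i (lineMap μ r₀ j₀ _ _ c) = 0 := by
  by_cases hi : i + 1 = j₀
  · rw [lineMap_self ⟨(), by rw [hi]⟩, map_smul, mapX_basisVec_removable hb hj hi.symm, smul_zero]
  · rw [lineMap_of_ne hi, map_zero]

theorem mapY_lineMap (hb : IsRemovable μ (boxOf r₀ j₀)) (hj : j₀ < 0)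
    (h0 : θ (j₀ : ZMod ℓ) = 0) (i : ZMod ℓ)
    (c : {_u : Unit // Vertex.node i = .node (j₀ : ZMod ℓ)} → ℂ) :
    mapY θ μ i (lineMap μ r₀ j₀ _ _ c) = 0 := by
  by_cases hi : i = j₀
  · rw [lineMap_self ⟨(), by rw [hi]⟩, map_smul, mapY_basisVec_removable θ hb hj h0 hi.symm,
      smul_zero]
  · rw [lineMap_of_ne hi, map_zero]

theorem mapy_lineMap (hb : IsRemovable μ (boxOf r₀ j₀)) (hj : j₀ < 0)
    (c : {_u : Unit // Vertex.node 0 = .node (j₀ : ZMod ℓ)} → ℂ) :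
    mapy μ (lineMap μ r₀ j₀ _ _ c) = 0 := by
  by_cases hi : (0 : ZMod ℓ) = j₀
  · rw [lineMap_self ⟨(), by rw [hi]⟩, map_smul,
      mapy_basisVec _ (mem_hookIndex_of_removable hb) hi.symm, if_neg hj.ne, smul_zero]
  · rw [lineMap_of_ne hi, map_zero]

/-- The line spanned by the basis vector of a removable box below the diagonal, as the image of
`L(α_i)`. -/
noncomputable def boxInclusion (hb : IsRemovable μ (boxOf r₀ j₀)) (hj : j₀ < 0)
    (h0 : θ (j₀ : ZMod ℓ) = 0) : QuiverRep.Hom (simpleAt (j₀ : ZMod ℓ)) (repA θ μ) where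
  app
    | .node i => lineMap μ r₀ j₀ i j₀
    | .inf => 0
  comm {a b} f v := by
    change Arrow ℓ a b at f
    cases f with
    | X i => exact (map_zero (lineMap μ r₀ j₀ _ _)).trans (mapX_lineMap hb hj i v).symm
    | Y i => exact (map_zero (lineMap μ r₀ j₀ _ _)).trans (mapY_lineMap θ hb hj h0 i v).symm
    | x => exact (map_zero (lineMap μ r₀ j₀ _ _)).trans (map_zero (mapx θ μ)).symm
    | y => exact (mapy_lineMap hb hj v).symm

theorem hasShortExact_of_nonneg (hb : IsRemovable μ (boxOf r₀ j₀)) (hj : 0 ≤ j₀)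
    (h0 : θ (j₀ : ZMod ℓ) = 0) :
    QuiverRep.HasShortExact (repA θ (eraseBox μ _ hb)) (repA θ μ) (simpleAt (j₀ : ZMod ℓ)) := by
  refine ⟨eraseInclusion θ hb hj h0, boxQuotient θ hb hj h0, ?_⟩
  rintro (i | _)
  · refine ⟨(fun u v huv => ?_ : Function.Injective (transfer (eraseBox μ _ hb) μ i)), ?_, ?_⟩
    · rw [← transfer_transfer_eraseBox hb u, huv, transfer_transfer_eraseBox hb]
    · intro v
      change (fun _ => coeffAt μ i r₀ j₀ v) = _ ↔ ∃ u, transfer (eraseBox μ _ hb) μ i u = v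
      constructor
      · intro h
        refine ⟨transfer μ (eraseBox μ _ hb) i v, ?_⟩
        conv_rhs => rw [← transfer_add_coeffAt hb v]
        by_cases hi : (j₀ : ZMod ℓ) = i
        · have h1 : coeffAt μ i r₀ j₀ v = 0 := congrFun h ⟨(), by rw [hi]⟩
          rw [h1, zero_smul, add_zero]
        · have h1 : basisVec μ i r₀ j₀ = 0 := dif_neg fun h => hi h.2
          rw [h1, smul_zero, add_zero]
      · rintro ⟨u, rfl⟩
        exact funext fun _ => coeffAt_transfer hb u
    · intro c
      change ∃ v, (fun _ => coeffAt μ i r₀ j₀ v) = c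
      by_cases hi : (j₀ : ZMod ℓ) = i
      · refine ⟨c ⟨(), by rw [hi]⟩ • basisVec μ i r₀ j₀, funext fun u => ?_⟩
        rw [map_smul, coeffAt_basisVec μ (mem_hookIndex_of_removable hb) hi, if_pos rfl,
          smul_eq_mul, mul_one]
      · exact ⟨0, funext fun u => absurd (Vertex.node.inj u.2).symm hi⟩
  · refine ⟨Function.injective_id, ?_, fun c => ⟨0, funext fun u => nomatch u⟩⟩
    intro v
    exact ⟨fun _ => ⟨v, rfl⟩, fun _ => funext fun u => nomatch u⟩

theorem hasShortExact_of_neg (hb : IsRemovable μ (boxOf r₀ j₀)) (hj : j₀ < 0)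
    (h0 : θ (j₀ : ZMod ℓ) = 0) :
    QuiverRep.HasShortExact (simpleAt (j₀ : ZMod ℓ)) (repA θ μ) (repA θ (eraseBox μ _ hb)) := by
  refine ⟨boxInclusion θ hb hj h0, eraseProjection θ hb hj h0, ?_⟩
  rintro (i | _)
  · refine ⟨?_, fun v => ?_,
      fun w => ⟨transfer (eraseBox μ _ hb) μ i w, transfer_transfer_eraseBox hb w⟩⟩
    · change Function.Injective (lineMap μ r₀ j₀ i (j₀ : ZMod ℓ))
      refine fun c d hcd => funext fun u => ?_
      have hi : (j₀ : ZMod ℓ) = i := (Vertex.node.inj u.2).symm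
      rw [lineMap_self u, lineMap_self u] at hcd
      have h1 := congrArg (coeffAt μ i r₀ j₀) hcd
      rwa [map_smul, map_smul, coeffAt_basisVec μ (mem_hookIndex_of_removable hb) hi, if_pos rfl,
        smul_eq_mul, smul_eq_mul, mul_one, mul_one] at h1
    · change transfer μ (eraseBox μ _ hb) i v = 0 ↔ ∃ c, lineMap μ r₀ j₀ i (j₀ : ZMod ℓ) c = v
      constructor
      · intro h
        refine ⟨fun _ => coeffAt μ i r₀ j₀ v, ?_⟩
        conv_rhs => rw [← transfer_add_coeffAt hb v]
        rw [h, map_zero, zero_add]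
        by_cases hi : i = j₀
        · rw [lineMap_self ⟨(), by rw [hi]⟩]
        · have h1 : basisVec μ i r₀ j₀ = 0 := dif_neg fun h => hi h.2.symm
          rw [lineMap_of_ne hi, h1, smul_zero]
      · rintro ⟨c, rfl⟩
        by_cases hi : i = j₀
        · rw [lineMap_self ⟨(), by rw [hi]⟩, map_smul, transfer_to_eraseBox hb,
            basisVec_of_notMem _ fun h => ((mem_hookIndex_eraseBox hb _ _).1 h).2 rfl, smul_zero]
        · rw [lineMap_of_ne hi, map_zero]
  · refine ⟨fun c d _ => funext fun u => (nomatch u), ?_, Function.surjective_id⟩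
    intro v
    constructor
    · intro h
      exact ⟨fun u => (nomatch u), Eq.symm h⟩
    · rintro ⟨c, rfl⟩
      rfl

/-- Removing a removable box on which the parameter vanishes splits off a one-dimensional
representation, as a quotient or as a subrepresentation. -/
theorem hasShortExact_eraseBox (μ : YoungDiagram) (b : ℕ × ℕ) (hb : IsRemovable μ b)
    (h0 : θ (residue ℓ b) = 0) :
    QuiverRep.HasShortExact (simpleAt (residue ℓ b)) (repA θ μ) (repA θ (eraseBox μ b hb)) ∨
      QuiverRep.HasShortExact (repA θ (eraseBox μ b hb)) (repA θ μ) (simpleAt (residue ℓ b)) := by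
  obtain ⟨r₀, j₀, rfl⟩ := exists_boxOf b
  rw [residue_boxOf] at h0 ⊢
  rcases lt_or_ge j₀ 0 with hj | hj
  · exact Or.inl (hasShortExact_of_neg θ hb hj h0)
  · exact Or.inr (hasShortExact_of_nonneg θ hb hj h0)

end Exact

namespace QuiverRep

/-! ### Morphisms, subrepresentations and composition factors -/

variable {Q : Type} [Quiver.{0} Q]

/-- The identity morphism. -/
def Hom.id (M : QuiverRep Q) : Hom M M where
  app _ := LinearMap.id
  comm _ _ := rfl

/-- Composition of morphisms. -/
def Hom.comp {M N P : QuiverRep Q} (g : Hom N P) (f : Hom M N) : Hom M P where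
  app a := g.app a ∘ₗ f.app a
  comm h v := by simp only [LinearMap.comp_apply, f.comm, g.comm]

/-- The inverse of a bijective morphism. -/
noncomputable def Hom.inverse {M N : QuiverRep Q} (f : Hom M N)
    (hf : ∀ a, Function.Bijective (f.app a)) : Hom N M where
  app a := (LinearEquiv.ofBijective (f.app a) (hf a)).symm
  comm {a b} h v := by
    apply (hf b).1
    have h1 : ∀ a w, f.app a ((LinearEquiv.ofBijective (f.app a) (hf a)).symm w) = w := fun a w =>
      (LinearEquiv.ofBijective (f.app a) (hf a)).apply_symm_apply w
    rw [LinearEquiv.coe_coe, LinearEquiv.coe_coe, f.comm, h1, h1]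

theorem Isomorphic.refl (M : QuiverRep Q) : Isomorphic M M :=
  ⟨Hom.id M, fun _ => Function.bijective_id⟩

theorem Isomorphic.symm {M N : QuiverRep Q} (h : Isomorphic M N) : Isomorphic N M := by
  obtain ⟨f, hf⟩ := h
  exact ⟨f.inverse hf, fun a => (LinearEquiv.ofBijective (f.app a) (hf a)).symm.bijective⟩

theorem Isomorphic.trans {M N P : QuiverRep Q} (h : Isomorphic M N) (h' : Isomorphic N P) :
    Isomorphic M P := by
  obtain ⟨f, hf⟩ := h
  obtain ⟨g, hg⟩ := h'
  exact ⟨g.comp f, fun a => (hg a).comp (hf a)⟩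

theorem Isomorphic.prod {M M' N N' : QuiverRep Q} (h : Isomorphic M M') (h' : Isomorphic N N') :
    Isomorphic (M.prod N) (M'.prod N') := by
  obtain ⟨f, hf⟩ := h
  obtain ⟨g, hg⟩ := h'
  refine ⟨⟨fun a => (f.app a).prodMap (g.app a), fun h v => ?_⟩, fun a => ?_⟩
  · exact Prod.ext (f.comm h v.1) (g.comm h v.2)
  · exact ((hf a).prodMap (hg a) :)

/-- Direct sums of families that agree up to isomorphism and reindexing are isomorphic. -/
theorem isomorphic_directSum {ι κ : Type} [Finite ι] [Finite κ] {M : ι → QuiverRep Q}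
    {N : κ → QuiverRep Q} (e : ι ≃ κ) (h : ∀ i, Isomorphic (M i) (N (e i))) :
    Isomorphic (directSum M) (directSum N) := by
  refine Isomorphic.symm ?_
  choose f hf using fun i => (h i).symm
  refine ⟨⟨fun a => LinearMap.pi fun i => (f i).app a ∘ₗ LinearMap.proj (e i), fun g v => ?_⟩,
    fun a => ⟨fun v w hvw => ?_, fun v => ?_⟩⟩
  · exact funext fun i => (f i).comm g (v (e i))
  · refine funext fun k => ?_
    obtain ⟨i, rfl⟩ := e.surjective k
    exact (hf i a).1 (congrFun hvw i)
  · choose u hu using fun i => (hf i a).2 (v i)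
    refine ⟨Equiv.piCongrLeft (fun k => (N k).V a) e u, funext fun i => ?_⟩
    change (f i).app a (Equiv.piCongrLeft (fun k => (N k).V a) e u (e i)) = v i
    rw [Equiv.piCongrLeft_apply_apply, hu]

theorem directSum_option {ι : Type} [Finite ι] (S : Option ι → QuiverRep Q) :
    Isomorphic (directSum S) ((S none).prod (directSum fun i => S (some i))) := by
  refine ⟨⟨fun a => LinearMap.prod (LinearMap.proj none) (LinearMap.pi fun i =>
    LinearMap.proj (some i)), fun _ _ => rfl⟩, fun a => ⟨fun v w hvw => funext fun i => ?_,
      fun v => ?_⟩⟩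
  · cases i with
    | none => exact congrArg Prod.fst hvw
    | some i => exact congrFun (congrArg Prod.snd hvw) i
  · exact ⟨fun i => match i with
      | none => v.1
      | some i => v.2 i, rfl⟩

instance (M : QuiverRep Q) : Lattice (Subrep M) where
  sup N P := ⟨fun a => N.carrier a ⊔ P.carrier a, fun f v hv => by
    obtain ⟨n, hn, p, hp, rfl⟩ := Submodule.mem_sup.1 hv
    rw [map_add]
    exact Submodule.add_mem_sup (N.map_mem f n hn) (P.map_mem f p hp)⟩
  le_sup_left _ _ := fun _ => le_sup_left
  le_sup_right _ _ := fun _ => le_sup_right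
  sup_le _ _ _ h h' := fun a => sup_le (h a) (h' a)
  inf N P := ⟨fun a => N.carrier a ⊓ P.carrier a, fun f v hv =>
    ⟨N.map_mem f v hv.1, P.map_mem f v hv.2⟩⟩
  inf_le_left _ _ := fun _ => inf_le_left
  inf_le_right _ _ := fun _ => inf_le_right
  le_inf _ _ _ h h' := fun a => le_inf (h a) (h' a)

instance (M : QuiverRep Q) : IsModularLattice (Subrep M) where
  sup_inf_le_assoc_of_le y _ h := fun a =>
    IsModularLattice.sup_inf_le_assoc_of_le (y.carrier a) (h a)

/-- The image of a subrepresentation. -/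
def Subrep.map {M N : QuiverRep Q} (f : Hom M N) (K : Subrep M) : Subrep N where
  carrier a := (K.carrier a).map (f.app a)
  map_mem h v hv := by
    obtain ⟨w, hw, rfl⟩ := hv
    exact ⟨M.map h w, K.map_mem h w hw, f.comm h w⟩

/-- The preimage of a subrepresentation. -/
def Subrep.comap {M N : QuiverRep Q} (f : Hom M N) (K : Subrep N) : Subrep M where
  carrier a := (K.carrier a).comap (f.app a)
  map_mem h v hv := by
    rw [Submodule.mem_comap, f.comm]
    exact K.map_mem h _ hv

/-- A criterion for a morphism to induce an isomorphism of subquotients. -/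
theorem isomorphic_subquotient {A M : QuiverRep Q} (f : Hom A M) {N P : Subrep A} {N' P' : Subrep M}
    (h1 : ∀ a, ∀ v ∈ P.carrier a, f.app a v ∈ P'.carrier a)
    (h2 : ∀ a, ∀ v ∈ P.carrier a, f.app a v ∈ N'.carrier a ↔ v ∈ N.carrier a)
    (h3 : ∀ a, ∀ w ∈ P'.carrier a, ∃ v ∈ P.carrier a, w - f.app a v ∈ N'.carrier a) :
    Isomorphic (subquotient N P) (subquotient N' P') := by
  have h4 : ∀ a, (N.carrier a).submoduleOf (P.carrier a) ≤
      ((N'.carrier a).submoduleOf (P'.carrier a)).comap ((f.app a).restrict (h1 a)) :=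
    fun a v hv => (h2 a v.1 v.2).2 hv
  refine ⟨⟨fun a => Submodule.mapQ _ _ ((f.app a).restrict (h1 a)) (h4 a), ?_⟩, fun a => ⟨?_, ?_⟩⟩
  · intro a b g v
    obtain ⟨v, rfl⟩ := Submodule.mkQ_surjective _ v
    refine congrArg (Submodule.mkQ _) (Subtype.ext ?_)
    exact f.comm g v.1
  · refine (injective_iff_map_eq_zero (Submodule.mapQ _ _ _ (h4 a))).2 fun v hv => ?_
    obtain ⟨v, rfl⟩ := Submodule.mkQ_surjective _ v
    rw [Submodule.mkQ_apply, Submodule.mapQ_apply, Submodule.Quotient.mk_eq_zero] at hv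
    rw [Submodule.mkQ_apply, Submodule.Quotient.mk_eq_zero]
    exact (h2 a v.1 v.2).1 hv
  · intro w
    obtain ⟨w, rfl⟩ := Submodule.mkQ_surjective _ w
    obtain ⟨v, hv, hvw⟩ := h3 a w.1 w.2
    refine ⟨Submodule.mkQ _ ⟨v, hv⟩, ?_⟩
    refine Eq.symm ((Submodule.Quotient.eq _).2 ?_)
    exact hvw

theorem isomorphic_subquotient_bot_top (M : QuiverRep Q) :
    Isomorphic (subquotient (⊥ : Subrep M) ⊤) M := by
  let F : ∀ a, M.V a →ₗ[ℂ] (subquotient (⊥ : Subrep M) ⊤).V a := fun a =>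
    Submodule.mkQ _ ∘ₗ (LinearMap.id (R := ℂ) (M := M.V a)).codRestrict ⊤
      (fun _ => Submodule.mem_top)
  refine Isomorphic.symm ⟨⟨F, fun _ _ => rfl⟩, fun a => ⟨?_, ?_⟩⟩
  · refine (injective_iff_map_eq_zero (F a)).2 fun v hv => ?_
    exact (Submodule.Quotient.mk_eq_zero _).1 hv
  · intro w
    obtain ⟨w, rfl⟩ := Submodule.mkQ_surjective _ w
    exact ⟨w.1, rfl⟩

/-- The subrepresentation `P` of `M` has a filtration starting from `0` with simple subquotients
isomorphic to the members of the multiset. -/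
inductive HasFactors (M : QuiverRep Q) : Subrep M → Multiset (QuiverRep Q) → Prop
  | bot : HasFactors M ⊥ 0
  | step {N P : Subrep M} {l : Multiset (QuiverRep Q)} {S : QuiverRep Q} :
      HasFactors M N l → N ⋖ P → Isomorphic (subquotient N P) S → HasFactors M P (S ::ₘ l)

theorem hasFactors_of_isSimple {M : QuiverRep Q} (h : M.IsSimple) : HasFactors M ⊤ {M} := by
  have : IsSimpleOrder (Subrep M) := h
  exact HasFactors.bot.step bot_covBy_top (isomorphic_subquotient_bot_top M)

theorem map_covBy {A M : QuiverRep Q} {f : Hom A M} (hf : ∀ a, Function.Injective (f.app a))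
    {N P : Subrep A} (h : N ⋖ P) : N.map f ⋖ P.map f := by
  have hle : ∀ {N P : Subrep A}, N.map f ≤ P.map f → N ≤ P := fun h a v hv => by
    obtain ⟨w, hw, hwv⟩ := h a ⟨v, hv, rfl⟩
    rwa [← hf a hwv]
  have hmono : ∀ {N P : Subrep A}, N ≤ P → N.map f ≤ P.map f := fun h a => Submodule.map_mono (h a)
  refine ⟨lt_of_le_not_ge (hmono h.1.le) fun h' => h.1.not_ge (hle h'), fun K hNK hKP => ?_⟩
  have hK : (K.comap f).map f = K := by
    refine le_antisymm (fun a => Submodule.map_comap_le _ _) fun a v hv => ?_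
    obtain ⟨w, hw, rfl⟩ := hKP.le a hv
    exact ⟨w, hv, rfl⟩
  rw [← hK] at hNK hKP
  exact h.2 (lt_of_le_not_ge (hle hNK.le) fun h' => hNK.not_ge (hmono h'))
    (lt_of_le_not_ge (hle hKP.le) fun h' => hKP.not_ge (hmono h'))

theorem comap_covBy {M C : QuiverRep Q} {g : Hom M C} (hg : ∀ a, Function.Surjective (g.app a))
    {N P : Subrep C} (h : N ⋖ P) : N.comap g ⋖ P.comap g := by
  have hle : ∀ {N P : Subrep C}, N.comap g ≤ P.comap g → N ≤ P := fun h a v hv => by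
    obtain ⟨w, rfl⟩ := hg a v
    exact h a hv
  have hmono : ∀ {N P : Subrep C}, N ≤ P → N.comap g ≤ P.comap g :=
    fun h a => Submodule.comap_mono (h a)
  refine ⟨lt_of_le_not_ge (hmono h.1.le) fun h' => h.1.not_ge (hle h'), fun K hNK hKP => ?_⟩
  have hK : (K.map g).comap g = K := by
    refine le_antisymm (fun a v hv => ?_) fun a => Submodule.le_comap_map _ _
    obtain ⟨w, hw, hwv⟩ := hv
    have h1 : v - w ∈ K.carrier a := hNK.le a (by
      change g.app a (v - w) ∈ N.carrier a
      rw [map_sub, hwv, sub_self]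
      exact Submodule.zero_mem _)
    simpa using Submodule.add_mem _ h1 hw
  rw [← hK] at hNK hKP
  exact h.2 (lt_of_le_not_ge (hle hNK.le) fun h' => hNK.not_ge (hmono h'))
    (lt_of_le_not_ge (hle hKP.le) fun h' => hKP.not_ge (hmono h'))

theorem HasFactors.map {A M : QuiverRep Q} {f : Hom A M} (hf : ∀ a, Function.Injective (f.app a))
    {N : Subrep A} {l : Multiset (QuiverRep Q)} (h : HasFactors A N l) :
    HasFactors M (N.map f) l := by
  induction h with
  | bot =>
    have : (⊥ : Subrep A).map f = ⊥ := Subrep.ext (funext fun a => Submodule.map_bot _)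
    rw [this]
    exact .bot
  | @step N P l S _ hNP hS ih =>
    refine ih.step (map_covBy hf hNP) (Isomorphic.trans (Isomorphic.symm ?_) hS)
    refine isomorphic_subquotient f (fun a v hv => ⟨v, hv, rfl⟩) (fun a v hv => ⟨?_, ?_⟩) ?_
    · rintro ⟨w, hw, hwv⟩
      rwa [← hf a hwv]
    · exact fun hv' => ⟨v, hv', rfl⟩
    · rintro a _ ⟨v, hv, rfl⟩
      exact ⟨v, hv, by rw [sub_self]; exact Submodule.zero_mem _⟩

theorem HasFactors.comap {M C : QuiverRep Q} {g : Hom M C}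
    (hg : ∀ a, Function.Surjective (g.app a)) {l₀ : Multiset (QuiverRep Q)}
    (h₀ : HasFactors M ((⊥ : Subrep C).comap g) l₀)
    {N : Subrep C} {l : Multiset (QuiverRep Q)} (h : HasFactors C N l) :
    HasFactors M (N.comap g) (l + l₀) := by
  induction h with
  | bot => rwa [zero_add]
  | @step N P l S _ hNP hS ih =>
    rw [Multiset.cons_add]
    refine ih.step (comap_covBy hg hNP) (Isomorphic.trans ?_ hS)
    refine isomorphic_subquotient g (fun a v hv => hv) (fun a v hv => Iff.rfl) fun a w hw => ?_
    obtain ⟨v, rfl⟩ := hg a w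
    exact ⟨v, hw, by rw [sub_self]; exact Submodule.zero_mem _⟩

/-- The composition factors of the middle term of a short exact sequence are those of the two
other terms. -/
theorem HasFactors.of_hasShortExact {A M C : QuiverRep Q} (hs : HasShortExact A M C)
    {l l' : Multiset (QuiverRep Q)} (hA : HasFactors A ⊤ l) (hC : HasFactors C ⊤ l') :
    HasFactors M ⊤ (l' + l) := by
  obtain ⟨f, g, h⟩ := hs
  have h1 : (⊤ : Subrep A).map f = (⊥ : Subrep C).comap g := by
    refine Subrep.ext (funext fun a => ?_)
    change Submodule.map (f.app a) ⊤ = LinearMap.ker (g.app a)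
    rw [Submodule.map_top]
    exact ((LinearMap.exact_iff).1 (h a).2.1).symm
  have h2 : (⊤ : Subrep C).comap g = ⊤ := rfl
  rw [← h2]
  refine HasFactors.comap (fun a => (h a).2.2) ?_ hC
  rw [← h1]
  exact hA.map fun a => (h a).1

theorem HasFactors.exists_series {M : QuiverRep Q} {P : Subrep M} {l : Multiset (QuiverRep Q)}
    (h : HasFactors M P l) : ∃ (n : ℕ) (F : ℕ → Subrep M) (g : ℕ → QuiverRep Q), F 0 = ⊥ ∧ F n = P ∧
      (∀ i < n, F i ⋖ F (i + 1) ∧ Isomorphic (subquotient (F i) (F (i + 1))) (g i)) ∧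
      (Multiset.range n).map g = l := by
  induction h with
  | bot => exact ⟨0, fun _ => ⊥, fun _ => M, rfl, rfl, by simp, by simp⟩
  | @step N P l S _ hNP hS ih =>
    obtain ⟨n, F, g, h0, hn, hF, hl⟩ := ih
    refine ⟨n + 1, fun i => if i ≤ n then F i else P, fun i => if i < n then g i else S,
      ?_, ?_, ?_, ?_⟩
    · simpa using h0
    · simp
    · intro i hi
      rcases Nat.lt_succ_iff_lt_or_eq.1 hi with hi | rfl
      · simpa [hi.le, Nat.succ_le_iff.2 hi, hi] using hF i hi
      · simpa [hn] using ⟨hNP, hS⟩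
    · rw [Multiset.range_succ, Multiset.map_cons, if_neg (lt_irrefl n), ← hl]
      congr 1
      exact Multiset.map_congr rfl fun i hi => if_pos (Multiset.mem_range.1 hi)

theorem exists_equiv_of_map_eq {ι κ : Type} [Fintype ι] [Fintype κ] {α : Type*} {f : ι → α}
    {g : κ → α} (h : Finset.univ.val.map f = Finset.univ.val.map g) :
    ∃ e : ι ≃ κ, ∀ i, f i = g (e i) := by
  classical
  have hcard : ∀ a, Fintype.card {i // f i = a} = Fintype.card {k // g k = a} := fun a => by
    have := congrArg (Multiset.count a) h
    rw [Multiset.count_map, Multiset.count_map] at this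
    rw [Fintype.card_subtype, Fintype.card_subtype]
    simpa only [Finset.card_def, Finset.filter_val, eq_comm (a := a)] using this
  let e : ∀ a, {i // f i = a} ≃ {k // g k = a} := fun a => Fintype.equivOfCardEq (hcard a)
  refine ⟨(Equiv.sigmaFiberEquiv f).symm.trans ((Equiv.sigmaCongrRight e).trans
    (Equiv.sigmaFiberEquiv g)), fun i => ?_⟩
  exact ((e (f i)) ⟨i, rfl⟩).2.symm

/-- The semisimplification is the direct sum of the members of any multiset of composition factors:
the Jordan-Hölder theorem. -/
theorem HasFactors.semisimplification_isomorphic [Finite Q] {M : QuiverRep Q}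
    {l : Multiset (QuiverRep Q)} (h : HasFactors M ⊤ l) {ι : Type} [Fintype ι] {S : ι → QuiverRep Q}
    (hS : Finset.univ.val.map S = l) : Isomorphic M.semisimplification (directSum S) := by
  obtain ⟨n, F, g, h0, hn, hF, hl⟩ := h.exists_series
  let s : CompSeries M := Classical.choice (nonempty_compSeries M)
  let s₁ : CompositionSeries (Subrep M) := ⟨s.length, s.F, s.step⟩
  let s₂ : CompositionSeries (Subrep M) := ⟨n, fun i => F i, fun i => (hF i i.2).1⟩
  obtain ⟨e, he⟩ := CompositionSeries.jordan_holder s₁ s₂ (s.head.trans h0.symm)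
    (s.last.trans hn.symm)
  have hmap : (Finset.univ : Finset (Fin n)).val.map (fun i : Fin n => g i) =
      Finset.univ.val.map S := by
    rw [hS, ← hl]
    have h1 := congrArg Finset.val (Fin.map_valEmbedding_univ (n := n))
    rw [Finset.map_val] at h1
    have h2 : (Finset.Iio n).val = Multiset.range n := by
      rw [← Finset.range_val]
      congr 1
      ext
      simp
    rw [← h2, ← h1, Multiset.map_map]
    rfl
  obtain ⟨e', he'⟩ := exists_equiv_of_map_eq hmap
  refine isomorphic_directSum (e.trans e') fun i => ?_
  have h1 : Isomorphic (subquotient (s.F i.castSucc) (s.F i.succ))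
      (subquotient (F (e i)) (F (e i + 1))) := by
    refine JordanHolderLattice.Iso.rel (X := Subrep M) (fun x y => Isomorphic (subquotient x.1 x.2)
      (subquotient y.1 y.2)) (fun {x} => Isomorphic.refl _) Isomorphic.symm
      Isomorphic.trans ?_ (he i)
    intro x y _
    refine Isomorphic.symm (isomorphic_subquotient (Hom.id M) (fun a v hv => ?_)
      (fun a v hv => ⟨fun h => ⟨h, hv⟩, fun h => h.1⟩) fun a w hw => ?_)
    · exact Submodule.mem_sup_right hv
    · obtain ⟨u, hu, v, hv, rfl⟩ := Submodule.mem_sup.1 hw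
      exact ⟨v, hv, by simpa [Hom.id] using hu⟩
  refine h1.trans ((hF (e i) (e i).2).2.trans ?_)
  rw [he' (e i)]
  exact Isomorphic.refl _

/-- A morphism between simple representations that is nonzero at one vertex is an isomorphism. -/
theorem bijective_of_isSimple {M N : QuiverRep Q} (hM : M.IsSimple) (hN : N.IsSimple) (f : Hom M N)
    {a : Q} {v : M.V a} (hv : f.app a v ≠ 0) (b : Q) : Function.Bijective (f.app b) := by
  have : IsSimpleOrder (Subrep M) := hM
  have : IsSimpleOrder (Subrep N) := hN
  have hker : (⊥ : Subrep N).comap f = ⊥ := (eq_bot_or_eq_top _).resolve_right fun h => by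
    have : v ∈ ((⊥ : Subrep N).comap f).carrier a := by rw [h]; exact Submodule.mem_top
    exact hv this
  have hran : (⊤ : Subrep M).map f = ⊤ := (eq_bot_or_eq_top _).resolve_left fun h => by
    have : f.app a v ∈ ((⊤ : Subrep M).map f).carrier a := ⟨v, Submodule.mem_top, rfl⟩
    rw [h] at this
    exact hv this
  refine ⟨?_, fun w => ?_⟩
  · rw [← LinearMap.ker_eq_bot]
    exact congrFun (congrArg Subrep.carrier hker) b
  · have : w ∈ ((⊤ : Subrep M).map f).carrier b := by rw [hran]; exact Submodule.mem_top
    obtain ⟨u, -, hu⟩ := this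
    exact ⟨u, hu⟩

end QuiverRep

/-! ### Vectors killed by both operators -/

section Commutator

variable {ℓ : ℕ} {θ : ZMod ℓ → ℂ}

theorem thetaSum_succ {p q : ℤ} (h : p ≤ q + 1) :
    thetaSum θ p (q + 1) = thetaSum θ p q + θ ((q + 1 : ℤ) : ZMod ℓ) := by
  unfold thetaSum
  have : Finset.Icc p (q + 1) = insert (q + 1) (Finset.Icc p q) := by
    ext; simp only [Finset.mem_Icc, Finset.mem_insert]; omega
  rw [this, Finset.sum_insert (by simp), add_comm]

theorem exists_pow_apply_ne_zero {V : Type*} [AddCommGroup V] [Module ℂ V] {Z : Module.End ℂ V}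
    {n : ℕ} (hZ : Z ^ n = 0) {v : V} (hv : v ≠ 0) : ∃ m, (Z ^ m) v ≠ 0 ∧ Z ((Z ^ m) v) = 0 := by
  classical
  have hex : ∃ n, (Z ^ n) v = 0 := ⟨n, by rw [hZ]; rfl⟩
  have hpos : Nat.find hex ≠ 0 := fun h => hv (by simpa [h] using Nat.find_spec hex)
  obtain ⟨m, hm⟩ := Nat.exists_eq_succ_of_ne_zero hpos
  refine ⟨m, Nat.find_min hex (by omega), ?_⟩
  have := Nat.find_spec hex
  rwa [hm, Nat.succ_eq_add_one, pow_succ', Module.End.mul_apply] at this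

/-- Let `X`, `Y` be nilpotent operators with `[X, Y] = θ_i` in degree `i`, where `θ` vanishes on no
positive root except for those in which all simple roots are zeros of `θ`. Then both operators kill
a nonzero homogeneous vector: starting from a vector `v` killed by `X`, of degree `p`, one has
`X Y ^ (k + 1) v = (θ_p + ⋯ + θ_{p + k}) Y ^ k v`, and the last nonzero `Y ^ k v` is killed by
`X`. -/
theorem exists_killed_of_commutator {V : Type*} [AddCommGroup V] [Module ℂ V] (X Y : Module.End ℂ V)
    (W : ZMod ℓ → Submodule ℂ V) (hX : ∀ i, ∀ v ∈ W (i + 1), X v ∈ W i)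
    (hY : ∀ i, ∀ v ∈ W i, Y v ∈ W (i + 1))
    (hXY : ∀ i, ∀ v ∈ W i, X (Y v) - Y (X v) = θ i • v)
    {n m : ℕ} (hXn : X ^ n = 0) (hYm : Y ^ m = 0)
    (hK : ∀ p q : ℤ, p ≤ q → thetaSum θ p q = 0 → ∀ i ∈ Finset.Icc p q, θ (i : ZMod ℓ) = 0)
    {i₀ : ZMod ℓ} {v₀ : V} (hv₀ : v₀ ∈ W i₀) (hne : v₀ ≠ 0) :
    ∃ i, ∃ w ∈ W i, w ≠ 0 ∧ X w = 0 ∧ Y w = 0 := by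
  obtain ⟨a, ha, ha'⟩ := exists_pow_apply_ne_zero hXn hne
  have hmem : ∀ k : ℕ, (X ^ k) v₀ ∈ W (i₀ - k) := fun k => by
    induction k with
    | zero => simpa using hv₀
    | succ k ih =>
      rw [pow_succ', Module.End.mul_apply]
      refine hX _ _ ?_
      have : i₀ - ((k + 1 : ℕ) : ZMod ℓ) + 1 = i₀ - k := by push_cast; ring
      rwa [this]
  obtain ⟨p, hp⟩ := ZMod.intCast_surjective (i₀ - (a : ZMod ℓ))
  set v := (X ^ a) v₀ with hv
  have hvW : v ∈ W (p : ZMod ℓ) := by rw [hp]; exact hmem a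
  have hYmem : ∀ k : ℕ, (Y ^ k) v ∈ W ((p + k : ℤ) : ZMod ℓ) := fun k => by
    induction k with
    | zero => simpa using hvW
    | succ k ih =>
      rw [pow_succ', Module.End.mul_apply]
      have : ((p + (k + 1 : ℕ) : ℤ) : ZMod ℓ) = ((p + k : ℤ) : ZMod ℓ) + 1 := by push_cast; ring
      rw [this]
      exact hY _ _ ih
  have hform : ∀ k : ℕ, X ((Y ^ (k + 1)) v) = thetaSum θ p (p + k) • (Y ^ k) v := fun k => by
    induction k with
    | zero =>
      have := hXY _ _ hvW
      rw [ha', map_zero, sub_zero] at this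
      simpa [thetaSum] using this
    | succ k ih =>
      have := hXY _ _ (hYmem (k + 1))
      rw [ih, map_smul, ← Module.End.mul_apply Y, ← pow_succ', ← Module.End.mul_apply Y,
        ← pow_succ', sub_eq_iff_eq_add] at this
      have h1 : p + ((k + 1 : ℕ) : ℤ) = p + k + 1 := by push_cast; ring
      rw [this, h1, thetaSum_succ (by omega), add_smul, add_comm]
  obtain ⟨q, hq, hq'⟩ := exists_pow_apply_ne_zero hYm ha
  have h0 : thetaSum θ p (p + q) = 0 := by
    have := hform q
    rw [pow_succ', Module.End.mul_apply, hq', map_zero] at this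
    exact (smul_eq_zero.1 this.symm).resolve_right hq
  have hθ := hK p (p + q) (by omega) h0
  refine ⟨_, _, hYmem q, hq, ?_, hq'⟩
  cases q with
  | zero => simpa using ha'
  | succ k =>
    rw [hform k]
    have : thetaSum θ p (p + k) = 0 := Finset.sum_eq_zero fun i hi => hθ i (by
      simp only [Finset.mem_Icc] at hi ⊢
      push_cast
      omega)
    rw [this, zero_smul]

end Commutator

/-! ### The total space of `A_μ` -/

section Total

variable {ℓ : ℕ} (θ : ZMod ℓ → ℂ) (μ : YoungDiagram)

/-- The direct sum of the spaces of `A_μ` at the vertices of `ℤ/ℓℤ`. -/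
abbrev TotalSpace : Type := hookIndex μ →₀ ℂ

open Classical in
/-- The vector `v_{r,j}` of the total space, `0` if `(r, j)` is not in the index set. -/
noncomputable def totalVec (r : ℕ) (j : ℤ) : TotalSpace μ :=
  if h : (r, j) ∈ hookIndex μ then Finsupp.single ⟨(r, j), h⟩ 1 else 0

theorem totalVec_of_mem {r : ℕ} {j : ℤ} (h : (r, j) ∈ hookIndex μ) :
    totalVec μ r j = Finsupp.single ⟨(r, j), h⟩ 1 :=
  dif_pos h

theorem totalVec_of_notMem {r : ℕ} {j : ℤ} (h : (r, j) ∉ hookIndex μ) : totalVec μ r j = 0 :=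
  dif_neg h

variable {μ} in
theorem totalSpace_hom_ext {M : Type*} [AddCommMonoid M] [Module ℂ M]
    {f g : TotalSpace μ →ₗ[ℂ] M}
    (h : ∀ r j, (r, j) ∈ hookIndex μ → f (totalVec μ r j) = g (totalVec μ r j)) : f = g := by
  refine Finsupp.lhom_ext' fun p => LinearMap.ext_ring ?_
  have := h p.1.1 p.1.2 p.2
  rw [totalVec_of_mem μ p.2] at this
  exact this

/-- The action of the arrows `X` on the total space. -/
noncomputable def totalX : Module.End ℂ (TotalSpace μ) :=
  Finsupp.linearCombination ℂ fun p => totalVec μ p.1.1 (p.1.2 - 1)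

/-- The action of the arrows `Y` on the total space. -/
noncomputable def totalY : Module.End ℂ (TotalSpace μ) :=
  Finsupp.linearCombination ℂ fun p =>
    if p.1.2 < 0 then
      thetaSum θ (-leg μ p.1.1) p.1.2 • totalVec μ p.1.1 (p.1.2 + 1)
        + ∑ t ∈ Finset.Ioo p.1.1 (numHooks μ), beta θ μ t • totalVec μ t (p.1.2 + 1)
    else
      -(thetaSum θ (p.1.2 + 1) (arm μ p.1.1) • totalVec μ p.1.1 (p.1.2 + 1))
        - ∑ t ∈ Finset.range p.1.1, beta θ μ t • totalVec μ t (p.1.2 + 1)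

/-- The vector `x(1)` of the total space. -/
noncomputable def totalx : TotalSpace μ :=
  ∑ r ∈ Finset.range (numHooks μ), beta θ μ r • totalVec μ r 0

/-- The linear form `y` on the total space. -/
noncomputable def totaly : TotalSpace μ →ₗ[ℂ] ℂ :=
  Finsupp.linearCombination ℂ fun p => if p.1.2 = 0 then 1 else 0

/-- The coefficient of `v_{r,j}`. -/
noncomputable def totalCoeff (r : ℕ) (j : ℤ) : TotalSpace μ →ₗ[ℂ] ℂ :=
  Finsupp.linearCombination ℂ fun p => if p.1 = (r, j) then 1 else 0

theorem totalCoeff_totalVec {r r' : ℕ} {j j' : ℤ} (h : (r', j') ∈ hookIndex μ) :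
    totalCoeff μ r j (totalVec μ r' j') = if (r', j') = (r, j) then 1 else 0 := by
  rw [totalVec_of_mem μ h, totalCoeff, Finsupp.linearCombination_single, one_smul]

theorem totalCoeff_totalVec_of_ne {r r' : ℕ} {j j' : ℤ} (h : (r', j') ≠ (r, j)) :
    totalCoeff μ r j (totalVec μ r' j') = 0 := by
  by_cases hi : (r', j') ∈ hookIndex μ
  · rw [totalCoeff_totalVec μ hi, if_neg h]
  · rw [totalVec_of_notMem μ hi, map_zero]

theorem totaly_totalVec {r : ℕ} {j : ℤ} (h : (r, j) ∈ hookIndex μ) :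
    totaly μ (totalVec μ r j) = if j = 0 then 1 else 0 := by
  rw [totalVec_of_mem μ h, totaly, Finsupp.linearCombination_single, one_smul]

theorem totalX_totalVec {r : ℕ} {j : ℤ} (h : (r, j - 1) ∈ hookIndex μ → (r, j) ∈ hookIndex μ) :
    totalX μ (totalVec μ r j) = totalVec μ r (j - 1) := by
  by_cases h' : (r, j) ∈ hookIndex μ
  · rw [totalVec_of_mem μ h', totalX, Finsupp.linearCombination_single, one_smul]
  · rw [totalVec_of_notMem μ h', totalVec_of_notMem μ fun h'' => h' (h h''), map_zero]

theorem totalY_totalVec_of_neg {r : ℕ} {j : ℤ} (h : (r, j) ∈ hookIndex μ) (hj : j < 0) :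
    totalY θ μ (totalVec μ r j) = thetaSum θ (-leg μ r) j • totalVec μ r (j + 1) +
      ∑ t ∈ Finset.Ioo r (numHooks μ), beta θ μ t • totalVec μ t (j + 1) := by
  rw [totalVec_of_mem μ h, totalY, Finsupp.linearCombination_single, one_smul, if_pos hj]

theorem totalY_totalVec_of_nonneg {r : ℕ} {j : ℤ} (h : (r, j) ∈ hookIndex μ) (hj : 0 ≤ j) :
    totalY θ μ (totalVec μ r j) =
      -(thetaSum θ (j + 1) (arm μ r) • totalVec μ r (j + 1)) -
        ∑ t ∈ Finset.range r, beta θ μ t • totalVec μ t (j + 1) := by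
  rw [totalVec_of_mem μ h, totalY, Finsupp.linearCombination_single, one_smul, if_neg hj.not_gt]

/-- The formula for `Y v_{r,j}`, `j < 0`, remains correct for `j = -b_r - 1`. -/
theorem totalY_totalVec_of_succ_mem {r : ℕ} {j : ℤ} (h : (r, j + 1) ∈ hookIndex μ) (hj : j < 0) :
    totalY θ μ (totalVec μ r j) = thetaSum θ (-leg μ r) j • totalVec μ r (j + 1) +
      ∑ t ∈ Finset.Ioo r (numHooks μ), beta θ μ t • totalVec μ t (j + 1) := by
  by_cases h' : (r, j) ∈ hookIndex μ
  · exact totalY_totalVec_of_neg θ μ h' hj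
  have h1 := eq_neg_leg h (by rwa [add_sub_cancel_right])
  have h2 : thetaSum θ (-leg μ r) j = 0 := by
    rw [thetaSum, Finset.Icc_eq_empty (by omega), Finset.sum_empty]
  rw [totalVec_of_notMem μ h', map_zero, h2, zero_smul, zero_add]
  refine (Finset.sum_eq_zero fun t ht => ?_).symm
  rw [totalVec_of_notMem, smul_zero]
  intro h3
  have := (Finset.mem_Ioo.1 ht).1
  exact h' (mem_hookIndex_of_le h3 (by omega) (by omega))

theorem thetaSum_eq_add {p q m : ℤ} (h1 : p ≤ m) (h2 : m ≤ q) :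
    thetaSum θ p q = thetaSum θ p (m - 1) + θ (m : ZMod ℓ) + thetaSum θ (m + 1) q := by
  unfold thetaSum
  have e : Finset.Icc p q = Finset.Icc p (m - 1) ∪ insert m (Finset.Icc (m + 1) q) := by
    ext; simp only [Finset.mem_Icc, Finset.mem_union, Finset.mem_insert]; omega
  rw [e, Finset.sum_union, Finset.sum_insert (by simp), add_assoc]
  rw [Finset.disjoint_left]
  intro x hx
  simp only [Finset.mem_Icc, Finset.mem_insert] at hx ⊢
  omega

/-- The deformed preprojective relation `[X, Y] = θ - x y`. -/
theorem commutator_totalVec {r : ℕ} {j : ℤ} (h : (r, j) ∈ hookIndex μ) :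
    totalX μ (totalY θ μ (totalVec μ r j)) - totalY θ μ (totalX μ (totalVec μ r j)) =
      θ (j : ZMod ℓ) • totalVec μ r j - totaly μ (totalVec μ r j) • totalx θ μ := by
  have hb := (mem_hookIndex_iff_bounds μ r j).1 h
  rw [totaly_totalVec μ h, totalX_totalVec μ fun _ => h]
  rcases lt_or_ge j 0 with hj | hj
  · have h1 : ∀ t, totalX μ (totalVec μ t (j + 1)) = totalVec μ t j := fun t => by
      rw [totalX_totalVec, add_sub_cancel_right]
      intro h'
      rw [add_sub_cancel_right] at h'
      exact mem_hookIndex_of_le h' (by omega) (by omega)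
    rw [totalY_totalVec_of_neg θ μ h hj, totalY_totalVec_of_succ_mem θ μ (by simpa using h)
      (by omega), map_add, map_smul, map_sum, h1, sub_add_cancel, if_neg hj.ne, zero_smul, sub_zero,
      thetaSum_eq_add θ hb.2.1 le_rfl, thetaSum, thetaSum,
      Finset.Icc_eq_empty (a := j + 1) (by omega),
      Finset.sum_empty, add_zero, add_smul]
    simp only [map_smul, h1]
    abel
  · have h1 : thetaSum θ (j + 1) (arm μ r) • totalX μ (totalVec μ r (j + 1)) =
        thetaSum θ (j + 1) (arm μ r) • totalVec μ r j := by
      by_cases h' : (r, j + 1) ∈ hookIndex μ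
      · rw [totalX_totalVec μ fun _ => h', add_sub_cancel_right]
      · rw [eq_arm h h', thetaSum, Finset.Icc_eq_empty (by omega), Finset.sum_empty, zero_smul,
          zero_smul]
    have h2 : ∀ t ∈ Finset.range r, totalX μ (beta θ μ t • totalVec μ t (j + 1)) =
        beta θ μ t • totalVec μ t j := fun t ht => by
      have := Finset.mem_range.1 ht
      rw [map_smul, totalX_totalVec μ fun _ => mem_hookIndex_of_le h (by omega) (by omega),
        add_sub_cancel_right]
    rw [totalY_totalVec_of_nonneg θ μ h hj, map_sub, map_neg, map_smul, map_sum, h1,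
      Finset.sum_congr rfl h2]
    rcases hj.lt_or_eq with hj' | rfl
    · rw [totalY_totalVec_of_nonneg θ μ (mem_hookIndex_of_le h (by omega) (by omega)) (by omega),
        sub_add_cancel, if_neg hj'.ne', zero_smul, sub_zero, thetaSum_eq_add θ le_rfl hb.2.2,
        thetaSum, thetaSum, Finset.Icc_eq_empty (b := j - 1) (by omega), Finset.sum_empty,
        zero_add, add_smul]
      abel
    · rw [totalY_totalVec_of_succ_mem θ μ (by simpa using h) (by omega), sub_add_cancel, if_pos rfl,
        one_smul, totalx]
      have hr := lt_numHooks_of_mem h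
      have e : Finset.range (numHooks μ) =
          Finset.range r ∪ insert r (Finset.Ioo r (numHooks μ)) := by
        ext
        simp only [Finset.mem_range, Finset.mem_union, Finset.mem_insert, Finset.mem_Ioo]
        omega
      rw [e, Finset.sum_union, Finset.sum_insert (by simp), beta, thetaSum_eq_add θ hb.2.1 hb.2.2,
        add_smul, add_smul]
      · abel
      · rw [Finset.disjoint_left]
        intro x hx
        simp only [Finset.mem_range, Finset.mem_insert, Finset.mem_Ioo] at hx ⊢
        omega

/-- An operator on the total space that shifts the content by `σ = ±1` is nilpotent. -/
theorem exists_pow_eq_zero_of_shift {σ : ℤ} (hσ : σ * σ = 1) (Z : Module.End ℂ (TotalSpace μ))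
    (hZ : ∀ r j, (r, j) ∈ hookIndex μ →
      Z (totalVec μ r j) ∈ Submodule.span ℂ (Set.range fun t => totalVec μ t (j + σ))) :
    ∃ n, Z ^ n = 0 := by
  -- the filtration by the content
  let L : ℤ → Submodule ℂ (TotalSpace μ) := fun c =>
    Submodule.span ℂ {x | ∃ r j, (r, j) ∈ hookIndex μ ∧ c ≤ σ * j ∧ x = totalVec μ r j}
  have hL : ∀ c, ∀ v ∈ L c, Z v ∈ L (c + 1) := by
    intro c v hv
    induction hv using Submodule.span_induction with
    | mem x hx =>
      obtain ⟨r, j, h, hc, rfl⟩ := hx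
      refine Submodule.span_le.2 ?_ (hZ r j h)
      rintro _ ⟨t, rfl⟩
      by_cases ht : (t, j + σ) ∈ hookIndex μ
      · exact Submodule.subset_span ⟨t, j + σ, ht, by rw [mul_add, hσ]; omega, rfl⟩
      · change totalVec μ t (j + σ) ∈ L (c + 1)
        rw [totalVec_of_notMem μ ht]
        exact Submodule.zero_mem _
    | zero => rw [map_zero]; exact Submodule.zero_mem _
    | add x y _ _ hx hy => rw [map_add]; exact Submodule.add_mem _ hx hy
    | smul a x _ hx => rw [map_smul]; exact Submodule.smul_mem _ _ hx
  obtain ⟨M, hM⟩ : ∃ M : ℕ, ∀ p ∈ hookIndex μ, |σ * p.2| ≤ M := by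
    refine ⟨((hookIndex μ).sup fun p => (σ * p.2).natAbs), fun p hp => ?_⟩
    have := Finset.le_sup (f := fun p : ℕ × ℤ => (σ * p.2).natAbs) hp
    rw [Int.abs_eq_natAbs]
    exact_mod_cast this
  have hpow : ∀ n : ℕ, ∀ v ∈ L (-M), (Z ^ n) v ∈ L (-M + n) := by
    intro n v hv
    induction n with
    | zero => simpa using hv
    | succ n ih =>
      rw [pow_succ', Module.End.mul_apply]
      have := hL _ _ ih
      rwa [add_assoc] at this
  refine ⟨2 * M + 1, totalSpace_hom_ext fun r j h => ?_⟩
  have h1 := hpow (2 * M + 1) (totalVec μ r j)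
    (Submodule.subset_span ⟨r, j, h, (abs_le.1 (hM _ h)).1, rfl⟩)
  have h2 : L (-M + ((2 * M + 1 : ℕ) : ℤ)) = ⊥ := by
    refine Submodule.span_eq_bot.2 ?_
    rintro _ ⟨r, j, h, hc, rfl⟩
    have := (abs_le.1 (hM _ h)).2
    push_cast at hc
    simp only at this
    omega
  rw [h2] at h1
  exact h1

theorem totalX_nilpotent : ∃ n, totalX μ ^ n = 0 := by
  refine exists_pow_eq_zero_of_shift μ (σ := -1) (by norm_num) _ fun r j h => ?_
  rw [totalX_totalVec μ fun _ => h]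
  exact Submodule.subset_span ⟨r, rfl⟩

theorem totalY_totalVec_mem_span {r : ℕ} {j : ℤ} (h : (r, j) ∈ hookIndex μ) :
    totalY θ μ (totalVec μ r j) ∈ Submodule.span ℂ (Set.range fun t => totalVec μ t (j + 1)) := by
  have hs : ∀ t, totalVec μ t (j + 1) ∈
      Submodule.span ℂ (Set.range fun t => totalVec μ t (j + 1)) :=
    fun t => Submodule.subset_span ⟨t, rfl⟩
  rcases lt_or_ge j 0 with hj | hj
  · rw [totalY_totalVec_of_neg θ μ h hj]
    exact Submodule.add_mem _ (Submodule.smul_mem _ _ (hs _))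
      (Submodule.sum_mem _ fun t _ => Submodule.smul_mem _ _ (hs _))
  · rw [totalY_totalVec_of_nonneg θ μ h hj]
    exact Submodule.sub_mem _ (Submodule.neg_mem _ (Submodule.smul_mem _ _ (hs _)))
      (Submodule.sum_mem _ fun t _ => Submodule.smul_mem _ _ (hs _))

theorem totalY_nilpotent : ∃ n, totalY θ μ ^ n = 0 :=
  exists_pow_eq_zero_of_shift μ (σ := 1) (by norm_num) _ fun _ _ h =>
    totalY_totalVec_mem_span θ μ h

end Total

/-! ### Killed vectors and removable boxes -/

section Simple

variable {ℓ : ℕ} {θ : ZMod ℓ → ℂ} {μ : YoungDiagram}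

/-- If `β_r = 0`, all parameters on the contents of the `r`-th hook vanish, so that they vanish on
the residue of some removable box. -/
theorem exists_removable_of_beta_eq_zero
    (hK : ∀ p q : ℤ, p ≤ q → thetaSum θ p q = 0 → ∀ i ∈ Finset.Icc p q, θ (i : ZMod ℓ) = 0)
    {r : ℕ} (hr : (r, r) ∈ μ) (h0 : beta θ μ r = 0) :
    ∃ b, IsRemovable μ b ∧ θ (residue ℓ b) = 0 := by
  obtain ⟨b, hb, j, hj, hres⟩ := exists_removable_of_hook hr
  have h1 := arm_nonneg μ r
  have h2 := leg_nonneg μ r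
  exact ⟨b, hb, by rw [hres]; exact hK _ _ (by omega) h0 j hj⟩

theorem totalSpace_apply {M : Type*} [AddCommMonoid M] [Module ℂ M] (f : TotalSpace μ →ₗ[ℂ] M)
    (w : TotalSpace μ) :
    f w = ∑ p : hookIndex μ, totalCoeff μ p.1.1 p.1.2 w • f (totalVec μ p.1.1 p.1.2) := by
  classical
  refine LinearMap.congr_fun (g := ∑ p : hookIndex μ, (totalCoeff μ p.1.1 p.1.2).smulRight
    (f (totalVec μ p.1.1 p.1.2))) (totalSpace_hom_ext fun r j h => ?_) w |>.trans (by simp)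
  rw [LinearMap.sum_apply, Finset.sum_eq_single ⟨(r, j), h⟩]
  · rw [LinearMap.smulRight_apply, totalCoeff_totalVec μ h, if_pos rfl, one_smul]
  · intro p _ hp
    rw [LinearMap.smulRight_apply, totalCoeff_totalVec_of_ne, zero_smul]
    exact fun h' => hp (Subtype.ext h'.symm)
  · exact fun h' => absurd (Finset.mem_univ _) h'

/-- If `X`, `Y` and `y` kill a nonzero vector supported on contents where the parameters vanish,
then `μ` has a removable box on which the parameter vanishes. -/
theorem exists_removable_of_killed
    (hK : ∀ p q : ℤ, p ≤ q → thetaSum θ p q = 0 → ∀ i ∈ Finset.Icc p q, θ (i : ZMod ℓ) = 0)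
    {w : TotalSpace μ} (hw : w ≠ 0) (hX : totalX μ w = 0) (hY : totalY θ μ w = 0)
    (hy : totaly μ w = 0) (hθ : ∀ r j, totalCoeff μ r j w ≠ 0 → θ (j : ZMod ℓ) = 0) :
    ∃ b, IsRemovable μ b ∧ θ (residue ℓ b) = 0 := by
  obtain ⟨⟨⟨r, j⟩, h⟩, hc⟩ : ∃ p : hookIndex μ, totalCoeff μ p.1.1 p.1.2 w ≠ 0 := by
    by_contra! hcon
    apply hw
    have := totalSpace_apply LinearMap.id w
    rw [LinearMap.id_apply] at this
    rw [this]
    exact Finset.sum_eq_zero fun p _ => by rw [hcon p, zero_smul]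
  simp only at hc
  -- the vector is supported at the beginning of columns
  have hstart : ∀ r j, totalCoeff μ r j w ≠ 0 → (r, j - 1) ∉ hookIndex μ := by
    intro r j hc h'
    apply hc
    have : totalCoeff μ r j = totalCoeff μ r (j - 1) ∘ₗ totalX μ := by
      refine totalSpace_hom_ext fun r' j' h => ?_
      rw [LinearMap.comp_apply, totalX_totalVec μ fun _ => h, totalCoeff_totalVec μ h]
      by_cases h1 : (r', j') = (r, j)
      · obtain ⟨rfl, rfl⟩ := Prod.mk.inj h1
        rw [if_pos rfl, totalCoeff_totalVec μ h', if_pos rfl]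
      · rw [if_neg h1, totalCoeff_totalVec_of_ne]
        intro h2
        obtain ⟨rfl, h3⟩ := Prod.mk.inj h2
        exact h1 (by rw [sub_left_inj.1 h3])
    rw [this, LinearMap.comp_apply, hX, map_zero]
  have hleg := eq_neg_leg h (hstart r j hc)
  have hj0 : j ≤ 0 := by have := leg_nonneg μ r; omega
  have huniq : ∀ t, totalCoeff μ t j w ≠ 0 → (t, j) ∈ hookIndex μ → t = r := by
    intro t ht hmem
    rcases lt_trichotomy t r with hlt | heq | hgt
    · exact absurd (mem_hookIndex_of_le h (by omega) (by omega)) (hstart t j ht)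
    · exact heq
    · exact absurd (mem_hookIndex_of_le hmem (by omega) (by omega)) (hstart r j hc)
  rcases hj0.lt_or_eq with hj | rfl
  · by_cases hrem : IsRemovable μ (boxOf r j)
    · exact ⟨_, hrem, by rw [residue_boxOf]; exact hθ r j hc⟩
    have hbox := (mem_hookIndex_iff μ r j).1 h
    have hbelow : (r, j - 1) ∉ hookIndex μ := hstart r j hc
    have hmem : (r + 1, j + 1) ∈ hookIndex μ := by
      by_contra hcon
      refine hrem ⟨hbox, fun h' => hbelow ?_, fun h' => hcon ?_⟩
      · rw [mem_hookIndex_iff]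
        exact μ.up_left_mem (by simp only [boxOf]; omega) (by simp only [boxOf]; omega) h'
      · rw [mem_hookIndex_iff]
        exact μ.up_left_mem (by simp only [boxOf]; omega) (by simp only [boxOf]; omega) h'
    refine exists_removable_of_beta_eq_zero hK (r := r + 1)
      ((mem_hookIndex_iff_bounds _ _ _).1 hmem).1 ?_
    -- compare the coefficients of `v_{r+1,j+1}` in `Y w = 0`
    have h1 := totalSpace_apply (totalCoeff μ (r + 1) (j + 1) ∘ₗ totalY θ μ) w
    rw [LinearMap.comp_apply, hY, map_zero, Finset.sum_eq_single ⟨(r, j), h⟩] at h1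
    · rw [LinearMap.comp_apply, totalY_totalVec_of_neg θ μ h hj, map_add, map_smul, map_sum,
        totalCoeff_totalVec_of_ne μ (by simp), smul_zero, zero_add,
        Finset.sum_eq_single (r + 1)] at h1
      · rw [map_smul, totalCoeff_totalVec μ hmem, if_pos rfl, smul_eq_mul, smul_eq_mul,
          mul_one] at h1
        exact (mul_eq_zero.1 h1.symm).resolve_left hc
      · intro t _ ht
        rw [map_smul, totalCoeff_totalVec_of_ne μ (by simpa using ht), smul_zero]
      · intro hnot
        exact absurd (Finset.mem_Ioo.2 ⟨by omega, lt_numHooks_of_mem hmem⟩) hnot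
    · rintro ⟨⟨t, m⟩, ht⟩ _ hne
      by_cases hm : m = j
      · subst hm
        have : totalCoeff μ t m w = 0 := by
          by_contra hcon
          obtain rfl := huniq t hcon ht
          exact hne rfl
        simp only [this, zero_smul]
      · have h2 := totalY_totalVec_mem_span θ μ ht
        have h3 : Submodule.span ℂ (Set.range fun s => totalVec μ s (m + 1)) ≤
            LinearMap.ker (totalCoeff μ (r + 1) (j + 1)) := by
          rw [Submodule.span_le]
          rintro _ ⟨s, rfl⟩
          exact totalCoeff_totalVec_of_ne μ fun h' => hm (by simpa using (Prod.mk.inj h').2)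
        rw [LinearMap.comp_apply, LinearMap.mem_ker.1 (h3 h2), smul_zero]
    · exact fun h' => absurd (Finset.mem_univ _) h'
  · exfalso
    have h1 := totalSpace_apply (totaly μ) w
    rw [hy, Finset.sum_eq_single ⟨(r, 0), h⟩] at h1
    · rw [totaly_totalVec μ h, if_pos rfl, smul_eq_mul, mul_one] at h1
      exact hc h1.symm
    · rintro ⟨⟨t, m⟩, ht⟩ _ hne
      rw [totaly_totalVec μ ht]
      split_ifs with hm
      · subst hm
        have : totalCoeff μ t 0 w = 0 := by
          by_contra hcon
          obtain rfl := huniq t hcon ht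
          exact hne rfl
        simp only [this, zero_smul]
      · rw [smul_zero]
    · exact fun h' => absurd (Finset.mem_univ _) h'

/-- If a nonzero linear form supported on contents where the parameters vanish kills the images of
`X`, `Y` and `x`, then `μ` has a removable box on which the parameter vanishes. -/
theorem exists_removable_of_killing
    (hK : ∀ p q : ℤ, p ≤ q → thetaSum θ p q = 0 → ∀ i ∈ Finset.Icc p q, θ (i : ZMod ℓ) = 0)
    {f : TotalSpace μ →ₗ[ℂ] ℂ} (hf : f ≠ 0) (hX : ∀ v, f (totalX μ v) = 0)
    (hY : ∀ v, f (totalY θ μ v) = 0) (hx : f (totalx θ μ) = 0)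
    (hθ : ∀ r j, f (totalVec μ r j) ≠ 0 → θ (j : ZMod ℓ) = 0) :
    ∃ b, IsRemovable μ b ∧ θ (residue ℓ b) = 0 := by
  obtain ⟨r, j, h, hc⟩ : ∃ r j, (r, j) ∈ hookIndex μ ∧ f (totalVec μ r j) ≠ 0 := by
    by_contra! hcon
    exact hf (totalSpace_hom_ext fun r j h => hcon r j h)
  -- the form is supported at the ends of rows
  have hend : ∀ r j, f (totalVec μ r j) ≠ 0 → (r, j + 1) ∉ hookIndex μ := by
    intro r j hc h'
    apply hc
    have := hX (totalVec μ r (j + 1))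
    rwa [totalX_totalVec μ fun _ => h', add_sub_cancel_right] at this
  have harm := eq_arm h (hend r j hc)
  have hj0 : 0 ≤ j := by have := arm_nonneg μ r; omega
  have huniq : ∀ t, f (totalVec μ t j) ≠ 0 → t = r := by
    intro t ht
    have hmem : (t, j) ∈ hookIndex μ := by
      by_contra hcon
      exact ht (by rw [totalVec_of_notMem μ hcon, map_zero])
    rcases lt_trichotomy t r with hlt | heq | hgt
    · exact absurd (mem_hookIndex_of_le h (by omega) (by omega)) (hend t j ht)
    · exact heq
    · exact absurd (mem_hookIndex_of_le hmem (by omega) (by omega)) (hend r j hc)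
  by_cases hrem : IsRemovable μ (boxOf r j)
  · exact ⟨_, hrem, by rw [residue_boxOf]; exact hθ r j hc⟩
  have hbox := (mem_hookIndex_iff μ r j).1 h
  have hright : (r, j + 1) ∉ hookIndex μ := hend r j hc
  refine exists_removable_of_beta_eq_zero hK ((mem_hookIndex_iff_bounds _ _ _).1 h).1 ?_
  -- if `f` kills a combination of `β_r v_{r,j}` and other vectors of content `j`, then `β_r = 0`
  have hsum : ∀ s : Finset ℕ, r ∈ s → f (∑ t ∈ s, beta θ μ t • totalVec μ t j) = 0 →
      beta θ μ r = 0 := by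
    intro s hs h0
    rw [map_sum, Finset.sum_eq_single r] at h0
    · rw [map_smul, smul_eq_mul] at h0
      exact (mul_eq_zero.1 h0).resolve_right hc
    · intro t _ ht
      rw [map_smul, smul_eq_mul]
      by_contra hcon
      exact ht (huniq t (right_ne_zero_of_mul hcon))
    · exact fun h' => absurd hs h'
  rcases hj0.lt_or_eq with hj | rfl
  · have hmem : (r + 1, j - 1) ∈ hookIndex μ := by
      by_contra hcon
      refine hrem ⟨hbox, fun h' => hcon ?_, fun h' => hright ?_⟩
      · rw [mem_hookIndex_iff]
        exact μ.up_left_mem (by simp only [boxOf]; omega) (by simp only [boxOf]; omega) h'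
      · rw [mem_hookIndex_iff]
        exact μ.up_left_mem (by simp only [boxOf]; omega) (by simp only [boxOf]; omega) h'
    refine hsum (Finset.range (r + 1)) (by simp) ?_
    have h1 := hY (totalVec μ (r + 1) (j - 1))
    have h2 : f (totalVec μ (r + 1) j) = 0 := by
      by_contra hcon
      exact absurd (huniq _ hcon) (by omega)
    rwa [totalY_totalVec_of_nonneg θ μ hmem (by omega), sub_add_cancel, map_sub, map_neg, map_smul,
      h2, smul_zero, neg_zero, zero_sub, neg_eq_zero] at h1
  · exact hsum _ (Finset.mem_range.2 (lt_numHooks_of_mem h)) hx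

end Simple

/-! ### The vertices inside the total space -/

section Embedding

variable {ℓ : ℕ} (θ : ZMod ℓ → ℂ) (μ : YoungDiagram)

/-- The inclusion of the space at a vertex into the total space. -/
noncomputable def nodeEmb (i : ZMod ℓ) : NodeSpace μ i →ₗ[ℂ] TotalSpace μ :=
  Finsupp.linearCombination ℂ fun p => totalVec μ p.1.1.1 p.1.1.2

/-- The projection of the total space to the space at a vertex. -/
noncomputable def nodeProj (i : ZMod ℓ) : TotalSpace μ →ₗ[ℂ] NodeSpace μ i :=
  Finsupp.linearCombination ℂ fun p => basisVec μ i p.1.1 p.1.2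

theorem nodeEmb_basisVec {i : ZMod ℓ} {r : ℕ} {j : ℤ} (hi : (j : ZMod ℓ) = i) :
    nodeEmb μ i (basisVec μ i r j) = totalVec μ r j := by
  by_cases h : (r, j) ∈ hookIndex μ
  · rw [basisVec_of_mem μ h hi, nodeEmb, Finsupp.linearCombination_single, one_smul]
  · rw [basisVec_of_notMem μ h, totalVec_of_notMem μ h, map_zero]

theorem nodeProj_totalVec (i : ZMod ℓ) (r : ℕ) (j : ℤ) :
    nodeProj μ i (totalVec μ r j) = basisVec μ i r j := by
  by_cases h : (r, j) ∈ hookIndex μ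
  · rw [totalVec_of_mem μ h, nodeProj, Finsupp.linearCombination_single, one_smul]
  · rw [basisVec_of_notMem μ h, totalVec_of_notMem μ h, map_zero]

theorem nodeProj_nodeEmb {i : ZMod ℓ} (v : NodeSpace μ i) : nodeProj μ i (nodeEmb μ i v) = v := by
  refine LinearMap.congr_fun (f := nodeProj μ i ∘ₗ nodeEmb μ i) (g := LinearMap.id)
    (nodeSpace_hom_ext fun r j _ hi => ?_) v
  rw [LinearMap.comp_apply, nodeEmb_basisVec μ hi, nodeProj_totalVec, LinearMap.id_apply]

theorem nodeProj_nodeEmb_of_ne {i i' : ZMod ℓ} (hne : i' ≠ i) (v : NodeSpace μ i') :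
    nodeProj μ i (nodeEmb μ i' v) = 0 := by
  refine LinearMap.congr_fun (f := nodeProj μ i ∘ₗ nodeEmb μ i') (g := 0)
    (nodeSpace_hom_ext fun r j _ hi => ?_) v
  rw [LinearMap.comp_apply, nodeEmb_basisVec μ hi, nodeProj_totalVec, LinearMap.zero_apply]
  exact dif_neg fun h => hne (hi.symm.trans h.2)

theorem nodeEmb_injective (i : ZMod ℓ) : Function.Injective (nodeEmb μ i) :=
  Function.LeftInverse.injective (nodeProj_nodeEmb μ)

theorem totalX_nodeEmb (i : ZMod ℓ) (v : NodeSpace μ (i + 1)) :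
    totalX μ (nodeEmb μ (i + 1) v) = nodeEmb μ i (mapX μ i v) := by
  refine LinearMap.congr_fun (f := totalX μ ∘ₗ nodeEmb μ (i + 1)) (g := nodeEmb μ i ∘ₗ mapX μ i)
    (nodeSpace_hom_ext fun r j h hi => ?_) v
  rw [LinearMap.comp_apply, LinearMap.comp_apply, nodeEmb_basisVec μ hi,
    totalX_totalVec μ fun _ => h, mapX_basisVec μ h hi, nodeEmb_basisVec]
  push_cast
  rw [hi, add_sub_cancel_right]

theorem totalY_nodeEmb (i : ZMod ℓ) (v : NodeSpace μ i) :
    totalY θ μ (nodeEmb μ i v) = nodeEmb μ (i + 1) (mapY θ μ i v) := by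
  refine LinearMap.congr_fun (f := totalY θ μ ∘ₗ nodeEmb μ i)
    (g := nodeEmb μ (i + 1) ∘ₗ mapY θ μ i) (nodeSpace_hom_ext fun r j h hi => ?_) v
  have h1 : ∀ t, nodeEmb μ (i + 1) (basisVec μ (i + 1) t (j + 1)) = totalVec μ t (j + 1) := fun t =>
    nodeEmb_basisVec μ (by push_cast; rw [hi])
  rw [LinearMap.comp_apply, LinearMap.comp_apply, nodeEmb_basisVec μ hi]
  rcases lt_or_ge j 0 with hj | hj
  · rw [totalY_totalVec_of_neg θ μ h hj, mapY_basisVec_of_neg θ μ le_rfl h hi hj]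
    simp only [map_add, map_sum, map_smul, h1]
  · rw [totalY_totalVec_of_nonneg θ μ h hj, mapY_basisVec_of_nonneg θ μ h hi hj]
    simp only [map_sub, map_neg, map_sum, map_smul, h1]

theorem totaly_nodeEmb_zero (v : NodeSpace (ℓ := ℓ) μ 0) : totaly μ (nodeEmb μ 0 v) = mapy μ v := by
  refine LinearMap.congr_fun (f := totaly μ ∘ₗ nodeEmb μ 0) (g := mapy μ)
    (nodeSpace_hom_ext fun r j h hi => ?_) v
  rw [LinearMap.comp_apply, nodeEmb_basisVec μ hi, totaly_totalVec μ h, mapy_basisVec μ h hi]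

theorem totaly_nodeEmb_of_ne {i : ZMod ℓ} (hi0 : i ≠ 0) (v : NodeSpace μ i) :
    totaly μ (nodeEmb μ i v) = 0 := by
  refine LinearMap.congr_fun (f := totaly μ ∘ₗ nodeEmb μ i) (g := 0)
    (nodeSpace_hom_ext fun r j h hi => ?_) v
  rw [LinearMap.comp_apply, nodeEmb_basisVec μ hi, totaly_totalVec μ h, if_neg,
    LinearMap.zero_apply]
  rintro rfl
  exact hi0 (by rw [← hi, Int.cast_zero])

theorem nodeEmb_mapx (c : ℂ) : nodeEmb μ 0 (mapx θ μ c) = c • totalx θ μ := by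
  rw [mapx_apply θ μ le_rfl, map_smul, map_sum, totalx]
  congr 1
  exact Finset.sum_congr rfl fun t _ => by rw [map_smul, nodeEmb_basisVec μ Int.cast_zero]

theorem commutator_nodeEmb (i : ZMod ℓ) (v : NodeSpace μ i) :
    totalX μ (totalY θ μ (nodeEmb μ i v)) - totalY θ μ (totalX μ (nodeEmb μ i v)) =
      θ i • nodeEmb μ i v - totaly μ (nodeEmb μ i v) • totalx θ μ := by
  refine LinearMap.congr_fun
    (f := (totalX μ * totalY θ μ - totalY θ μ * totalX μ) ∘ₗ nodeEmb μ i)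
    (g := θ i • nodeEmb μ i - (totaly μ).smulRight (totalx θ μ) ∘ₗ nodeEmb μ i)
    (nodeSpace_hom_ext fun r j h hi => ?_) v
  have := commutator_totalVec θ μ h
  rw [hi, ← nodeEmb_basisVec μ hi] at this
  exact this

theorem totalCoeff_nodeEmb_of_ne {i : ZMod ℓ} {r : ℕ} {j : ℤ} (hj : (j : ZMod ℓ) ≠ i)
    (v : NodeSpace μ i) : totalCoeff μ r j (nodeEmb μ i v) = 0 := by
  refine LinearMap.congr_fun (f := totalCoeff μ r j ∘ₗ nodeEmb μ i) (g := 0)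
    (nodeSpace_hom_ext fun r' j' h hi => ?_) v
  rw [LinearMap.comp_apply, nodeEmb_basisVec μ hi, totalCoeff_totalVec_of_ne, LinearMap.zero_apply]
  intro heq
  rw [(Prod.mk.inj heq).2] at hi
  exact hj hi

end Embedding

/-! ### Simplicity of `A_μ` for `J`-cores -/

section Simple

variable {ℓ : ℕ} {θ : ZMod ℓ → ℂ} {μ : YoungDiagram}

/-- A subrepresentation of `A_μ` that vanishes at `∞` is zero, unless `θ` vanishes on the residue of
a removable box. -/
theorem carrier_eq_bot_of_inf
    (hK : ∀ p q : ℤ, p ≤ q → thetaSum θ p q = 0 → ∀ i ∈ Finset.Icc p q, θ (i : ZMod ℓ) = 0)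
    (hμ : ∀ b, IsRemovable μ b → θ (residue ℓ b) ≠ 0)
    {B : QuiverRep.Subrep (repA θ μ)} (hB : ∀ c : ℂ, c ∈ B.carrier .inf → c = 0) (i : ZMod ℓ) :
    B.carrier (.node i) = ⊥ := by
  let C : ∀ i, Submodule ℂ (NodeSpace μ i) := fun i => B.carrier (.node i)
  have hCX : ∀ i, ∀ v ∈ C (i + 1), mapX μ i v ∈ C i := fun i v hv => B.map_mem (Arrow.X i) v hv
  have hCY : ∀ i, ∀ v ∈ C i, mapY θ μ i v ∈ C (i + 1) := fun i v hv => B.map_mem (Arrow.Y i) v hv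
  have hCy : ∀ v ∈ C 0, mapy μ v = 0 := fun v hv => hB _ (B.map_mem Arrow.y v hv)
  have hy : ∀ i, ∀ v ∈ C i, totaly μ (nodeEmb μ i v) = 0 := fun i v hv => by
    by_cases hi : i = 0
    · subst hi
      rw [totaly_nodeEmb_zero, hCy v hv]
    · exact totaly_nodeEmb_of_ne μ hi v
  change C i = ⊥
  refine (Submodule.eq_bot_iff _).2 fun v hv => ?_
  by_contra hne
  obtain ⟨n, hn⟩ := totalX_nilpotent μ
  obtain ⟨m, hm⟩ := totalY_nilpotent θ μ
  obtain ⟨k, w, ⟨u, hu, rfl⟩, hw0, hwX, hwY⟩ := exists_killed_of_commutator (totalX μ) (totalY θ μ)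
    (fun i => (C i).map (nodeEmb μ i))
    (by rintro i _ ⟨u, hu, rfl⟩; exact ⟨_, hCX i u hu, (totalX_nodeEmb μ i u).symm⟩)
    (by rintro i _ ⟨u, hu, rfl⟩; exact ⟨_, hCY i u hu, (totalY_nodeEmb θ μ i u).symm⟩)
    (by
      rintro i _ ⟨u, hu, rfl⟩
      rw [commutator_nodeEmb, hy i u hu, zero_smul, sub_zero])
    hn hm hK (v₀ := nodeEmb μ i v) ⟨v, hv, rfl⟩
    (fun h => hne (nodeEmb_injective μ i (h.trans (map_zero _).symm)))
  have hk : θ k = 0 := by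
    have := commutator_nodeEmb θ μ k u
    rw [hwX, hwY, map_zero, map_zero, hy k u hu, zero_smul, sub_zero, sub_zero] at this
    exact (smul_eq_zero.1 this.symm).resolve_right hw0
  obtain ⟨b, hb, hb0⟩ := exists_removable_of_killed hK hw0 hwX hwY (hy k u hu) fun r j hc => by
    by_cases hj : (j : ZMod ℓ) = k
    · rw [hj, hk]
    · exact absurd (totalCoeff_nodeEmb_of_ne μ hj u) hc
  exact hμ b hb hb0

theorem dualMap_pow_eq_zero {V : Type*} [AddCommGroup V] [Module ℂ V] {Z : Module.End ℂ V}
    {n : ℕ} (hZ : Z ^ n = 0) : (LinearMap.dualMap Z : Module.End ℂ (Module.Dual ℂ V)) ^ n = 0 := by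
  have : ∀ (m : ℕ) (f : Module.Dual ℂ V) (v : V),
      (((LinearMap.dualMap Z : Module.End ℂ (Module.Dual ℂ V)) ^ m) f) v = f ((Z ^ m) v) := by
    intro m
    induction m with
    | zero => intro f v; rfl
    | succ m ih =>
      intro f v
      rw [pow_succ, Module.End.mul_apply, ih, LinearMap.dualMap_apply, pow_succ',
        Module.End.mul_apply]
  refine LinearMap.ext fun f => LinearMap.ext fun v => ?_
  rw [this, hZ, LinearMap.zero_apply, map_zero]
  rfl

/-- A subrepresentation of `A_μ` that contains the space at `∞` is `A_μ`, unless `θ` vanishes on the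
residue of a removable box. This is the dual of `carrier_eq_bot_of_inf`: the transposes of `Y` and
`X`, in this order, satisfy the same relation on the linear forms that kill the
subrepresentation. -/
theorem carrier_eq_top_of_inf
    (hK : ∀ p q : ℤ, p ≤ q → thetaSum θ p q = 0 → ∀ i ∈ Finset.Icc p q, θ (i : ZMod ℓ) = 0)
    (hμ : ∀ b, IsRemovable μ b → θ (residue ℓ b) ≠ 0)
    {B : QuiverRep.Subrep (repA θ μ)} (hB : (1 : ℂ) ∈ B.carrier .inf) (i : ZMod ℓ) :
    B.carrier (.node i) = ⊤ := by
  let C : ∀ i, Submodule ℂ (NodeSpace μ i) := fun i => B.carrier (.node i)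
  have hCX : ∀ i, ∀ v ∈ C (i + 1), mapX μ i v ∈ C i := fun i v hv => B.map_mem (Arrow.X i) v hv
  have hCY : ∀ i, ∀ v ∈ C i, mapY θ μ i v ∈ C (i + 1) := fun i v hv => B.map_mem (Arrow.Y i) v hv
  have hCx : mapx θ μ 1 ∈ C 0 := B.map_mem Arrow.x (1 : ℂ) hB
  change C i = ⊤
  by_contra hne
  obtain ⟨g, hg0, hg⟩ := Submodule.exists_le_ker_of_lt_top (C i) (lt_top_iff_ne_top.2 hne)
  -- the forms of degree `i` that vanish on the subrepresentation
  let W : ZMod ℓ → Submodule ℂ (Module.Dual ℂ (TotalSpace μ)) := fun i =>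
    { carrier := {f | (∀ i' ≠ i, ∀ v, f (nodeEmb μ i' v) = 0) ∧ ∀ v ∈ C i, f (nodeEmb μ i v) = 0}
      add_mem' := fun {f f'} hf hf' =>
        ⟨fun i' hi v => by rw [LinearMap.add_apply, hf.1 i' hi, hf'.1 i' hi, add_zero],
          fun v hv => by rw [LinearMap.add_apply, hf.2 v hv, hf'.2 v hv, add_zero]⟩
      zero_mem' := ⟨fun _ _ _ => rfl, fun _ _ => rfl⟩
      smul_mem' := fun c f hf =>
        ⟨fun i' hi v => by rw [LinearMap.smul_apply, hf.1 i' hi, smul_zero],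
          fun v hv => by rw [LinearMap.smul_apply, hf.2 v hv, smul_zero]⟩ }
  have hWx : ∀ i, ∀ f ∈ W i, f (totalx θ μ) = 0 := fun i f hf => by
    have h1 := nodeEmb_mapx θ μ 1
    rw [one_smul] at h1
    rw [← h1]
    by_cases hi : (0 : ZMod ℓ) = i
    · subst hi
      exact hf.2 _ hCx
    · exact hf.1 _ hi _
  have hWθ : ∀ i, ∀ f ∈ W i, ∀ r j, f (totalVec μ r j) ≠ 0 → (j : ZMod ℓ) = i :=
    fun i f hf r j hne => by
      by_contra hji
      rw [← nodeEmb_basisVec μ rfl] at hne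
      exact hne (hf.1 _ hji _)
  have hcomm : ∀ i, ∀ f ∈ W i, ∀ v, f (totalX μ (totalY θ μ v)) - f (totalY θ μ (totalX μ v)) =
      θ i • f v := fun i f hf v => by
    refine LinearMap.congr_fun (f := f ∘ₗ (totalX μ * totalY θ μ) - f ∘ₗ (totalY θ μ * totalX μ))
      (g := θ i • f) (totalSpace_hom_ext fun r j h => ?_) v
    have := congrArg f (commutator_totalVec θ μ h)
    rw [map_sub, map_sub, map_smul, map_smul, hWx i f hf, smul_zero, sub_zero] at this
    refine this.trans ?_
    by_cases h0 : f (totalVec μ r j) = 0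
    · rw [LinearMap.smul_apply, h0, smul_zero, smul_zero]
    · rw [hWθ i f hf r j h0, LinearMap.smul_apply]
  obtain ⟨n, hn⟩ := totalX_nilpotent μ
  obtain ⟨m, hm⟩ := totalY_nilpotent θ μ
  have hv₀ : g ∘ₗ nodeProj μ i ∈ W i :=
    ⟨fun i' hi' v => by rw [LinearMap.comp_apply, nodeProj_nodeEmb_of_ne μ hi', map_zero],
      fun v hv => by rw [LinearMap.comp_apply, nodeProj_nodeEmb]; exact hg hv⟩
  obtain ⟨k, f, hf, hf0, hfY, hfX⟩ := exists_killed_of_commutator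
    (LinearMap.dualMap (totalY θ μ)) (LinearMap.dualMap (totalX μ)) W
    (fun i f hf => ⟨fun i' hi' v => by
        rw [LinearMap.dualMap_apply, totalY_nodeEmb]
        exact hf.1 _ (fun h => hi' (add_right_cancel h)) _,
      fun v hv => by
        rw [LinearMap.dualMap_apply, totalY_nodeEmb]
        exact hf.2 _ (hCY i v hv)⟩)
    (fun i f hf => ⟨fun i' hi' v => by
        obtain ⟨k, rfl⟩ : ∃ k, i' = k + 1 := ⟨i' - 1, by ring⟩
        rw [LinearMap.dualMap_apply, totalX_nodeEmb]
        exact hf.1 _ (fun h => hi' (by rw [h])) _,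
      fun v hv => by
        rw [LinearMap.dualMap_apply, totalX_nodeEmb]
        exact hf.2 _ (hCX i v hv)⟩)
    (fun i f hf => LinearMap.ext fun v => hcomm i f hf v)
    (dualMap_pow_eq_zero hm) (dualMap_pow_eq_zero hn) hK hv₀
    (fun h => hg0 (LinearMap.ext fun v => by
      have := LinearMap.congr_fun h (nodeEmb μ i v)
      rwa [LinearMap.comp_apply, nodeProj_nodeEmb] at this))
  have hfX' : ∀ v, f (totalX μ v) = 0 := fun v => LinearMap.congr_fun hfX v
  have hfY' : ∀ v, f (totalY θ μ v) = 0 := fun v => LinearMap.congr_fun hfY v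
  have hk : θ k = 0 := by
    by_contra hk
    refine hf0 (LinearMap.ext fun v => ?_)
    have := hcomm k f hf v
    rw [hfX', hfY', sub_zero] at this
    exact (smul_eq_zero.1 this.symm).resolve_left hk
  obtain ⟨b, hb, hb0⟩ := exists_removable_of_killing hK hf0 hfX' hfY' (hWx k f hf) fun r j hc => by
    rw [hWθ k f hf r j hc, hk]
  exact hμ b hb hb0

theorem repA_isSimple
    (hK : ∀ p q : ℤ, p ≤ q → thetaSum θ p q = 0 → ∀ i ∈ Finset.Icc p q, θ (i : ZMod ℓ) = 0)
    (hμ : ∀ b, IsRemovable μ b → θ (residue ℓ b) ≠ 0) : (repA θ μ).IsSimple := by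
  have hnt : (⊥ : QuiverRep.Subrep (repA θ μ)) ≠ ⊤ := fun h => by
    have h1 : ∀ c, c ∈ (⊤ : QuiverRep.Subrep (repA θ μ)).carrier .inf := fun _ =>
      Submodule.mem_top
    rw [← h] at h1
    exact one_ne_zero (α := ℂ) (h1 (1 : ℂ))
  have : Nontrivial (QuiverRep.Subrep (repA θ μ)) := ⟨_, _, hnt⟩
  refine (⟨fun B => ?_⟩ : IsSimpleOrder (QuiverRep.Subrep (repA θ μ)))
  by_cases hB : ∀ c : ℂ, c ∈ B.carrier .inf → c = 0
  · left
    refine QuiverRep.Subrep.ext (funext fun a => ?_)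
    cases a with
    | node i => exact carrier_eq_bot_of_inf hK hμ hB i
    | inf => exact (Submodule.eq_bot_iff _).2 hB
  · right
    push Not at hB
    obtain ⟨(c : ℂ), hc, (hc0 : c ≠ 0)⟩ := hB
    have h1 : (1 : ℂ) ∈ B.carrier .inf := by
      have h2 : ((c : ℂ)⁻¹ * (c : ℂ) : ℂ) ∈ B.carrier .inf :=
        Submodule.smul_mem (B.carrier .inf) (c : ℂ)⁻¹ hc
      rwa [inv_mul_cancel₀ hc0] at h2
    refine QuiverRep.Subrep.ext (funext fun a => ?_)
    cases a with
    | node i => exact carrier_eq_top_of_inf hK hμ h1 i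
    | inf =>
      refine (Submodule.eq_top_iff').2 fun (d : ℂ) => ?_
      have h2 : ((d : ℂ) * (1 : ℂ) : ℂ) ∈ B.carrier .inf :=
        Submodule.smul_mem (B.carrier .inf) (d : ℂ) h1
      rwa [mul_one] at h2

theorem repA_isSimple_of_isJCore [NeZero ℓ] {J : Set (ZMod ℓ)} (hsum : ∑ i, θ i ≠ 0)
    (hθ : IsJStandard θ J) (hμ : IsJCore J μ) : (repA θ μ).IsSimple :=
  repA_isSimple (fun _ _ hpq h0 _ hi => theta_eq_zero_of_thetaSum_eq_zero hsum hθ hpq h0 hi)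
    fun b hb h0 => hμ b hb ((hθ.2 _).2 h0)

end Simple

/-! ### Semisimplifications -/

section Semisimplification

variable {ℓ : ℕ}

theorem simpleAt_isSimple (i : ZMod ℓ) : (simpleAt i).IsSimple := by
  have hone : ∃ v : (simpleAt i).V (.node i), v ≠ 0 :=
    ⟨fun _ => (1 : ℂ), fun h => one_ne_zero (congrFun h ⟨(), rfl⟩)⟩
  have hnt : (⊥ : QuiverRep.Subrep (simpleAt i)) ≠ ⊤ := fun h => by
    obtain ⟨v, hv⟩ := hone
    have h1 : v ∈ (⊤ : QuiverRep.Subrep (simpleAt i)).carrier (.node i) := Submodule.mem_top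
    rw [← h] at h1
    exact hv h1
  have : Nontrivial (QuiverRep.Subrep (simpleAt i)) := ⟨_, _, hnt⟩
  refine (⟨fun B => ?_⟩ : IsSimpleOrder (QuiverRep.Subrep (simpleAt i)))
  by_cases hB : ∀ a, ∀ v ∈ B.carrier a, v = 0
  · exact Or.inl (QuiverRep.Subrep.ext (funext fun a => (Submodule.eq_bot_iff _).2 (hB a)))
  · right
    push Not at hB
    obtain ⟨a, v, hv, hv0⟩ := hB
    obtain ⟨⟨u, rfl⟩, hu⟩ := Function.ne_iff.1 hv0
    refine QuiverRep.Subrep.ext (funext fun a' => (Submodule.eq_top_iff').2 fun w => ?_)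
    by_cases ha : a' = .node i
    · subst ha
      have : w = ((w ⟨u, rfl⟩ : ℂ) / (v ⟨u, rfl⟩ : ℂ)) • v := funext fun u' => by
        rw [Subsingleton.elim u' ⟨u, rfl⟩]
        exact (div_mul_cancel₀ (w ⟨u, rfl⟩ : ℂ) hu).symm
      rw [this]
      exact Submodule.smul_mem _ _ hv
    · have : w = 0 := funext fun u' => absurd u'.2 ha
      rw [this]
      exact Submodule.zero_mem _

/-- The composition factors of `A_μ`, if `λ` is obtained from `μ` by removing boxes on which the
parameter vanishes and `A_λ` is simple. -/
theorem hasFactors_repA {J : Set (ZMod ℓ)} {θ : ZMod ℓ → ℂ} (hJ : ∀ i ∈ J, θ i = 0)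
    {μ lam : YoungDiagram} (h : Relation.ReflTransGen (JStep J) μ lam)
    (hs : (repA θ lam).IsSimple) :
    QuiverRep.HasFactors (repA θ μ) ⊤
      (repA θ lam ::ₘ (μ.cells \ lam.cells).val.map fun b => simpleAt (residue ℓ b)) := by
  induction h using Relation.ReflTransGen.head_induction_on with
  | refl =>
    rw [sdiff_self, Finset.bot_eq_empty, Finset.empty_val, Multiset.map_zero]
    exact QuiverRep.hasFactors_of_isSimple hs
  | @head μ κ hstep hrest ih =>
    obtain ⟨b, hb, hbJ, rfl⟩ := hstep
    have hbl : b ∉ lam.cells := fun h => Finset.notMem_erase b μ.cells (le_of_reach hrest h)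
    have hcells : μ.cells \ lam.cells = insert b ((eraseBox μ b hb).cells \ lam.cells) := by
      have : (eraseBox μ b hb).cells = μ.cells.erase b := rfl
      rw [this, Finset.erase_sdiff_comm, Finset.insert_erase (Finset.mem_sdiff.2 ⟨hb.1, hbl⟩)]
    have hnot : b ∉ (eraseBox μ b hb).cells \ lam.cells := fun h =>
      Finset.notMem_erase b μ.cells (Finset.mem_sdiff.1 h).1
    rw [hcells, Finset.insert_val_of_notMem hnot, Multiset.map_cons, Multiset.cons_swap]
    have hL := QuiverRep.hasFactors_of_isSimple (simpleAt_isSimple (residue ℓ b))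
    rcases hasShortExact_eraseBox θ μ b hb (hJ _ hbJ) with hse | hse
    · have := QuiverRep.HasFactors.of_hasShortExact hse hL ih
      rwa [add_comm, Multiset.singleton_add] at this
    · have := QuiverRep.HasFactors.of_hasShortExact hse ih hL
      rwa [Multiset.singleton_add] at this

theorem semisimplification_of_hasFactors {Q : Type} [Quiver.{0} Q] [Finite Q] {M A : QuiverRep Q}
    {β : Type} (s : Finset β) (f : β → QuiverRep Q)
    (h : QuiverRep.HasFactors M ⊤ (A ::ₘ s.val.map f)) :
    QuiverRep.Isomorphic M.semisimplification
      (A.prod (QuiverRep.directSum fun b : {b : β // b ∈ s} => f b.1)) := by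
  let S : Option {b : β // b ∈ s} → QuiverRep Q := fun o => o.elim A fun b => f b.1
  have hS : Finset.univ.val.map S = A ::ₘ s.val.map f := by
    have h1 : (Finset.univ : Finset (Option {b : β // b ∈ s})).val =
        none ::ₘ (Finset.univ : Finset {b : β // b ∈ s}).val.map some := rfl
    rw [h1, Multiset.map_cons, Multiset.map_map, Finset.univ_eq_attach, Finset.attach_val]
    congr 1
    exact Multiset.attach_map_val' s.val f
  exact (h.semisimplification_isomorphic hS).trans (QuiverRep.directSum_option S)

end Semisimplification

/-! ### Recovering the partition from the representation -/

section Content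

/-- The hooks that have a box of content `j` form an initial segment, whose length is the number of
boxes of content `j`. -/
theorem exists_contentCount (μ : YoungDiagram) (j : ℤ) :
    ∃ n : ℕ, ∀ r, (r, j) ∈ hookIndex μ ↔ r < n := by
  classical
  have hex : ∃ n, boxOf n j ∉ μ := by
    obtain ⟨s, hs⟩ := μ.exists_notMem_row 0
    exact ⟨s, fun h => hs (μ.up_left_mem (Nat.zero_le _) (Nat.le_add_right s _) h)⟩
  refine ⟨Nat.find hex, fun r => ?_⟩
  rw [mem_hookIndex_iff, Nat.lt_find_iff]
  exact ⟨fun h m hm => not_not.2 (μ.up_left_mem (by omega) (by omega) h),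
    fun h => not_not.1 (h r le_rfl)⟩

variable {ℓ : ℕ} (θ : ZMod ℓ → ℂ) (μ : YoungDiagram)

/-- The operator that multiplies `v_{r,j}` by the content `j`. -/
noncomputable def contentOp (i : ZMod ℓ) : Module.End ℂ (NodeSpace μ i) :=
  Finsupp.linearCombination ℂ fun p => (p.1.1.2 : ℂ) • basisVec μ i p.1.1.1 p.1.1.2

theorem contentOp_basisVec (i : ZMod ℓ) (r : ℕ) (j : ℤ) :
    contentOp μ i (basisVec μ i r j) = (j : ℂ) • basisVec μ i r j := by
  by_cases h : (r, j) ∈ hookIndex μ ∧ (j : ZMod ℓ) = i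
  · conv_lhs => rw [basisVec_of_mem μ h.1 h.2]
    rw [contentOp, Finsupp.linearCombination_single, one_smul]
  · have h1 : basisVec μ i r j = 0 := dif_neg h
    rw [h1, map_zero, smul_zero]

theorem contentOp_mapX (i : ZMod ℓ) (v : NodeSpace μ (i + 1)) :
    contentOp μ i (mapX μ i v) = mapX μ i (contentOp μ (i + 1) v) - mapX μ i v := by
  refine LinearMap.congr_fun (f := contentOp μ i ∘ₗ mapX μ i)
    (g := mapX μ i ∘ₗ contentOp μ (i + 1) - mapX μ i) (nodeSpace_hom_ext fun r j h hi => ?_) v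
  rw [LinearMap.comp_apply, LinearMap.sub_apply, LinearMap.comp_apply, contentOp_basisVec, map_smul,
    mapX_basisVec μ h hi, contentOp_basisVec]
  push_cast
  rw [sub_smul, one_smul]

theorem contentOp_mapY (i : ZMod ℓ) (v : NodeSpace μ i) :
    contentOp μ (i + 1) (mapY θ μ i v) = mapY θ μ i (contentOp μ i v) + mapY θ μ i v := by
  refine LinearMap.congr_fun (f := contentOp μ (i + 1) ∘ₗ mapY θ μ i)
    (g := mapY θ μ i ∘ₗ contentOp μ i + mapY θ μ i) (nodeSpace_hom_ext fun r j h hi => ?_) v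
  rw [LinearMap.comp_apply, LinearMap.add_apply, LinearMap.comp_apply, contentOp_basisVec, map_smul]
  have h0 : ∀ w : NodeSpace μ (i + 1), (j : ℂ) • w + w = ((j : ℂ) + 1) • w := fun w => by
    rw [add_smul, one_smul]
  rw [h0]
  have h1 : ∀ (c : ℂ) (t : ℕ), contentOp μ (i + 1) (c • basisVec μ (i + 1) t (j + 1)) =
      ((j : ℂ) + 1) • c • basisVec μ (i + 1) t (j + 1) := fun c t => by
    rw [map_smul, contentOp_basisVec, smul_comm]
    push_cast
    rfl
  rcases lt_or_ge j 0 with hj | hj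
  · rw [mapY_basisVec_of_neg θ μ le_rfl h hi hj, map_add, map_sum, h1, smul_add, Finset.smul_sum,
      Finset.sum_congr rfl fun t _ => h1 _ t]
  · rw [mapY_basisVec_of_nonneg θ μ h hi hj, map_sub, map_neg, map_sum, h1, smul_sub, smul_neg,
      Finset.smul_sum, Finset.sum_congr rfl fun t _ => h1 _ t]

theorem contentOp_mapx (c : ℂ) : contentOp μ 0 (mapx θ μ c) = 0 := by
  rw [mapx_apply θ μ le_rfl, map_smul, map_sum, Finset.sum_eq_zero, smul_zero]
  intro t _
  rw [map_smul, contentOp_basisVec, Int.cast_zero, zero_smul, smul_zero]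

theorem coeffAt_contentOp (i : ZMod ℓ) (r : ℕ) (j : ℤ) (v : NodeSpace μ i) :
    coeffAt μ i r j (contentOp μ i v) = j * coeffAt μ i r j v := by
  refine LinearMap.congr_fun (f := coeffAt μ i r j ∘ₗ contentOp μ i)
    (g := (j : ℂ) • coeffAt μ i r j) (nodeSpace_hom_ext fun r' j' h hi => ?_) v
  rw [LinearMap.comp_apply, contentOp_basisVec, map_smul, LinearMap.smul_apply,
    coeffAt_basisVec μ h hi]
  split_ifs with heq
  · rw [(Prod.mk.inj heq).2]
  · rw [smul_zero, smul_zero]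

variable {μ} in
theorem eq_zero_of_coeffAt {i : ZMod ℓ} {v : NodeSpace μ i}
    (h : ∀ r j, (r, j) ∈ hookIndex μ → coeffAt μ i r j v = 0) : v = 0 := by
  have key : ∀ p, coeffAt μ i p.1.1.1 p.1.1.2 v = v p := fun p => by
    refine LinearMap.congr_fun (g := Finsupp.lapply p) (nodeSpace_hom_ext fun r j h hi => ?_) v
    rw [coeffAt_basisVec μ h hi, basisVec_of_mem μ h hi, Finsupp.lapply_apply,
      Finsupp.single_apply]
    refine if_congr ⟨fun h => ?_, fun h => ?_⟩ rfl rfl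
    · exact Subtype.ext (Subtype.ext h)
    · rw [← h]
  exact Finsupp.ext fun p => (key p).symm.trans (h _ _ p.1.2)

variable {θ μ}

/-- A morphism from a simple `A_μ` respects the contents: the vectors on which it commutes with the
content operators form a subrepresentation that contains the space at `∞`. -/
theorem app_contentOp (hs : (repA θ μ).IsSimple) {κ : YoungDiagram}
    (f : QuiverRep.Hom (repA θ μ) (repA θ κ)) (i : ZMod ℓ) (v : NodeSpace μ i) :
    f.app (.node i) (contentOp μ i v) = contentOp κ i (f.app (.node i) v) := by
  let F : ∀ i, NodeSpace μ i →ₗ[ℂ] NodeSpace κ i := fun i => f.app (.node i)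
  have hFX : ∀ i v, F i (mapX μ i v) = mapX κ i (F (i + 1) v) := fun i v => f.comm (Arrow.X i) v
  have hFY : ∀ i v, F (i + 1) (mapY θ μ i v) = mapY θ κ i (F i v) := fun i v => f.comm (Arrow.Y i) v
  let G : ℂ →ₗ[ℂ] ℂ := f.app .inf
  have hFx : ∀ c, F 0 (mapx θ μ c) = mapx θ κ (G c) := fun c => f.comm Arrow.x c
  let D : ∀ i, NodeSpace μ i →ₗ[ℂ] NodeSpace κ i := fun i =>
    F i ∘ₗ contentOp μ i - contentOp κ i ∘ₗ F i
  have hD : ∀ i v, D i v = 0 ↔ F i (contentOp μ i v) = contentOp κ i (F i v) :=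
    fun i v => sub_eq_zero
  have hDX : ∀ i v, D (i + 1) v = 0 → D i (mapX μ i v) = 0 := fun i v hv => by
    rw [hD] at hv ⊢
    rw [contentOp_mapX, map_sub, hFX, hFX, contentOp_mapX, hv]
  have hDY : ∀ i v, D i v = 0 → D (i + 1) (mapY θ μ i v) = 0 := fun i v hv => by
    rw [hD] at hv ⊢
    rw [contentOp_mapY, map_add, hFY, hFY, contentOp_mapY, hv]
  have hDx : ∀ c, D 0 (mapx θ μ c) = 0 := fun c => by
    rw [hD, contentOp_mapx, hFx, contentOp_mapx, map_zero]
  let K : QuiverRep.Subrep (repA θ μ) :=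
    { carrier := fun
        | .node i => LinearMap.ker (D i)
        | .inf => (⊤ : Submodule ℂ ℂ)
      map_mem := by
        intro a b g v hv
        change Arrow ℓ a b at g
        cases g with
        | X i => exact hDX i v hv
        | Y i => exact hDY i v hv
        | x => exact hDx v
        | y => exact Submodule.mem_top (R := ℂ) (M := ℂ) }
  have : IsSimpleOrder (QuiverRep.Subrep (repA θ μ)) := hs
  have hK : K = ⊤ := (eq_bot_or_eq_top K).resolve_left fun h => by
    have h1 : ∀ c, c ∈ K.carrier .inf := fun c => Submodule.mem_top (R := ℂ) (M := ℂ)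
    rw [h] at h1
    exact one_ne_zero (α := ℂ) (h1 (1 : ℂ))
  have h1 : v ∈ K.carrier (.node i) := by
    rw [hK]
    exact Submodule.mem_top (R := ℂ) (M := NodeSpace μ i)
  exact (hD i v).1 h1

/-- An injective morphism from a simple `A_μ` to `A_κ` forces `κ` to have at least as many boxes of
each content as `μ`, and the number of boxes of each content determines a partition. -/
theorem le_of_injective (hs : (repA θ μ).IsSimple) {κ : YoungDiagram}
    (f : QuiverRep.Hom (repA θ μ) (repA θ κ)) (hf : ∀ a, Function.Injective (f.app a)) : μ ≤ κ := by
  intro b hb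
  obtain ⟨r, j, rfl⟩ := exists_boxOf b
  obtain ⟨m, hm⟩ := exists_contentCount μ j
  obtain ⟨n, hn⟩ := exists_contentCount κ j
  have hb' := (hm r).1 ((mem_hookIndex_iff μ r j).2 hb)
  refine (mem_hookIndex_iff κ r j).1 ((hn r).2 (lt_of_lt_of_le hb' ?_))
  let i : ZMod ℓ := j
  let F : NodeSpace μ i →ₗ[ℂ] NodeSpace κ i := f.app (.node i)
  have hF : ∀ v, F (contentOp μ i v) = contentOp κ i (F v) := fun v => app_contentOp hs f i v
  let E : (Fin m → ℂ) →ₗ[ℂ] NodeSpace μ i :=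
    Fintype.linearCombination ℂ fun r : Fin m => basisVec μ i r j
  have hE : ∀ c, E c = ∑ r, c r • basisVec μ i r j := fun c => rfl
  let P : NodeSpace κ i →ₗ[ℂ] (Fin n → ℂ) := LinearMap.pi fun r => coeffAt κ i r j
  have hinj : Function.Injective (P ∘ₗ F ∘ₗ E) := by
    refine (injective_iff_map_eq_zero _).2 fun c hc => ?_
    have h1 : contentOp μ i (E c) = (j : ℂ) • E c := by
      rw [hE, map_sum, Finset.smul_sum]
      exact Finset.sum_congr rfl fun r _ => by rw [map_smul, contentOp_basisVec, smul_comm]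
    have h2 : F (E c) = 0 := by
      refine eq_zero_of_coeffAt fun r' j' h => ?_
      by_cases hj : j' = j
      · subst hj
        exact congrFun hc ⟨r', (hn r').1 h⟩
      · have h3 := coeffAt_contentOp κ i r' j' (F (E c))
        rw [← hF, h1, map_smul, map_smul, smul_eq_mul] at h3
        have h4 : ((j : ℂ) - j') * coeffAt κ i r' j' (F (E c)) = 0 := by rw [sub_mul, h3, sub_self]
        refine (mul_eq_zero.1 h4).resolve_left fun h5 => hj ?_
        exact_mod_cast (sub_eq_zero.1 h5).symm
    have h3 : E c = 0 := hf (.node i) (h2.trans (map_zero F).symm)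
    refine funext fun r => ?_
    have h4 := congrArg (coeffAt μ i r j) h3
    rw [hE, map_sum, map_zero, Finset.sum_eq_single r] at h4
    · rwa [map_smul, coeffAt_basisVec μ ((hm r).2 r.2) rfl, if_pos rfl, smul_eq_mul, mul_one] at h4
    · intro t _ ht
      rw [map_smul, coeffAt_basisVec_of_ne, smul_zero]
      exact fun h => ht (Fin.ext (Prod.mk.inj h).1)
    · exact fun h => absurd (Finset.mem_univ _) h
  simpa using LinearMap.finrank_le_finrank_of_injective hinj

/-- The summand that is nonzero at `∞` in a direct sum of a simple `A_μ` and of representations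
`L(α_i)` determines `μ`. -/
theorem le_of_isomorphic_prod (hs : (repA θ μ).IsSimple) {κ : YoungDiagram}
    (hs' : (repA θ κ).IsSimple) {ι ι' : Type} [Finite ι] [Finite ι']
    {c : ι → ZMod ℓ} {c' : ι' → ZMod ℓ}
    (h : QuiverRep.Isomorphic
      ((repA θ μ).prod (QuiverRep.directSum fun i => simpleAt (c i)))
      ((repA θ κ).prod (QuiverRep.directSum fun i => simpleAt (c' i)))) : μ ≤ κ := by
  obtain ⟨e, he⟩ := h
  let f : QuiverRep.Hom (repA θ μ) (repA θ κ) :=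
    { app := fun a => LinearMap.fst _ _ _ ∘ₗ e.app a ∘ₗ LinearMap.inl _ _ _
      comm := fun {a b} g v => by
        have h1 := e.comm g (v, 0)
        have h2 : (((repA θ μ).prod (QuiverRep.directSum fun i => simpleAt (c i))).map g (v, 0)) =
            ((repA θ μ).map g v, 0) := Prod.ext rfl
          (LinearMap.map_zero ((QuiverRep.directSum fun i => simpleAt (c i)).map g))
        rw [h2] at h1
        exact congrArg Prod.fst h1 }
  have hne : f.app .inf (1 : ℂ) ≠ 0 := fun h0 => by
    have h1 : e.app .inf ((1 : ℂ), 0) = 0 :=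
      Prod.ext h0 (funext fun i => funext fun u => nomatch u)
    have h2 := (he .inf).1 (h1.trans (map_zero _).symm)
    exact one_ne_zero (α := ℂ) (congrArg Prod.fst h2)
  exact le_of_injective hs f fun a => (QuiverRep.bijective_of_isSimple hs hs' f hne a).1

end Content

/-! ### Residues of the boxes of partitions with the same `ℓ`-core -/

section EllCore

theorem count_residue_of_ellStep {ℓ : ℕ} [NeZero ℓ] {lam μ : YoungDiagram} (h : EllStep ℓ lam μ)
    (i : ZMod ℓ) :
    (lam.cells.val.map (residue ℓ)).count i = (μ.cells.val.map (residue ℓ)).count i + 1 := by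
  obtain ⟨hle, hcard, hinj⟩ := h
  have h1 : ((lam.cells \ μ.cells).image (residue ℓ)) = Finset.univ := by
    refine Finset.eq_univ_of_card _ ?_
    rw [Finset.card_image_of_injOn hinj, hcard, ZMod.card]
  have h2 : (lam.cells \ μ.cells).val.map (residue ℓ) = (Finset.univ : Finset (ZMod ℓ)).val := by
    rw [← h1, Finset.image_val_of_injOn hinj]
  have h3 : lam.cells.val = μ.cells.val + (lam.cells \ μ.cells).val := by
    rw [Finset.sdiff_val, add_tsub_cancel_of_le (Finset.val_le_iff.2 hle)]
  rw [h3, Multiset.map_add, Multiset.count_add, h2,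
    Multiset.count_eq_one_of_mem Finset.univ.nodup (Finset.mem_univ i)]

/-- Partitions with the same size and the same `ℓ`-core have the same number of boxes of each
residue. -/
theorem map_residue_eq {ℓ : ℕ} [NeZero ℓ] {ν μ : YoungDiagram} {n : ℕ}
    (h : μ ∈ partitionsWithCore ℓ ν (n * ℓ + ν.card)) (i : ZMod ℓ) :
    (μ.cells.val.map (residue ℓ)).count i = (ν.cells.val.map (residue ℓ)).count i + n := by
  obtain ⟨⟨hreach, -⟩, hcard⟩ := h
  have key : ∃ m, μ.card = m * ℓ + ν.card ∧ ∀ i, (μ.cells.val.map (residue ℓ)).count i =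
      (ν.cells.val.map (residue ℓ)).count i + m := by
    clear hcard
    induction hreach using Relation.ReflTransGen.head_induction_on with
    | refl => exact ⟨0, by simp, by simp⟩
    | @head lam κ hstep _ ih =>
      obtain ⟨m, hm, hc⟩ := ih
      refine ⟨m + 1, ?_, fun i => by rw [count_residue_of_ellStep hstep, hc, add_assoc]⟩
      have h1 := Finset.card_sdiff_add_card_eq_card hstep.1
      rw [hstep.2.1] at h1
      change lam.cells.card = _
      rw [← h1]
      change ℓ + κ.card = _
      rw [hm]
      ring
  obtain ⟨m, hm, hc⟩ := key
  have : m = n := by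
    have h1 : m * ℓ = n * ℓ := by omega
    exact Nat.eq_of_mul_eq_mul_right (Nat.pos_of_ne_zero (NeZero.ne ℓ)) h1
  rw [hc, this]

theorem map_residue_sdiff_eq {ℓ : ℕ} [NeZero ℓ] {ν μ₁ μ₂ lam : YoungDiagram} {n : ℕ}
    (h₁ : μ₁ ∈ partitionsWithCore ℓ ν (n * ℓ + ν.card))
    (h₂ : μ₂ ∈ partitionsWithCore ℓ ν (n * ℓ + ν.card)) (hle₁ : lam ≤ μ₁) (hle₂ : lam ≤ μ₂) :
    (μ₁.cells \ lam.cells).val.map (residue ℓ) = (μ₂.cells \ lam.cells).val.map (residue ℓ) := by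
  have h3 : ∀ {μ : YoungDiagram}, lam ≤ μ → μ.cells.val.map (residue ℓ) =
      lam.cells.val.map (residue ℓ) + (μ.cells \ lam.cells).val.map (residue ℓ) := fun hle => by
    rw [← Multiset.map_add, Finset.sdiff_val, add_tsub_cancel_of_le (Finset.val_le_iff.2 hle)]
  have h4 : μ₁.cells.val.map (residue ℓ) = μ₂.cells.val.map (residue ℓ) :=
    Multiset.ext.2 fun i => by rw [map_residue_eq h₁, map_residue_eq h₂]
  rw [h3 hle₁, h3 hle₂] at h4
  exact add_left_cancel h4

end EllCore

end CMQuiver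

open CMQuiver
theorem mainTheorem8 (ℓ : ℕ) [NeZero ℓ] (J : Set (ZMod ℓ)) (θ : ZMod ℓ → ℂ)
    (hsum : ∑ i, θ i ≠ 0) (hθ : IsJStandard θ J) :
    (∀ μ : YoungDiagram, IsJCore J μ → (repA θ μ).IsSimple) ∧
    (∀ (μ : YoungDiagram) (b : ℕ × ℕ) (hb : IsRemovable μ b), residue ℓ b ∈ J →
      QuiverRep.HasShortExact (simpleAt (residue ℓ b)) (repA θ μ) (repA θ (eraseBox μ b hb)) ∨
      QuiverRep.HasShortExact (repA θ (eraseBox μ b hb)) (repA θ μ) (simpleAt (residue ℓ b))) ∧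
    (∀ μ : YoungDiagram,
      (repA θ (coreJ J μ)).IsSimple ∧
      (∀ b ∈ μ.cells \ (coreJ J μ).cells, (simpleAt (residue ℓ b)).IsSimple) ∧
      QuiverRep.Isomorphic (repA θ μ).semisimplification
        (QuiverRep.prod (repA θ (coreJ J μ))
          (QuiverRep.directSum
            fun b : {b : ℕ × ℕ // b ∈ μ.cells \ (coreJ J μ).cells} =>
              simpleAt (residue ℓ b.1)))) ∧
    (∀ (ν : YoungDiagram) (n : ℕ) (μ₁ μ₂ : YoungDiagram), IsEllCore ℓ ν →
      μ₁ ∈ partitionsWithCore ℓ ν (n * ℓ + ν.card) →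
      μ₂ ∈ partitionsWithCore ℓ ν (n * ℓ + ν.card) →
      (QuiverRep.Isomorphic (repA θ μ₁).semisimplification (repA θ μ₂).semisimplification ↔
        coreJ J μ₁ = coreJ J μ₂)) := by
  have hcore : ∀ μ, Relation.ReflTransGen (JStep J) μ (coreJ J μ) ∧ IsJCore J (coreJ J μ) :=
    fun μ => Classical.choose_spec (exists_coreJ J μ)
  have hsimple : ∀ μ, (repA θ (coreJ J μ)).IsSimple := fun μ =>
    repA_isSimple_of_isJCore hsum hθ (hcore μ).2
  have hfac := fun μ => hasFactors_repA (fun i hi => (hθ.2 i).1 hi) (hcore μ).1 (hsimple μ)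
  have hss := fun μ => semisimplification_of_hasFactors _ _ (hfac μ)
  refine ⟨fun μ hμ => repA_isSimple_of_isJCore hsum hθ hμ,
    fun μ b hb hbJ => hasShortExact_eraseBox θ μ b hb ((hθ.2 _).1 hbJ),
    fun μ => ⟨hsimple μ, fun b _ => simpleAt_isSimple _, hss μ⟩,
    fun ν n μ₁ μ₂ _ h₁ h₂ => ⟨fun h => ?_, fun h => ?_⟩⟩
  · have h' := ((hss μ₁).symm.trans h).trans (hss μ₂)
    exact le_antisymm (le_of_isomorphic_prod (hsimple μ₁) (hsimple μ₂) h')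
      (le_of_isomorphic_prod (hsimple μ₂) (hsimple μ₁) h'.symm)
  · have hres := map_residue_sdiff_eq h₁ h₂ (le_of_reach (hcore μ₁).1)
      (by rw [h]; exact le_of_reach (hcore μ₂).1)
    have hmap := congrArg (Multiset.map fun i => simpleAt i) hres
    rw [Multiset.map_map, Multiset.map_map, h] at hmap
    have hf₁ := hfac μ₁
    rw [h] at hf₁
    exact (semisimplification_of_hasFactors _ (fun b => simpleAt (residue ℓ b))
      (hmap ▸ hf₁)).trans (hss μ₂).symm
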